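/- Conventions. $k$ is the security parameter. A PPT algorithm is a probabilistic algorithm that runs in polynomial time; a function $f:\mathbb N\to\mathbb R$ is negligible if $k^c f(k)\to 0$ for every $c$. An $n$-group system consists of cyclic groups $\mathbb G_1,\dots,\mathbb G_n$ of the same prime order $p$ with maps $\hat e_{i,j}:\mathbb G_i\times\mathbb G_j\to\mathbb G_{i+j}$ ($i+j\le n$) such that $\hat e_{i,j}(g_i^a,g_j^b)=g_{i+j}^{ab}$ for suitable generators $g_i$ of $\mathbb G_i$; this is extended to the group $\mathbb G_0=\mathbb Z_p$ of exponents by $\hat e_{0,j}(a,h)=h^a$. Write $\hat e(h_1,\dots,h_j)=\hat e(h_1,\hat e(h_2,\dots))$ and $\hat e(h_1)=h_1$. Let $\ell=\ell(k)\ge 1$ be polynomially bounded (for example constant), and let $\mathbf{MG}$ be a PPT algorithm that on input $1^k$ outputs the description of an $(\ell+1)$-group system, including $p$, in which elements have unique representations of polynomial length and products and the maps $\hat e_{i,j}$ are computable in polynomial time. The group system is an implicit input of all algorithms below. The $(\ell+1)$-MDDH assumption says: for a group system output by $\mathbf{MG}(1^k)$, uniform $g\in\mathbb G_1$ and uniform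 $x_1,\dots,x_{\ell+2}\in\mathbb Z_p$, no PPT algorithm that gets $g,g^{x_1},\dots,g^{x_{\ell+2}}$ distinguishes $\hat e(g^{x_1},\dots,g^{x_{\ell+1}})^{x_{\ell+2}}$ from a uniform element of $\mathbb G_{\ell+1}$ with non-negligible advantage. A group hash function $\mathbf H$ into $\mathbb G_\ell$ consists of a PPT algorithm $\mathbf{HGen}(1^k)$ that outputs a key $hk$ and a deterministic polynomial-time evaluation $\mathbf H_{hk}:\{0,1\}^k\to\mathbb G_\ell$. It is a $(\mathsf{poly},2)$-MPHF if for every polynomial $q$ there are a PPT algorithm $\mathbf{TGen}$ and a deterministic polynomial-time algorithm $\mathbf{TEval}$, a polynomial $P>0$ and negligible functions $\nu,\nu'$ such that for all $k$, all group systems output by $\mathbf{MG}(1^k)$, all $c_1,\dots,c_\ell\in\mathbb G_1$ and all $1\ne h\in\mathbb G_1$, the pair $(hk,td)$ output by $\mathbf{TGen}(1^k,c_1,\dots,c_\ell,h)$ satisfies: (i) the distribution of $hk$ has statistical distance at most $\nu(k)$ from that of $\mathbf{HGen}(1^k)$; (ii) for every $X\in\{0,1\}^k$, $\mathbf{TEval}(td,X)$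 is a pair $(a_X,B_X)\in\mathbb Z_p\times\mathbb G_{\ell-1}$ with $\mathbf H_{hk}(X)=\hat e(c_1,\dots,c_\ell)^{a_X}\cdot\hat e(B_X,h)$; (iii) for all $X_1,\dots,X_{q(k)},Z_1,Z_2\in\{0,1\}^k$ with $X_i\ne Z_j$ for all $i,j$, the conditional probability given $hk$ $$P_{hk}=\Pr[a_{X_1}=\dots=a_{X_{q(k)}}=0\ \wedge\ a_{Z_1}\ne0\ \wedge\ a_{Z_2}\neq 0]$$ is at least $1/P(k)$ for all $hk$ in the range of $\mathbf{TGen}(1^k,c_1,\dots,c_\ell,h)$, and $|P_{hk}-P_{hk'}|\le\nu'(k)$ for all $hk,hk'$ in this range. The IBKEM scheme, with identities in $\{0,1\}^k$: the setup runs $\mathbf{MG}(1^k)$ and $\mathbf{HGen}(1^k)$, chooses uniform $h\in\mathbb G_1$ and $x\in\mathbb Z_p$, and outputs the public key consisting of the group system, $hk$, $h$ and $h^x$, and the secret key $(hk,x)$; the decryption key of $ID$ is $\mathbf H_{hk}(ID)^x$; the encapsulation for $ID$ with random value $r\in\mathbb Z_p^*$ yields the key $\hat K=\hat e(\mathbf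 H_{hk}(ID),h^x)^r\in\mathbb G_{\ell+1}$ and the encapsulation $\hat C=h^r$; the decapsulation of $\hat C\in\mathbb G_1$ with a decryption key $\hat S$ is $\hat e(\hat C,\hat S)$. In the Anon-SS-ID-CPA game, a PPT adversary gets the public key, adaptively queries decryption keys of identities, and submits two identities $ID_0^*,ID_1^*$. For a uniform bit $d$ and independent uniform random values $r_0,r_1\in\mathbb Z_p^*$ it gets $(\hat K_d,\hat C_0)$, where $(\hat K_j,\hat C_j)$ is the encapsulation for $ID_j^*$ with $r_j$; it makes further queries and outputs a guess $d'$. It may query the decryption key of neither challenge identity at any time. The scheme is Anon-SS-ID-CPA secure if $\Pr[d'=d]-\frac12$ is negligible for every such adversary. **Theorem.** Suppose that the above IBKEM scheme is implemented in an $(\ell+1)$-group system generated by $\mathbf{MG}$ and with a $(\mathsf{poly},2)$-MPHF $\mathbf H$ into $\mathbb G_\ell$. Then, under the $(\ell+1)$-MDDH assumption for $\mathbf{MG}$, the scheme is Anon-SS-ID-CPA secure. -/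

import Mathlib

open Filter Asymptotics

/-! ## Data and a programming language with a cost model -/

/-- Finite binary trees, the data on which algorithms work. Bit strings, lists, pairs and numbers are
represented by trees in the obvious way. -/
inductive Data : Type
  | leaf : Data
  | node : Data → Data → Data

namespace Data

/-- Number of nodes of a tree, leaves included. -/
def size : Data → ℕ
  | leaf => 1
  | node a b => a.size + b.size + 1

/-- First component (a leaf for a leaf). -/
def fst : Data → Data
  | leaf => leaf
  | node a _ => a

/-- Second component (a leaf for a leaf). -/
def snd : Data → Data
  | leaf => leaf
  | node _ b => b

/-- A list, as a right-nested tree that ends in a leaf. -/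
def list : List Data → Data
  | [] => leaf
  | x :: xs => node x (list xs)

/-- The two bits: `0` is a leaf and `1` is a tree with two leaves. -/
def bit : Bool → Data
  | false => leaf
  | true => node leaf leaf

/-- A bit string. -/
def bits (w : List Bool) : Data := list (w.map bit)

/-- A bit string of given length. -/
def str {n : ℕ} (w : Fin n → Bool) : Data := bits (List.ofFn w)

/-- The unary numeral `1^n`. -/
def unary (n : ℕ) : Data := list (List.replicate n leaf)

/-- The binary numeral of `n`, least significant bit first and without leading zeros. -/
def nat (n : ℕ) : Data := bits n.bits

end Data

/-- Programs of a WHILE language over trees. Every program maps a tree to a tree. -/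
inductive Code : Type
  | nil : Code
  | id : Code
  | fst : Code
  | snd : Code
  /-- equality test of the two components of the input -/
  | eq : Code
  | pair : Code → Code → Code
  /-- `comp g f` runs `f` and then `g` -/
  | comp : Code → Code → Code
  /-- `ite b f g` runs `g` if `b` returns a leaf and `f` otherwise -/
  | ite : Code → Code → Code → Code
  /-- `loop b f` repeats `f` as long as `b` does not return a leaf -/
  | loop : Code → Code → Code

/-- `Eval c v u t`: program `c` halts on input `v` with output `u` after time `t`. Every elementary
operation is charged the size of the tree that it reads, so that no program can
write more than its running time, and this time is polynomially related to that of
a Turing machine. -/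
inductive Eval : Code → Data → Data → ℕ → Prop
  | nil (v) : Eval .nil v .leaf v.size
  | id (v) : Eval .id v v v.size
  | fst (v) : Eval .fst v v.fst v.size
  | snd (v) : Eval .snd v v.snd v.size
  | eq_true (v) : v.fst = v.snd → Eval .eq v (Data.bit true) (v.size + 3)
  | eq_false (v) : v.fst ≠ v.snd → Eval .eq v (Data.bit false) (v.size + 3)
  | pair {f g v u w s t} : Eval f v u s → Eval g v w t →
      Eval (.pair f g) v (.node u w) (s + t + 1)
  | comp {f g v u w s t} : Eval f v u s → Eval g u w t → Eval (.comp g f) v w (s + t + 1)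
  | ite_true {b f g v u w s t} : Eval b v u s → u ≠ .leaf → Eval f v w t →
      Eval (.ite b f g) v w (s + t + 1)
  | ite_false {b f g v w s t} : Eval b v .leaf s → Eval g v w t →
      Eval (.ite b f g) v w (s + t + 1)
  | loop_done {b f v s} : Eval b v .leaf s → Eval (.loop b f) v v (s + v.size + 1)
  | loop_step {b f v u v' w s t r} : Eval b v u s → u ≠ .leaf → Eval f v v' t →
      Eval (.loop b f) v' w r → Eval (.loop b f) v w (s + t + r + 1)

/-- `f` is computed by a program whose running time is at most a polynomial in the input size. -/
def PolyTime (f : Data → Data) : Prop :=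
  ∃ (c : Code) (P : Polynomial ℕ), ∀ v, ∃ t, Eval c v (f v) t ∧ t ≤ P.eval v.size

/-! ## Probability and probabilistic polynomial time -/

/-- The probability of an event. -/
noncomputable def prob {α : Type*} (μ : PMF α) (S : Set α) : ℝ := (μ.toOuterMeasure S).toReal

/-- The statistical distance of `μ` and `μ'` is at most `ε`. -/
def StatClose {α : Type*} (ε : ℝ) (μ μ' : PMF α) : Prop := ∀ S : Set α, |prob μ S - prob μ' S| ≤ ε

/-- Negligible functions of the security parameter. -/
def Negligible (f : ℕ → ℝ) : Prop := SuperpolynomialDecay atTop (fun k : ℕ => (k : ℝ)) f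

/-- Polynomially bounded functions of the security parameter. -/
def PolyBounded (f : ℕ → ℕ) : Prop := ∃ P : Polynomial ℕ, ∀ k, f k ≤ P.eval k

/-- A probabilistic polynomial-time algorithm: a polynomial-time function of the security parameter
`1^k`, the input and a random tape, which is a uniform bit string of length polynomial in `k`. -/
structure PPT where
  fn : Data → Data
  polyTime : PolyTime fn
  coins : Polynomial ℕ

/-- The output distribution of a PPT algorithm on input `(1^k, x)`. -/
noncomputable def PPT.run (A : PPT) (k : ℕ) (x : Data) : PMF Data :=
  (PMF.uniformOfFintype (Fin (A.coins.eval k) → Bool)).map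
    fun ω => A.fn (Data.list [Data.unary k, x, Data.str ω])

/-! ## Multilinear group systems -/

/-- An `n`-group system: cyclic groups `G 1, …, G n` of prime order `p`, together with the group
`G 0` of exponents modulo `p`, with maps `e_{i,j} : G i × G j → G (i+j)` for `i + j ≤ n` that satisfy
`e_{i,j}(g_i^a, g_j^b) = g_{i+j}^{ab}` for suitable generators `g_i`. Group elements have unique
representations as data, exponents being written in binary. Only the levels up to `n` carry any
meaning. -/
structure GroupSystem (n : ℕ) where
  p : ℕ
  prime : p.Prime
  G : ℕ → Type
  [group : ∀ i, CommGroup (G i)]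
  [fin : ∀ i, Fintype (G i)]
  card_eq : ∀ i ≤ n, Fintype.card (G i) = p
  gen : ∀ i, G i
  gen_spec : ∀ i ≤ n, ∀ x : G i, x ∈ Subgroup.zpowers (gen i)
  /-- the map `e_{i,j}`; its target is `G l` for `l = i + j` -/
  e : ∀ {i j l : ℕ}, i + j = l → G i → G j → G l
  e_gen : ∀ {i j l : ℕ} (h : i + j = l), l ≤ n → ∀ a b : ℕ,
    e h (gen i ^ a) (gen j ^ b) = gen l ^ (a * b)
  enc : ∀ i, G i → Data
  enc_injective : ∀ i ≤ n, Function.Injective (enc i)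
  enc_zero : ∀ a < p, enc 0 (gen 0 ^ a) = Data.nat a

namespace GroupSystem

attribute [instance] GroupSystem.group GroupSystem.fin

variable {n : ℕ} (Γ : GroupSystem n)

instance : Fact Γ.p.Prime := ⟨Γ.prime⟩

/-- The iterated map `e(h₁, …, h_j) = e(h₁, e(h₂, … e(h_{j-1}, h_j)…))` on `G 1`, with `e(h) = h`. It is
used for `j ≥ 1` only. -/
def multi : ∀ j : ℕ, (Fin j → Γ.G 1) → Γ.G j
  | 0, _ => 1
  | 1, h => h 0
  | j + 2, h => Γ.e (Nat.add_comm 1 (j + 1)) (h 0) (multi (j + 1) fun i => h i.succ)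

/-- Exponentiation with exponents modulo `p`. -/
def pow {i : ℕ} (g : Γ.G i) (x : ZMod Γ.p) : Γ.G i := g ^ x.val

end GroupSystem

/-- A generator of `n`-group systems, where the number `n` of levels may grow with the security
parameter. On input `1^k` it outputs a description `pp` of a group system. Given `pp`, the
order is known, elements have representations of polynomial length, and products
and the maps `e_{i,j}` (exponentiation being `e_{0,j}`) can be computed in polynomial time. -/
structure GroupGen (n : ℕ → ℕ) where
  gen : PPT
  sys : ∀ k, Data → GroupSystem (n k)
  levels : PolyBounded n
  enc_size : ∃ P : Polynomial ℕ, ∀ k, ∀ pp ∈ (gen.run k .leaf).support, ∀ i ≤ n k,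
    ∀ x : (sys k pp).G i, ((sys k pp).enc i x).size ≤ P.eval k
  order_eff : ∃ f, PolyTime f ∧ ∀ k, ∀ pp ∈ (gen.run k .leaf).support,
    f (Data.list [Data.unary k, pp]) = Data.nat (sys k pp).p
  mul_eff : ∃ f, PolyTime f ∧ ∀ k, ∀ pp ∈ (gen.run k .leaf).support, ∀ i ≤ n k,
    ∀ x y : (sys k pp).G i,
      f (Data.list [Data.unary k, pp, Data.unary i, (sys k pp).enc i x, (sys k pp).enc i y])
        = (sys k pp).enc i (x * y)
  e_eff : ∃ f, PolyTime f ∧ ∀ k, ∀ pp ∈ (gen.run k .leaf).support,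
    ∀ i j l, ∀ h : i + j = l, l ≤ n k → ∀ (x : (sys k pp).G i) (y : (sys k pp).G j),
      f (Data.list [Data.unary k, pp, Data.unary i, Data.unary j,
          (sys k pp).enc i x, (sys k pp).enc j y])
        = (sys k pp).enc l ((sys k pp).e h x y)

namespace GroupGen

variable {n : ℕ → ℕ} (M : GroupGen n)

/-- The distribution of the descriptions of group systems for security parameter `k`. -/
noncomputable def params (k : ℕ) : PMF Data := M.gen.run k .leaf

/-- An MDDH challenge `(pp, g, g^{x₁}, …, g^{x_{n+1}}, S)` for a group system with `n` levels, where
`S` is `e(g^{x₁}, …, g^{x_n})^{x_{n+1}}` if `real` is true and a uniform element of `G n` otherwise. -/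
noncomputable def mddhChallenge (real : Bool) (k : ℕ) : PMF Data :=
  (M.params k).bind fun pp =>
    let Γ := M.sys k pp
    (PMF.uniformOfFintype (Γ.G 1)).bind fun g =>
    (PMF.uniformOfFintype (Fin (n k + 1) → ZMod Γ.p)).bind fun x =>
    (PMF.uniformOfFintype (Γ.G (n k))).map fun R =>
      let S := if real then
          Γ.pow (Γ.multi (n k) fun i => Γ.pow g (x i.castSucc)) (x (Fin.last (n k)))
        else R
      Data.list [pp, Γ.enc 1 g, Data.list (List.ofFn fun i => Γ.enc 1 (Γ.pow g (x i))),
        Γ.enc (n k) S]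

/-- The MDDH assumption for group systems with `n` levels (the `n`-MDDH assumption): no PPT algorithm,
whose output is read as `1` unless it is a leaf, distinguishes real from random challenges. -/
def MDDH : Prop :=
  ∀ D : PPT, Negligible fun k =>
    prob ((M.mddhChallenge true k).bind (D.run k)) {b | b ≠ .leaf}
      - prob ((M.mddhChallenge false k).bind (D.run k)) {b | b ≠ .leaf}

end GroupGen

/-! ## Group hash functions and programmability -/

/-- A group hash function into `G ℓ`, for `1 ≤ ℓ ≤ n`: a PPT key generator (given `1^k` and the group
system) and a polynomial-time evaluation on bit strings of length `k`. -/
structure GroupHash {n : ℕ → ℕ} (M : GroupGen n) (ℓ : ℕ → ℕ) where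
  one_le : ∀ k, 1 ≤ ℓ k
  le : ∀ k, ℓ k ≤ n k
  hgen : PPT
  eval : ∀ k pp, Data → (Fin k → Bool) → (M.sys k pp).G (ℓ k)
  eval_eff : ∃ f, PolyTime f ∧ ∀ k, ∀ pp ∈ (M.params k).support,
    ∀ hk ∈ (hgen.run k pp).support, ∀ X : Fin k → Bool,
      f (Data.list [Data.unary k, pp, hk, Data.str X]) = (M.sys k pp).enc (ℓ k) (eval k pp hk X)

namespace GroupHash

variable {n : ℕ → ℕ} {M : GroupGen n} {ℓ : ℕ → ℕ} (H : GroupHash M ℓ)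

/-- The distribution of the pairs `(hk, td)` output by a trapdoor key generator `T` on input
`(1^k, c₁, …, c_ℓ, h)`. -/
noncomputable def trapKeys (_H : GroupHash M ℓ) (T : PPT) (k : ℕ) (pp : Data)
    (c : Fin (ℓ k) → (M.sys k pp).G 1) (h : (M.sys k pp).G 1) : PMF (Data × Data) :=
  (T.run k (Data.list [pp, Data.list (List.ofFn fun i => (M.sys k pp).enc 1 (c i)),
    (M.sys k pp).enc 1 h])).map fun o => (o.fst, o.snd)

/-- `P_{hk,X,Z}`: the probability that `a_X = 0` for all `X` in the first family and `a_Z ≠ 0` for all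
`Z` in the second, over the trapdoors that come along with `hk`. -/
noncomputable def progProb {α : Type*} [Zero α] {k r s : ℕ} (μ : PMF (Data × Data))
    (a : Data → (Fin k → Bool) → α) (hk : Data)
    (X : Fin r → Fin k → Bool) (Z : Fin s → Fin k → Bool) : ℝ :=
  prob μ {o | o.1 = hk ∧ (∀ i, a o.2 (X i) = 0) ∧ ∀ j, a o.2 (Z j) ≠ 0} / prob μ {o | o.1 = hk}

/-- `H` is an `(r, s)`-programmable hash function in the multilinear setting: there are a PPT algorithm
`T` (the trapdoor key generation) and a polynomial-time algorithm `f` (the trapdoor evaluation,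
whose output on `td` and `X` consists of `a td X` and `B td X`) such that
the hash keys of `T` are statistically close to genuine ones, the hash function is computed
by `e(c₁, …, c_ℓ)^{a_X} · e(B_X, h)`, the probabilities `P_{hk,X,Z}` are at least
the inverse of a polynomial, and they are up to a negligible error independent of `hk`. -/
def IsMPHF (r : ℕ → ℕ) (s : ℕ) : Prop :=
  ∃ (T : PPT) (f : Data → Data)
    (a : ∀ k pp, Data → (Fin k → Bool) → ZMod (M.sys k pp).p)
    (B : ∀ k pp, Data → (Fin k → Bool) → (M.sys k pp).G (ℓ k - 1))
    (P : Polynomial ℕ) (ν ν' : ℕ → ℝ),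
    PolyTime f ∧ (∀ k, 0 < P.eval k) ∧ Negligible ν ∧ Negligible ν' ∧
    ∀ k, ∀ pp ∈ (M.params k).support, ∀ (c : Fin (ℓ k) → (M.sys k pp).G 1) (h : (M.sys k pp).G 1),
      h ≠ 1 →
      StatClose (ν k) ((H.trapKeys T k pp c h).map Prod.fst) (H.hgen.run k pp) ∧
      (∀ o ∈ (H.trapKeys T k pp c h).support, ∀ X : Fin k → Bool,
        f (Data.list [Data.unary k, pp, o.2, Data.str X])
          = Data.node (Data.nat (a k pp o.2 X).val)
              ((M.sys k pp).enc (ℓ k - 1) (B k pp o.2 X)) ∧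
        H.eval k pp o.1 X
          = (M.sys k pp).pow ((M.sys k pp).multi (ℓ k) c) (a k pp o.2 X)
            * (M.sys k pp).e (Nat.sub_add_cancel (H.one_le k)) (B k pp o.2 X) h) ∧
      ∀ (X : Fin (r k) → Fin k → Bool) (Z : Fin s → Fin k → Bool), (∀ i j, X i ≠ Z j) →
        ∀ o ∈ (H.trapKeys T k pp c h).support,
          1 / ((P.eval k : ℕ) : ℝ) ≤ progProb (H.trapKeys T k pp c h) (a k pp) o.1 X Z ∧
          ∀ o' ∈ (H.trapKeys T k pp c h).support,
            |progProb (H.trapKeys T k pp c h) (a k pp) o.1 X Z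
              - progProb (H.trapKeys T k pp c h) (a k pp) o'.1 X Z| ≤ ν' k

/-- `(poly, s)`-programmability: `(q(k), s)`-programmability for every polynomial `q`. -/
def IsPolyMPHF (s : ℕ) : Prop := ∀ q : Polynomial ℕ, H.IsMPHF (fun k => q.eval k) s

end GroupHash

/-! ## Identity-based key encapsulation and its security -/

/-- An identity-based key encapsulation mechanism. Decryption keys, encapsulated keys and encapsulations
are data; the random value of an encapsulation is uniform on `Rnd pk`; invalid
encapsulations are answered by `none`. -/
structure IBKEM where
  Id : ℕ → Type
  idStr : ∀ {k}, Id k → Data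
  idStr_injective : ∀ {k}, Function.Injective (idStr : Id k → Data)
  PK : ℕ → Type
  SK : ℕ → Type
  pkStr : ∀ {k}, PK k → Data
  setup : ∀ k, PMF (PK k × SK k)
  extract : ∀ {k}, SK k → Id k → Data
  Rnd : ∀ {k}, PK k → Type
  [rndFintype : ∀ {k} (pk : PK k), Fintype (Rnd pk)]
  [rndNonempty : ∀ {k} (pk : PK k), Nonempty (Rnd pk)]
  /-- the key and its encapsulation -/
  encaps : ∀ {k} (pk : PK k), Id k → Rnd pk → Data × Data
  decaps : ∀ {k}, PK k → Data → Data → Option Data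

/-- A PPT adversary with an oracle, as a polynomial-time next-message function. It is applied to
`1^k`, the public key, a uniform random tape of polynomial length and the messages
received so far, and it makes a polynomial number of oracle queries in each phase. -/
structure Adversary where
  next : Data → Data
  polyTime : PolyTime next
  coins : Polynomial ℕ
  queries : Polynomial ℕ

open Classical in
/-- A query phase with at most `m` queries. The function `next` maps the answers received so far to the
next message: a pair whose first component is not a leaf is a query of the second component, and a
pair `(leaf, m)` ends the phase with the message `m`. The result consists of that last
message, the answers and the queries of this phase. -/
noncomputable def queryPhase (next : List Data → Data) (oracle : Data → Data) :
    ℕ → List Data → List Data → Data × List Data × List Data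
  | 0, ans, asked => ((next ans).snd, ans, asked)
  | m + 1, ans, asked =>
    if (next ans).fst = .leaf then ((next ans).snd, ans, asked)
    else queryPhase next oracle m (ans ++ [oracle (next ans).snd]) ((next ans).snd :: asked)

namespace IBKEM

attribute [instance] IBKEM.rndFintype IBKEM.rndNonempty

variable (E : IBKEM)

/-- The identity that is represented by given data, if any. -/
noncomputable def parseId (k : ℕ) (d : Data) : Option (E.Id k) :=
  Function.partialInv (E.idStr : E.Id k → Data) d

open Classical in
/-- The decryption key oracle, which answers a leaf to data that do not represent an identity and to
the identities in `forbidden`. -/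
noncomputable def keyOracle {k : ℕ} (sk : E.SK k) (forbidden : Set (E.Id k)) (d : Data) : Data :=
  match E.parseId k d with
  | none => .leaf
  | some i => if i ∈ forbidden then .leaf else E.extract sk i

/-- The challenge `(K_d, C_0)`, where `(K_j, C_j)` is the encapsulation for the identity `i_j` with the
random value `r_j`. -/
def challenge {k : ℕ} (pk : E.PK k) (i₀ i₁ : E.Id k) (r₀ r₁ : E.Rnd pk) (d : Bool) : Data :=
  .node (if d then (E.encaps pk i₁ r₁).1 else (E.encaps pk i₀ r₀).1) (E.encaps pk i₀ r₀).2

open Classical in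
/-- The guess of the adversary in the security game with all random choices fixed. The adversary makes
key queries and submits two challenge identities (which it must not have queried), gets the challenge, makes key queries again
(but none for the challenge identities) and outputs a guess, which is read as `1` unless it is a leaf.
If the challenge identities are not admissible, the guess is `0`. -/
noncomputable def guess (A : Adversary) {k : ℕ} (pk : E.PK k) (sk : E.SK k) (tape : Data)
    (r₀ r₁ : E.Rnd pk) (d : Bool) : Bool :=
  let view (ans : List Data) (rest : Data) : Data :=
    A.next (Data.list [Data.unary k, E.pkStr pk, tape, Data.list ans, rest])
  let phase1 := queryPhase (fun ans => view ans .leaf) (E.keyOracle sk ∅) (A.queries.eval k) [] []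
  match E.parseId k phase1.1.fst, E.parseId k phase1.1.snd with
  | some i₀, some i₁ =>
    if E.idStr i₀ ∈ phase1.2.2 ∨ E.idStr i₁ ∈ phase1.2.2 then false
    else
      let phase2 := queryPhase
        (fun ans => view phase1.2.1 (.node (E.challenge pk i₀ i₁ r₀ r₁ d) (Data.list ans)))
        (E.keyOracle sk {i₀, i₁}) (A.queries.eval k) [] []
      decide (phase2.1 ≠ .leaf)
  | _, _ => false

/-- The Anon-SS-ID-CPA game, whose value tells whether the adversary wins. -/
noncomputable def game (A : Adversary) (k : ℕ) : PMF Bool :=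
  (E.setup k).bind fun keys =>
  (PMF.uniformOfFintype (Fin (A.coins.eval k) → Bool)).bind fun ω =>
  (PMF.uniformOfFintype (E.Rnd keys.1 × E.Rnd keys.1)).bind fun r =>
  (PMF.uniformOfFintype Bool).map fun d =>
    E.guess A keys.1 keys.2 (Data.str ω) r.1 r.2 d == d

/-- Anon-SS-ID-CPA security: every PPT adversary has negligible advantage. -/
def AnonSSIDCPA : Prop :=
  ∀ A : Adversary, Negligible fun k => prob (E.game A k) {true} - 1 / 2

end IBKEM

/-! ## The scheme -/

section Scheme

/-- The public key `(pp, hk, h, h^x)` of the scheme; `pp` describes the group system. -/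
structure MasterPublic {n : ℕ → ℕ} (M : GroupGen n) (k : ℕ) where
  pp : Data
  hk : Data
  h : (M.sys k pp).G 1
  h' : (M.sys k pp).G 1

/-- The secret key `(hk, x)` of the scheme, together with the description `pp` of the group system. -/
structure MasterSecret {n : ℕ → ℕ} (M : GroupGen n) (k : ℕ) where
  pp : Data
  hk : Data
  x : ZMod (M.sys k pp).p

theorem Data.bit_injective : Function.Injective Data.bit := by
  intro a b h
  cases a <;> cases b <;> simp_all [Data.bit]

theorem Data.list_injective : Function.Injective Data.list := by
  intro a
  induction a with
  | nil => intro b h; cases b <;> simp_all [Data.list]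
  | cons x xs ih =>
    intro b h
    cases b with
    | nil => simp [Data.list] at h
    | cons y ys =>
      simp only [Data.list, Data.node.injEq] at h
      rw [h.1, ih h.2]

theorem Data.str_injective {k : ℕ} : Function.Injective (Data.str : (Fin k → Bool) → Data) := by
  intro v w h
  exact List.ofFn_injective (Data.bit_injective.list_map (Data.list_injective h))

open Classical in
/-- The IBKEM in an `(ℓ+1)`-group system with a hash function into `G ℓ`; the identities are the bit
strings of length `k`. With `H = H_{hk}`, the decryption key of `ID` is `H(ID)^x`, the encapsulation with random
value `r` in `ℤ_p^*` is the key `e(H(ID), h^x)^r` with the capsule `h^r`, and `C` is decapsulated with the decryption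
key `S` to `e(C, S)`. -/
noncomputable def multilinearIBKEM (ℓ : ℕ → ℕ) (M : GroupGen fun k => ℓ k + 1)
    (H : GroupHash M ℓ) : IBKEM where
  Id k := Fin k → Bool
  idStr := Data.str
  idStr_injective := @Data.str_injective
  PK := MasterPublic M
  SK := MasterSecret M
  pkStr {k} pk := Data.list [pk.pp, pk.hk, (M.sys k pk.pp).enc 1 pk.h, (M.sys k pk.pp).enc 1 pk.h']
  setup k :=
    (M.params k).bind fun pp =>
    (H.hgen.run k pp).bind fun hk =>
    (PMF.uniformOfFintype ((M.sys k pp).G 1)).bind fun h =>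
    (PMF.uniformOfFintype (ZMod (M.sys k pp).p)).map fun x =>
      (⟨pp, hk, h, (M.sys k pp).pow h x⟩, ⟨pp, hk, x⟩)
  extract {k} sk i :=
    (M.sys k sk.pp).enc (ℓ k) ((M.sys k sk.pp).pow (H.eval k sk.pp sk.hk i) sk.x)
  Rnd {k} pk := (ZMod (M.sys k pk.pp).p)ˣ
  rndFintype {_} _ := inferInstance
  rndNonempty {_} _ := inferInstance
  encaps {k} pk i r :=
    ((M.sys k pk.pp).enc (ℓ k + 1) ((M.sys k pk.pp).pow
        ((M.sys k pk.pp).e rfl (H.eval k pk.pp pk.hk i) pk.h') (r : ZMod (M.sys k pk.pp).p)),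
      (M.sys k pk.pp).enc 1 ((M.sys k pk.pp).pow pk.h (r : ZMod (M.sys k pk.pp).p)))
  decaps {k} pk S C :=
    match Function.partialInv ((M.sys k pk.pp).enc 1) C,
      Function.partialInv ((M.sys k pk.pp).enc (ℓ k)) S with
    | some c, some s => some ((M.sys k pk.pp).enc (ℓ k + 1)
        ((M.sys k pk.pp).e (Nat.add_comm 1 (ℓ k)) c s))
    | _, _ => none

end Scheme

/-! An MDDH challenge `(g, g^{x_1}, …, g^{x_{ℓ+2}}, S)` is read as an instance of the scheme: `h =
g`, `h^x = g^{x_{ℓ+1}}`, capsule `C = g^{x_{ℓ+2}}`, and `c_i = g^{x_i}` for `i ≤ ℓ`, with a hash key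
that is generated together with a trapdoor. If `a_X = 0`, then `H(X) = e(B_X, h)` and the decryption
key `H(X)^x = e(B_X, h^x)` can be computed. If `a_Z ≠ 0`, the value `S^{a_Z} · e(e(B_Z, C), h^x)` is
the genuine challenge key of `Z` when `S` is real, and uniform when `S` is. So the simulation is
perfect on every transcript for which the trapdoor is good: `a ≠ 0` at the first challenge identity
and `a = 0` at all revealed ones (`GroupSystem.challenge_eq`, `simRun_eq_some_iff`,
`avg_acceptProb_idealRun`).

The probability that the trapdoor is good, given the hash key, is at least `1/P` and almost
independent of the key, but it depends on the transcript. An artificial abort removes this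
dependence. The distinguisher draws `J` uniformly from `0, …, N-1` and outputs the guess of the
adversary only if its trapdoor is good and `J` fresh trapdoors are all bad for the transcript. If a
fresh trapdoor is good with probability `p`, then `p · E[(1-p)^J] = (1 - (1-p)^N)/N` by the
geometric series (`mul_failProb`), so `p` never has to be estimated. For `N > kP` this is `1/N` up
to an exponentially small relative error. Hence `N` times the acceptance probability is close to the
probability that the adversary outputs `1` (`abs_acceptProb_sub_le`), and by MDDH the genuine key of
the first challenge identity is indistinguishable from a uniform one (`negligible_winProb_sub`).

This settles the game with `d = 0`. For `d = 1` the key `e(H(ID_1), h^x)^{r_1}` has an exponent that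
is independent of the capsule, so it is nearly uniform without any assumption, unless `h = 1`, `x =
0` or `H(ID_1) = 1` (`abs_avg_secondKey_sub_le`). An adversary that often finds `ID_1` with trivial
hash value would contradict the case `d = 0`: submit `ID_1` twice and test whether the challenge key
is trivial (`trivialityTest`). The remaining exceptions, and the passage between `ℤ_p^*` and `ℤ_p`,
cost multiples of `1/p`, which is negligible by MDDH itself (`GroupGen.MDDH.negligible_inv_order`).

The distinguisher is an explicit function on trees. Its running time is bounded by closure
properties of `PolyTime`, whose only loop principle is `PolyTime.foldl`. -/

/-! ### Elementary operations on trees. -/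

namespace Data

theorem size_pos (d : Data) : 0 < d.size := by cases d <;> simp [size]

theorem size_fst_le (d : Data) : d.fst.size ≤ d.size := by
  cases d <;> simp [size, fst]; omega

theorem size_snd_le (d : Data) : d.snd.size ≤ d.size := by
  cases d <;> simp [size, snd]; omega

@[simp] theorem fst_node (a b : Data) : (node a b).fst = a := rfl
@[simp] theorem snd_node (a b : Data) : (node a b).snd = b := rfl
@[simp] theorem fst_leaf : leaf.fst = leaf := rfl
@[simp] theorem snd_leaf : leaf.snd = leaf := rfl
@[simp] theorem list_nil : list [] = leaf := rfl
@[simp] theorem list_cons (x : Data) (l : List Data) : list (x :: l) = node x (list l) := rfl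

/-- Length of the right spine, which is the length of a list. -/
def len : Data → ℕ
  | leaf => 0
  | node _ b => b.len + 1

@[simp] theorem len_list (l : List Data) : (list l).len = l.length := by
  induction l <;> simp_all [len]

@[simp] theorem len_unary (n : ℕ) : (unary n).len = n := by simp [unary]

theorem len_lt_size (d : Data) : d.len < d.size := by
  induction d with
  | leaf => simp [len, size]
  | node a b _ ih => simp [len, size]; have := a.size_pos; omega

/-- Case distinction on whether the first argument is a leaf. -/
def sel : Data → Data → Data → Data
  | leaf, _, g => g
  | node _ _, f, _ => f

@[simp] theorem sel_leaf (f g : Data) : sel leaf f g = g := rfl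
@[simp] theorem sel_node (a b f g : Data) : sel (node a b) f g = f := rfl

open Classical in
theorem sel_eq_ite (b f g : Data) : sel b f g = if b = leaf then g else f := by
  cases b <;> simp

open Classical in
/-- Equality test. -/
noncomputable def eqb (a b : Data) : Data := if a = b then bit true else leaf

open Classical in
theorem eqb_eq_leaf {a b : Data} : eqb a b = leaf ↔ a ≠ b := by
  unfold eqb; split <;> simp_all [bit]

/-- Left fold over the right spine. -/
def foldl (f : Data → Data → Data) : Data → Data → Data
  | acc, leaf => acc
  | acc, node x xs => foldl f (f acc x) xs

@[simp] theorem foldl_list (f : Data → Data → Data) (acc : Data) (l : List Data) :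
    foldl f acc (list l) = l.foldl f acc := by
  induction l generalizing acc <;> simp_all [foldl]

end Data

/-! ### Closure properties of polynomial time. -/

theorem Polynomial.eval_nat_mono (P : Polynomial ℕ) {m n : ℕ} (h : m ≤ n) :
    P.eval m ≤ P.eval n := by
  induction P using Polynomial.induction_on' with
  | add p q hp hq => simpa using Nat.add_le_add hp hq
  | monomial i a => simp; gcongr

/-- Each rule charges at least the size of what it returns. Time bounds therefore control
intermediate sizes, as the composition of programs requires. -/
theorem Eval.size_le {c : Code} {v u : Data} {t : ℕ} (h : Eval c v u t) : u.size ≤ t := by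
  induction h with
  | nil v => exact v.size_pos
  | id v => exact le_rfl
  | fst v => exact v.size_fst_le
  | snd v => exact v.size_snd_le
  | eq_true v _ => simp [Data.bit, Data.size]
  | eq_false v _ => simp [Data.bit, Data.size]
  | pair _ _ _ _ => simp [Data.size]; omega
  | _ => omega

theorem PolyTime.size_le {f : Data → Data} (hf : PolyTime f) :
    ∃ P : Polynomial ℕ, ∀ v, (f v).size ≤ P.eval v.size := by
  obtain ⟨c, P, h⟩ := hf
  refine ⟨P, fun v => ?_⟩
  obtain ⟨t, ht, htP⟩ := h v
  exact ht.size_le.trans htP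

attribute [fun_prop] PolyTime

@[fun_prop]
theorem PolyTime.id : PolyTime fun v => v :=
  ⟨.id, Polynomial.X, fun v => ⟨_, .id v, by simp⟩⟩

@[fun_prop]
theorem PolyTime.comp {f g : Data → Data} (hg : PolyTime g) (hf : PolyTime f) :
    PolyTime fun v => g (f v) := by
  obtain ⟨cg, Q, hg⟩ := hg
  obtain ⟨cf, P, hf⟩ := hf
  refine ⟨.comp cg cf, P + Q.comp P + 1, fun v => ?_⟩
  obtain ⟨s, hs, hsP⟩ := hf v
  obtain ⟨t, ht, htQ⟩ := hg (f v)
  refine ⟨_, .comp hs ht, ?_⟩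
  have := Q.eval_nat_mono (hs.size_le.trans hsP)
  simp only [Polynomial.eval_add, Polynomial.eval_comp, Polynomial.eval_one]
  omega

@[fun_prop]
theorem PolyTime.node {f g : Data → Data} (hf : PolyTime f) (hg : PolyTime g) :
    PolyTime fun v => Data.node (f v) (g v) := by
  obtain ⟨cf, P, hf⟩ := hf
  obtain ⟨cg, Q, hg⟩ := hg
  refine ⟨.pair cf cg, P + Q + 1, fun v => ?_⟩
  obtain ⟨s, hs, hsP⟩ := hf v
  obtain ⟨t, ht, htQ⟩ := hg v
  refine ⟨_, .pair hs ht, ?_⟩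
  simp only [Polynomial.eval_add, Polynomial.eval_one]
  omega

@[fun_prop]
theorem PolyTime.const (d : Data) : PolyTime fun _ => d := by
  induction d with
  | leaf => exact ⟨.nil, Polynomial.X, fun v => ⟨_, .nil v, by simp⟩⟩
  | node a b ha hb => exact ha.node hb

@[fun_prop]
theorem PolyTime.fst {f : Data → Data} (hf : PolyTime f) : PolyTime fun v => (f v).fst :=
  PolyTime.comp ⟨.fst, Polynomial.X, fun v => ⟨_, .fst v, by simp⟩⟩ hf

@[fun_prop]
theorem PolyTime.snd {f : Data → Data} (hf : PolyTime f) : PolyTime fun v => (f v).snd :=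
  PolyTime.comp ⟨.snd, Polynomial.X, fun v => ⟨_, .snd v, by simp⟩⟩ hf

@[fun_prop]
theorem PolyTime.eqb {f g : Data → Data} (hf : PolyTime f) (hg : PolyTime g) :
    PolyTime fun v => Data.eqb (f v) (g v) := by
  have : PolyTime fun v => Data.eqb v.fst v.snd := by
    refine ⟨.eq, Polynomial.X + 3, fun v => ⟨v.size + 3, ?_, by simp⟩⟩
    by_cases h : v.fst = v.snd
    · simpa [Data.eqb, h] using Eval.eq_true v h
    · simpa [Data.eqb, h, Data.bit] using Eval.eq_false v h
  exact this.comp (hf.node hg)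

@[fun_prop]
theorem PolyTime.sel {b f g : Data → Data} (hb : PolyTime b) (hf : PolyTime f) (hg : PolyTime g) :
    PolyTime fun v => Data.sel (b v) (f v) (g v) := by
  obtain ⟨cb, R, hb⟩ := hb
  obtain ⟨cf, P, hf⟩ := hf
  obtain ⟨cg, Q, hg⟩ := hg
  refine ⟨.ite cb cf cg, R + P + Q + 1, fun v => ?_⟩
  obtain ⟨r, hr, hrR⟩ := hb v
  simp only [Polynomial.eval_add, Polynomial.eval_one]
  rcases h : b v with _ | ⟨x, y⟩
  · obtain ⟨t, ht, htQ⟩ := hg v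
    exact ⟨_, .ite_false (h ▸ hr) ht, by omega⟩
  · obtain ⟨t, ht, htQ⟩ := hf v
    exact ⟨_, .ite_true hr (by simp [h]) ht, by omega⟩

@[fun_prop]
theorem PolyTime.list_nil : PolyTime fun _ => Data.list [] := PolyTime.const _

@[fun_prop]
theorem PolyTime.list_cons {f : Data → Data} {l : Data → List Data} (hf : PolyTime f)
    (hl : PolyTime fun v => Data.list (l v)) : PolyTime fun v => Data.list (f v :: l v) :=
  hf.node hl

/-- Folds over a list are computable in polynomial time if the steps are and if each step
lengthens the accumulator by a bounded amount only. -/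
theorem PolyTime.foldl {s : Data → Data → Data → Data} {init lst : Data → Data}
    (hs : PolyTime fun w => s w.fst w.snd.fst w.snd.snd) (hi : PolyTime init) (hl : PolyTime lst)
    (G : Polynomial ℕ)
    (hG : ∀ v acc x, (s v acc x).size ≤ acc.size + x.size + G.eval v.size) :
    PolyTime fun v => Data.foldl (s v) (init v) (lst v) := by
  -- The loop state is `node list (node acc v)`. The body pops one element and carries `v` along as
  -- parameter; the test `.fst` is a leaf once the list is used up.
  have hstep : PolyTime fun w : Data => Data.node w.fst.snd
      (Data.node ((fun w : Data => s w.fst w.snd.fst w.snd.snd)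
        (.node w.snd.snd (.node w.snd.fst w.fst.fst))) w.snd.snd) :=
    .node (by fun_prop) (.node (hs.comp (by fun_prop)) (by fun_prop))
  obtain ⟨c, P, hc⟩ := hstep
  simp only [Data.fst_node, Data.snd_node] at hc
  obtain ⟨I, hI⟩ := hi.size_le
  obtain ⟨J, hJ⟩ := hl.size_le
  -- `M` bounds the accumulator, the rest of the list and all growth still to come. A step only
  -- moves size between these summands, so the same `M` serves for the whole loop.
  have key : ∀ (v : Data) (M : ℕ) (l acc : Data),
      acc.size + l.size + l.len * G.eval v.size ≤ M →
      ∃ t, Eval (.loop .fst c) (.node l (.node acc v))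
        (.node .leaf (.node (Data.foldl (s v) acc l) v)) t ∧
        t ≤ (l.len + 1) * (2 * (M + v.size + 2) + P.eval (M + v.size + 2) + 1) := by
    intro v M l
    induction l with
    | leaf =>
      intro acc h
      refine ⟨_, .loop_done (.fst _), ?_⟩
      simp only [Data.size, Data.len] at h ⊢
      omega
    | node x xs _ ih =>
      intro acc h
      simp only [Data.size, Data.len] at h
      obtain ⟨r, hr, hrb⟩ := ih (s v acc x) (by
        have := hG v acc x
        rw [add_mul, one_mul] at h
        omega)
      obtain ⟨t, ht, htP⟩ := hc (.node (.node x xs) (.node acc v))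
      refine ⟨_, .loop_step (.fst _) ?_ ht hr, ?_⟩
      · simp
      · have h1 : (Data.node (.node x xs) (.node acc v)).size ≤ M + v.size + 2 := by
          simp only [Data.size]; omega
        have h2 := P.eval_nat_mono h1
        simp only [Data.len]
        rw [add_mul _ 1, one_mul]
        omega
  have hloop : PolyTime fun v =>
      Data.node .leaf (.node (Data.foldl (s v) (init v) (lst v)) v) := by
    have hstart : PolyTime fun v => Data.node (lst v) (.node (init v) v) := by fun_prop
    obtain ⟨c₀, P₀, hc₀⟩ := hstart
    let M : Polynomial ℕ := I + J + J * G
    refine ⟨.comp (.loop .fst c) c₀,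
      P₀ + (J + 1) * (2 * (M + .X + 2) + P.comp (M + .X + 2) + 1) + 1, fun v => ?_⟩
    obtain ⟨t₀, ht₀, htb₀⟩ := hc₀ v
    have hlen := (lst v).len_lt_size
    obtain ⟨t, ht, htb⟩ := key v (M.eval v.size) (lst v) (init v) (by
      simp only [M, Polynomial.eval_add, Polynomial.eval_mul]
      have := Nat.mul_le_mul_right (G.eval v.size) (hlen.le.trans (hJ v))
      have := hI v
      have := hJ v
      omega)
    refine ⟨_, .comp ht₀ ht, ?_⟩
    have h1 := htb.trans (Nat.mul_le_mul_right _ (Nat.add_le_add_right (hlen.le.trans (hJ v)) 1))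
    simp only [Polynomial.eval_add, Polynomial.eval_mul, Polynomial.eval_comp, Polynomial.eval_one,
      Polynomial.eval_ofNat, Polynomial.eval_X]
    omega
  have := hloop.snd.fst
  simpa using this

/-! ### Programs for lists, unary numerals, size bounds and bit strings. -/

namespace Data

/-- `revAppend a b` is the reversal of the list `a`, followed by `b`. -/
def revAppend (a b : Data) : Data := foldl (fun acc x => node x acc) b a

/-- Concatenation of lists. -/
def append (a b : Data) : Data := revAppend (revAppend a leaf) b

@[simp] theorem revAppend_list (a b : List Data) :
    revAppend (list a) (list b) = list (a.reverse ++ b) := by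
  simp only [revAppend, foldl_list]
  induction a generalizing b with
  | nil => simp
  | cons x xs ih => simpa using ih (x :: b)

@[simp] theorem append_list (a b : List Data) : append (list a) (list b) = list (a ++ b) := by
  have := revAppend_list a []
  rw [list_nil] at this
  simp [append, this]

/-- Membership test. -/
noncomputable def mem (q l : Data) : Data :=
  foldl (fun acc x => sel (eqb x q) (bit true) acc) leaf l

theorem mem_list {q : Data} {l : List Data} : mem q (list l) = leaf ↔ q ∉ l := by
  suffices ∀ acc, l.foldl (fun acc x => sel (eqb x q) (bit true) acc) acc = leaf
      ↔ acc = leaf ∧ q ∉ l by simpa [mem] using this leaf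
  induction l with
  | nil => simp
  | cons x xs ih =>
    intro acc
    rw [List.foldl_cons, ih, sel_eq_ite, List.mem_cons]
    by_cases h : x = q
    · simp [eqb_eq_leaf, h, bit]
    · simp [eqb_eq_leaf, h, Ne.symm h]

/-- Boolean negation. -/
def not (a : Data) : Data := sel a leaf (bit true)

@[simp] theorem not_bit (b : Bool) : not (bit b) = bit (!b) := by cases b <;> rfl

/-- Length of a list in unary. -/
def ulen (a : Data) : Data := foldl (fun acc _ => node leaf acc) leaf a

@[simp] theorem ulen_list (a : List Data) : ulen (list a) = unary a.length := by
  suffices ∀ n, a.foldl (fun acc _ => node leaf acc) (unary n) = unary (n + a.length) by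
    simpa [ulen, unary] using this 0
  induction a with
  | nil => simp
  | cons x xs ih =>
    intro n
    rw [List.foldl_cons, show node leaf (unary n) = unary (n + 1) by simp [unary, List.replicate],
      ih, List.length_cons]
    congr 1; omega

@[simp] theorem size_unary (n : ℕ) : (unary n).size = 2 * n + 1 := by
  induction n with
  | zero => rfl
  | succ n ih =>
    simp only [unary, List.replicate, list_cons, size] at ih ⊢
    omega

theorem unary_succ (n : ℕ) : unary (n + 1) = node leaf (unary n) := rfl
@[simp] theorem snd_unary (n : ℕ) : (unary n).snd = unary (n - 1) := by cases n <;> rfl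

theorem ulen_eq (a : Data) : ulen a = unary a.len := by
  suffices ∀ n, foldl (fun acc _ => node leaf acc) (unary n) a = unary (n + a.len) by
    simpa [ulen, unary] using this 0
  induction a with
  | leaf => simp [foldl, len]
  | node x xs _ ih =>
    intro n
    rw [foldl, ← unary_succ, ih, len]
    congr 1; omega

/-- Product of unary numerals. -/
def umul (a b : Data) : Data := foldl (fun acc _ => append b acc) leaf a

@[simp] theorem append_unary (m n : ℕ) : append (unary m) (unary n) = unary (m + n) := by
  simp [unary, List.replicate_append_replicate]

@[simp] theorem umul_unary (m n : ℕ) : umul (unary m) (unary n) = unary (m * n) := by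
  suffices ∀ i, (List.replicate m leaf).foldl (fun acc _ => append (unary n) acc) (unary i)
      = unary (m * n + i) by simpa [umul, unary] using this 0
  induction m with
  | zero => simp
  | succ m ih => intro i; simp [List.replicate, ih]; congr 1; ring

/-- The last `len l - len n` elements of a list. -/
def drop (n l : Data) : Data := foldl (fun acc _ => acc.snd) l n

@[simp] theorem snd_list (l : List Data) : (list l).snd = list l.tail := by cases l <;> rfl

@[simp] theorem drop_unary (n : ℕ) (l : List Data) : drop (unary n) (list l) = list (l.drop n) := by
  simp only [drop, unary, foldl_list]
  induction n generalizing l with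
  | zero => simp
  | succ n ih => simp [List.replicate, ih]

/-- The first `len n` elements of a list. -/
def take (n l : Data) : Data :=
  revAppend (foldl (fun acc _ => sel acc.fst (node acc.fst.snd (node acc.fst.fst acc.snd)) acc)
    (node l leaf) n).snd leaf

@[simp] theorem take_unary (n : ℕ) (l : List Data) : take (unary n) (list l) = list (l.take n) := by
  suffices ∀ r, (List.replicate n leaf).foldl
      (fun acc _ => sel acc.fst (node acc.fst.snd (node acc.fst.fst acc.snd)) acc)
      (node (list l) (list r)) = node (list (l.drop n)) (list ((l.take n).reverse ++ r)) by
    have h := this []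
    rw [list_nil] at h
    rw [take, unary, foldl_list, h, ← list_nil]
    simp [-list_nil]
  induction n generalizing l with
  | zero => simp
  | succ n ih =>
    intro r
    cases l with
    | nil =>
      have := ih [] r
      simp only [list_nil, List.replicate, List.foldl_cons, fst_node, sel_leaf] at this ⊢
      rw [this]; simp
    | cons x xs =>
      have := ih xs (x :: r)
      simp only [list_cons, List.replicate, List.foldl_cons, fst_node, snd_node, sel_node] at this ⊢
      rw [this]; simp

/-- One step of the traversal of a stack of trees. -/
def popStep (acc : Data) : Data :=
  sel acc (sel acc.fst (node acc.fst.fst (node acc.fst.snd acc.snd)) acc.snd) leaf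

/-- `d` itself if its size is at most the length of `b`, and a leaf otherwise. -/
def clamp (b d : Data) : Data := sel (foldl (fun acc _ => popStep acc) (node d leaf) b) leaf d

theorem popStep_size_le (d : Data) : (popStep d).size ≤ d.size := by
  rcases d with _ | ⟨_ | ⟨x, y⟩, z⟩ <;> simp [popStep, size] <;> omega

theorem popStep_list_sum (l : List Data) :
    ∃ l', popStep (list l) = list l' ∧ (l'.map size).sum = (l.map size).sum - 1 := by
  rcases l with _ | ⟨_ | ⟨x, y⟩, l⟩
  · exact ⟨[], by simp [popStep]⟩
  · exact ⟨l, by simp [popStep, size]⟩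
  · exact ⟨x :: y :: l, by simp [popStep, size]; omega⟩

/-- A step removes exactly one node from the stack: a leaf is dropped, and an inner node is replaced
by its children. The stack is empty after as many steps as it had nodes, which is how `clamp`
measures a size. -/
theorem foldl_popStep_eq_leaf (b : Data) (l : List Data) :
    foldl (fun acc _ => popStep acc) (list l) b = leaf ↔ (l.map size).sum ≤ b.len := by
  induction b generalizing l with
  | leaf =>
    rcases l with _ | ⟨x, l⟩
    · simp [foldl]
    · simp [foldl, len]
      have := x.size_pos
      omega
  | node _ b _ ih =>
    obtain ⟨l', h, h'⟩ := popStep_list_sum l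
    rw [foldl, h, ih, h', len]
    omega

theorem clamp_eq (b d : Data) : clamp b d = if d.size ≤ b.len then d else leaf := by
  have := foldl_popStep_eq_leaf b [d]
  simp only [list_cons, list_nil, List.map_cons, List.map_nil, List.sum_cons, List.sum_nil,
    add_zero] at this
  rw [clamp, sel_eq_ite]
  split_ifs <;> simp_all

theorem clamp_of_le {b d : Data} (h : d.size ≤ b.len) : clamp b d = d := by
  rw [clamp_eq, if_pos h]

theorem size_clamp_le (b d : Data) : (clamp b d).size ≤ b.size := by
  rw [clamp_eq]
  split_ifs with h
  · exact h.trans b.len_lt_size.le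
  · exact b.size_pos

/-- A value that is not a bit string. -/
def bad : Data := node (node leaf (node leaf leaf)) leaf

/-- The tail of a non-empty bit string, and `bad` for other data. -/
noncomputable def bitTail (r : Data) : Data :=
  sel r (sel r.fst (sel (eqb r.fst (bit true)) r.snd bad) r.snd) bad

/-- A leaf for the bit strings that are as long as the list `n`, and only for them. -/
noncomputable def notStr (n d : Data) : Data := foldl (fun acc _ => bitTail acc) d n

/-- `bad` is absorbing, so an error at any position survives to the end of the fold in `notStr`. -/
theorem bitTail_bad : bitTail bad = bad := by
  have : eqb bad.fst (bit true) = leaf := by simp [eqb_eq_leaf, bad, bit]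
  rw [bitTail, this]
  rfl

theorem bitTail_cases (r : Data) :
    (∃ b s, r = node (bit b) s ∧ bitTail r = s) ∨
      (∀ b s, r ≠ node (bit b) s) ∧ bitTail r = bad := by
  rcases r with _ | ⟨x, s⟩
  · right; simp [bitTail]
  · rcases x with _ | ⟨x, y⟩
    · exact .inl ⟨false, s, rfl, by simp [bitTail]⟩
    · by_cases h : node x y = bit true
      · refine .inl ⟨true, s, by rw [h], ?_⟩
        simp [bitTail, h, sel_eq_ite, eqb_eq_leaf, bit]
      · right
        refine ⟨?_, ?_⟩
        · intro b
          cases b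
          · simp [bit]
          · intro s; simp [h]
        · simp [bitTail, sel_eq_ite (eqb _ _), eqb_eq_leaf, h]

theorem notStr_eq_leaf {n d : Data} :
    notStr n d = leaf ↔ ∃ w : List Bool, w.length = n.len ∧ bits w = d := by
  have hbad : ∀ n, notStr n bad = bad := by
    intro n
    induction n with
    | leaf => rfl
    | node x n _ ih =>
      have : notStr (node x n) bad = notStr n (bitTail bad) := rfl
      rw [this, bitTail_bad, ih]
  induction n generalizing d with
  | leaf =>
    simp only [notStr, foldl, len, List.length_eq_zero_iff]
    simp [bits, eq_comm]
  | node x n _ ih =>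
    have : notStr (node x n) d = notStr n (bitTail d) := rfl
    rw [this]
    rcases bitTail_cases d with ⟨b, s, rfl, h⟩ | ⟨h, h'⟩
    · rw [h]
      refine ih.trans ?_
      constructor
      · rintro ⟨w, hw, rfl⟩
        exact ⟨b :: w, by simp [len, hw], rfl⟩
      · rintro ⟨w, hw, hd⟩
        rcases w with _ | ⟨c, w⟩
        · simp [len] at hw
        · simp only [bits, List.map_cons, list_cons, node.injEq] at hd
          exact ⟨w, by simpa [len] using hw, hd.2⟩
    · rw [h', hbad]
      refine ⟨fun h => by simp [bad] at h, ?_⟩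
      rintro ⟨w, hw, rfl⟩
      rcases w with _ | ⟨c, w⟩
      · simp [len] at hw
      · exact (h c _ rfl).elim

theorem notStr_unary_eq_leaf {k : ℕ} {d : Data} :
    notStr (unary k) d = leaf ↔ ∃ w : Fin k → Bool, str w = d := by
  rw [notStr_eq_leaf, len_unary]
  constructor
  · rintro ⟨w, rfl, rfl⟩
    exact ⟨w.get, by simp [str]⟩
  · rintro ⟨w, rfl⟩
    exact ⟨List.ofFn w, by simp, rfl⟩

theorem size_bits_le (w : List Bool) : (bits w).size ≤ 4 * w.length + 1 := by
  induction w with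
  | nil => simp [bits, size]
  | cons b w ih =>
    simp only [bits, List.map_cons, list_cons, size, List.length_cons] at ih ⊢
    have : (bit b).size ≤ 3 := by cases b <;> simp [bit, size]
    omega

end Data

/-! ### Running times of these programs. -/

open Data

@[fun_prop]
theorem PolyTime.revAppend {f g : Data → Data} (hf : PolyTime f) (hg : PolyTime g) :
    PolyTime fun v => revAppend (f v) (g v) :=
  PolyTime.foldl (s := fun _ acc x => .node x acc) (by fun_prop) hg hf 1
    (fun v acc x => by simp [size]; omega)

@[fun_prop]
theorem PolyTime.append {f g : Data → Data} (hf : PolyTime f) (hg : PolyTime g) :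
    PolyTime fun v => append (f v) (g v) := by
  unfold Data.append; fun_prop

theorem Data.size_revAppend_le (a b : Data) : (Data.revAppend a b).size ≤ a.size + b.size := by
  unfold Data.revAppend
  induction a generalizing b with
  | leaf => simp [Data.foldl]
  | node x xs _ ih =>
    have := ih (.node x b)
    simp only [Data.foldl, Data.size] at this ⊢
    omega

theorem Data.size_append_le (a b : Data) : (Data.append a b).size ≤ a.size + b.size + 1 := by
  have h1 := Data.size_revAppend_le (Data.revAppend a .leaf) b
  have h2 := Data.size_revAppend_le a .leaf
  unfold Data.append
  simp only [Data.size] at h2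
  omega

@[fun_prop]
theorem PolyTime.mem {f g : Data → Data} (hf : PolyTime f) (hg : PolyTime g) :
    PolyTime fun v => mem (f v) (g v) :=
  PolyTime.foldl (s := fun v acc x => Data.sel (Data.eqb x (f v)) (bit true) acc)
    (by have := hf.comp (.fst .id); fun_prop) (.const _) hg 3
    (fun v acc x => by
      rw [sel_eq_ite]
      split_ifs
      · omega
      · simp [bit, size])

@[fun_prop]
theorem PolyTime.not {f : Data → Data} (hf : PolyTime f) : PolyTime fun v => Data.not (f v) := by
  unfold Data.not; fun_prop

@[fun_prop]
theorem PolyTime.ulen {f : Data → Data} (hf : PolyTime f) : PolyTime fun v => ulen (f v) :=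
  PolyTime.foldl (s := fun _ acc _ => .node .leaf acc) (by fun_prop) (.const _) hf 2
    (fun v acc x => by simp [size]; omega)

@[fun_prop]
theorem PolyTime.umul {f g : Data → Data} (hf : PolyTime f) (hg : PolyTime g) :
    PolyTime fun v => umul (f v) (g v) := by
  obtain ⟨Q, hQ⟩ := hg.size_le
  refine PolyTime.foldl (s := fun v acc _ => Data.append (g v) acc)
    (.append (hg.comp (by fun_prop)) (by fun_prop)) (.const _) hf (Q + 1) (fun v acc x => ?_)
  have h1 := size_append_le (g v) acc
  have h2 := hQ v
  simp only [Polynomial.eval_add, Polynomial.eval_one]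
  omega

@[fun_prop]
theorem PolyTime.drop {f g : Data → Data} (hf : PolyTime f) (hg : PolyTime g) :
    PolyTime fun v => drop (f v) (g v) :=
  PolyTime.foldl (s := fun _ acc _ => acc.snd) (by fun_prop) hg hf 0
    (fun v acc x => by have := acc.size_snd_le; simp; omega)

@[fun_prop]
theorem PolyTime.take {f g : Data → Data} (hf : PolyTime f) (hg : PolyTime g) :
    PolyTime fun v => take (f v) (g v) := by
  refine PolyTime.revAppend (PolyTime.snd (PolyTime.foldl (s := fun _ acc _ =>
    Data.sel acc.fst (.node acc.fst.snd (.node acc.fst.fst acc.snd)) acc) (by fun_prop)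
    (hg.node (.const _)) hf 0 (fun v acc x => ?_))) (.const _)
  rcases acc with _ | ⟨_ | ⟨x, y⟩, z⟩ <;> simp [size]; omega

@[fun_prop]
theorem PolyTime.clamp {f g : Data → Data} (hf : PolyTime f) (hg : PolyTime g) :
    PolyTime fun v => clamp (f v) (g v) := by
  refine PolyTime.sel (PolyTime.foldl (s := fun _ acc _ => popStep acc)
    (by unfold popStep; fun_prop) (hg.node (.const _)) hf 0 (fun v acc x => ?_)) (.const _) hg
  have := popStep_size_le acc
  omega

@[fun_prop]
theorem PolyTime.notStr {f g : Data → Data} (hf : PolyTime f) (hg : PolyTime g) :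
    PolyTime fun v => notStr (f v) (g v) := by
  refine PolyTime.foldl (s := fun _ acc _ => bitTail acc)
    -- `7` is the size of `bad`, the only result of a step that is not a part of the old value.
    (by unfold bitTail; fun_prop) hg hf 7 (fun v acc x => ?_)
  rcases bitTail_cases acc with ⟨b, s, rfl, h⟩ | ⟨h, h'⟩
  · rw [h]; simp only [size]; omega
  · rw [h']; simp [bad, size]

/-- Polynomials of the length of a list can be computed in unary. -/
theorem PolyTime.unary_eval (P : Polynomial ℕ) {f : Data → Data} (hf : PolyTime f) :
    PolyTime fun v => unary (P.eval (f v).len) := by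
  induction P using Polynomial.induction_on' with
  | add p q hp hq =>
    simp only [Polynomial.eval_add, ← append_unary]
    fun_prop
  | monomial i a =>
    simp only [Polynomial.eval_monomial, ← umul_unary]
    refine PolyTime.umul (.const _) ?_
    induction i with
    | zero => simpa using PolyTime.const _
    | succ i ih =>
      simp only [pow_succ, ← umul_unary, ← ulen_eq]
      exact ih.umul hf.ulen

/-! ### The game as a function of the key oracle and the challenge. -/

section Game

variable {ι : Type} {str : ι → Data}

variable (str) in
/-- The identity that is represented by given data, if any. -/
noncomputable def parse (d : Data) : Option ι := Function.partialInv str d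

variable (str) in
open Classical in
/-- The answer to a key query if the keys are given by `O`. -/
noncomputable def keyAnswer (O : ι → Data) (forb : Set ι)
    (d : Data) : Data :=
  match parse str d with
  | none => .leaf
  | some i => if i ∈ forb then .leaf else O i

variable (str) in
open Classical in
/-- The identities whose keys are revealed when the given data are queried. -/
noncomputable def revealed (forb : Set ι) (asked : List Data) :
    List ι :=
  (asked.filterMap (parse str)).filter (· ∉ forb)

theorem parse_eq_some (hstr : Function.Injective str) {d : Data} {w : ι} :
    parse str d = some w ↔ str w = d :=
  Function.Injective.isPartialInv hstr _ _

theorem parse_str (hstr : Function.Injective str) (w : ι) : parse str (str w) = some w :=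
  (parse_eq_some hstr).2 rfl

theorem mem_revealed (hstr : Function.Injective str) {forb : Set ι} {asked : List Data} {w : ι} :
    w ∈ revealed str forb asked ↔ str w ∈ asked ∧ w ∉ forb := by
  simp [revealed, parse_eq_some hstr]

theorem length_revealed_le (forb : Set ι) (asked : List Data) :
    (revealed str forb asked).length ≤ asked.length :=
  (List.length_filter_le _ _).trans (List.length_filterMap_le _ _)

open Classical in
/-- One round of a query phase. -/
noncomputable def queryRound (next : List Data → Data) (oracle : Data → Data)
    (st : List Data × List Data) : List Data × List Data :=
  if (next st.1).fst = .leaf then st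
  else (st.1 ++ [oracle (next st.1).snd], (next st.1).snd :: st.2)

/-- A state in which the phase has ended is a fixed point of `queryRound`. A program may thus always
run the full number of rounds. -/
theorem queryPhase_eq_iterate (next : List Data → Data) (oracle : Data → Data) (m : ℕ)
    (ans asked : List Data) :
    queryPhase next oracle m ans asked =
      ((next ((queryRound next oracle)^[m] (ans, asked)).1).snd,
        (queryRound next oracle)^[m] (ans, asked)) := by
  induction m generalizing ans asked with
  | zero => rfl
  | succ m ih =>
    rw [queryPhase, Function.iterate_succ_apply]
    by_cases h : (next ans).fst = .leaf
    · have hfix : queryRound next oracle (ans, asked) = (ans, asked) := by simp [queryRound, h]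
      rw [hfix, Function.iterate_fixed hfix]
      simp [h]
    · rw [if_neg h, ih]
      simp [queryRound, h]

theorem asked_subset_queryPhase (next : List Data → Data) (oracle : Data → Data) (m : ℕ)
    (ans asked : List Data) : ∀ d ∈ asked, d ∈ (queryPhase next oracle m ans asked).2.2 := by
  induction m generalizing ans asked with
  | zero => exact fun d hd => hd
  | succ m ih =>
    intro d hd
    rw [queryPhase]
    split_ifs
    · exact hd
    · exact ih _ _ d (List.mem_cons_of_mem _ hd)

theorem length_asked_queryPhase_le (next : List Data → Data) (oracle : Data → Data) (m : ℕ)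
    (ans asked : List Data) :
    (queryPhase next oracle m ans asked).2.2.length ≤ asked.length + m := by
  induction m generalizing ans asked with
  | zero => simp [queryPhase]
  | succ m ih =>
    rw [queryPhase]
    split_ifs
    · simp
    · have := ih (ans ++ [oracle (next ans).snd]) ((next ans).snd :: asked)
      simp only [List.length_cons] at this
      omega

theorem queryPhase_congr (next : List Data → Data) {oracle oracle' : Data → Data} (m : ℕ)
    (ans asked : List Data)
    (h : ∀ d ∈ (queryPhase next oracle m ans asked).2.2, oracle d = oracle' d) :
    queryPhase next oracle' m ans asked = queryPhase next oracle m ans asked := by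
  induction m generalizing ans asked with
  | zero => rfl
  | succ m ih =>
    rw [queryPhase] at h ⊢
    rw [queryPhase]
    split_ifs with h0
    · rfl
    · rw [if_neg h0] at h
      have h1 := h (next ans).snd (asked_subset_queryPhase _ _ _ _ _ _ (by simp))
      rw [← h1]
      exact ih _ _ h

/-- Malformed and forbidden queries are answered by a leaf whatever the keys are, so only revealed
identities matter. -/
theorem queryPhase_keyAnswer_congr (hstr : Function.Injective str) (next : List Data → Data)
    {O O' : ι → Data} (forb : Set ι) (m : ℕ)
    (h : ∀ w ∈ revealed str forb (queryPhase next (keyAnswer str O forb) m [] []).2.2, O w = O' w) :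
    queryPhase next (keyAnswer str O' forb) m [] []
      = queryPhase next (keyAnswer str O forb) m [] [] := by
  refine queryPhase_congr next m [] [] fun d hd => ?_
  unfold keyAnswer
  rcases hp : parse str d with _ | w
  · rfl
  · by_cases hw : w ∈ forb
    · simp [hw]
    · simpa [hw] using h w ((mem_revealed hstr).2 ⟨(parse_eq_some hstr).1 hp ▸ hd, hw⟩)

/-- The state of the game when the challenge identities have been submitted. -/
structure Commitment (ι : Type) where
  first : ι
  second : ι
  answers : List Data
  revealed : List ι

/-- The relevant part of the transcript of the game: the first challenge identity, the identities
whose keys have been revealed, and the final output. -/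
structure Transcript (ι : Type) where
  first : ι
  revealed : List ι
  out : Data

variable (str) in
open Classical in
/-- The game up to the submission of two admissible challenge identities. -/
noncomputable def commitPhase (view : List Data → Data → Data) (O : ι → Data)
    (m : ℕ) : Option (Commitment ι) :=
  let ph := queryPhase (fun ans => view ans .leaf) (keyAnswer str O ∅) m [] []
  match parse str ph.1.fst, parse str ph.1.snd with
  | some i₀, some i₁ =>
    if str i₀ ∈ ph.2.2 ∨ str i₁ ∈ ph.2.2 then none
    else some ⟨i₀, i₁, ph.2.1, revealed str ∅ ph.2.2⟩
  | _, _ => none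

variable (str) in
/-- The second query phase of the game. -/
noncomputable def guessPhase (view : List Data → Data → Data) (O : ι → Data)
    (m : ℕ) (s : Commitment ι) (ch : Data) : Data × List Data × List Data :=
  queryPhase (fun ans => view s.answers (.node ch (Data.list ans)))
    (keyAnswer str O {s.first, s.second}) m [] []

variable (str) in
/-- The transcript of the rest of the game, after the challenge `ch` has been received. -/
noncomputable def finish (view : List Data → Data → Data) (O : ι → Data)
    (m : ℕ) (s : Commitment ι) (ch : Data) : Transcript ι :=
  ⟨s.first, s.revealed ++ revealed str {s.first, s.second} (guessPhase str view O m s ch).2.2,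
    (guessPhase str view O m s ch).1⟩

variable (str) in
/-- The transcript of the game, if the challenge identities are admissible. -/
noncomputable def runGame (view : List Data → Data → Data) (O : ι → Data)
    (ch : Commitment ι → Data) (m : ℕ) : Option (Transcript ι) :=
  (commitPhase str view O m).map fun s => finish str view O m s (ch s)

theorem commitPhase_congr (hstr : Function.Injective str) {view : List Data → Data → Data}
    {O O' : ι → Data}
    {m : ℕ} {s : Commitment ι} (hs : commitPhase str view O m = some s)
    (h : ∀ w ∈ s.revealed, O w = O' w) : commitPhase str view O' m = some s := by
  have key : queryPhase (fun ans => view ans .leaf) (keyAnswer str O' ∅) m [] []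
      = queryPhase (fun ans => view ans .leaf) (keyAnswer str O ∅) m [] [] := by
    refine queryPhase_keyAnswer_congr hstr _ _ _ ?_
    unfold commitPhase at hs
    dsimp only at hs
    split at hs
    · split_ifs at hs
      obtain rfl := Option.some.inj hs
      exact h
    · simp at hs
  rw [← hs]
  unfold commitPhase
  rw [key]

/-- The simulated keys are wrong at identities with nonzero exponent. This does no harm to a run
that never reveals such a key, and agreement has to be checked along one of the two runs only. -/
theorem runGame_congr (hstr : Function.Injective str) {view : List Data → Data → Data}
    {O O' : ι → Data}
    {ch ch' : Commitment ι → Data} {m : ℕ} {r : Transcript ι}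
    (hr : runGame str view O ch m = some r) (h : ∀ w ∈ r.revealed, O w = O' w)
    (hch : ∀ s, commitPhase str view O m = some s → ch s = ch' s) :
    runGame str view O' ch' m = some r := by
  unfold runGame at hr ⊢
  obtain ⟨s, hs, rfl⟩ := Option.map_eq_some_iff.1 hr
  rw [commitPhase_congr hstr hs fun w hw => h w (by simp [finish, hw]), Option.map_some, ← hch s hs]
  have : guessPhase str view O' m s (ch s) = guessPhase str view O m s (ch s) :=
    queryPhase_keyAnswer_congr hstr _ _ _ fun w hw => h w (by simp [finish, guessPhase, hw])
  simp [finish, this]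

theorem not_mem_revealed_of_commitPhase (hstr : Function.Injective str)
    {view : List Data → Data → Data}
    {O : ι → Data} {m : ℕ} {s : Commitment ι}
    (hs : commitPhase str view O m = some s) :
    s.first ∉ s.revealed ∧ s.revealed.length ≤ m := by
  unfold commitPhase at hs
  dsimp only at hs
  split at hs
  · split_ifs at hs with h
    obtain rfl := Option.some.inj hs
    refine ⟨fun h' => h (.inl ((mem_revealed hstr).1 h').1), ?_⟩
    exact (length_revealed_le _ _).trans (by simpa using length_asked_queryPhase_le _ _ m [] [])
  · simp at hs

/-- These are the conditions under which programmability applies to a transcript: `m` queries in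
each of two phases, none of them revealing the key of the first challenge identity. -/
theorem runGame_revealed (hstr : Function.Injective str) {view : List Data → Data → Data}
    {O : ι → Data} {ch : Commitment ι → Data} {m : ℕ} {r : Transcript ι}
    (hr : runGame str view O ch m = some r) : r.first ∉ r.revealed ∧ r.revealed.length ≤ 2 * m := by
  obtain ⟨s, hs, rfl⟩ := Option.map_eq_some_iff.1 hr
  obtain ⟨h1, h2⟩ := not_mem_revealed_of_commitPhase hstr hs
  constructor
  · simp [finish, h1, mem_revealed hstr]
  · have := length_revealed_le (str := str) {s.first, s.second} (guessPhase str view O m s (ch s)).2.2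
    have h3 : (guessPhase str view O m s (ch s)).2.2.length ≤ 0 + m :=
      length_asked_queryPhase_le _ _ m [] []
    simp only [finish, List.length_append]
    omega

open Classical in
/-- The guess in the security game in terms of `runGame`. -/
theorem IBKEM.guess_eq_true (E : IBKEM) (A : Adversary) {k : ℕ} (pk : E.PK k) (sk : E.SK k)
    (tape : Data) (r₀ r₁ : E.Rnd pk) (d : Bool) :
    E.guess A pk sk tape r₀ r₁ d = true ↔
      ∃ r, runGame E.idStr
        (fun ans rest => A.next (Data.list [Data.unary k, E.pkStr pk, tape, Data.list ans, rest]))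
        (E.extract sk) (fun s => E.challenge pk s.first s.second r₀ r₁ d)
        (A.queries.eval k) = some r ∧ r.out ≠ .leaf := by
  have hO : ∀ forb, E.keyOracle sk forb = keyAnswer E.idStr (E.extract sk) forb := by
    intro forb
    funext d
    unfold IBKEM.keyOracle keyAnswer IBKEM.parseId parse
    cases Function.partialInv (E.idStr : E.Id k → Data) d <;> rfl
  have hp : ∀ d, E.parseId k d = parse E.idStr d := fun _ => rfl
  unfold IBKEM.guess runGame commitPhase
  simp only [hp, hO]
  generalize queryPhase (fun ans => A.next (Data.list [Data.unary k,
    E.pkStr pk, tape, Data.list ans, leaf])) _ _ [] [] = ph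
  rcases parse E.idStr ph.1.fst with _ | x
  · simp
  rcases parse E.idStr ph.1.snd with _ | y
  · simp
  dsimp only
  split_ifs with h
  · simp
  · simp only [Option.map_some, Option.some.injEq, exists_eq_left', finish, guessPhase,
      decide_eq_true_eq]

end Game

/-! ### The random index and the auxiliary identity. -/

namespace Data

theorem size_drop_le (n l : Data) : (drop n l).size ≤ l.size := by
  unfold drop
  induction n generalizing l with
  | leaf => exact le_rfl
  | node _ n _ ih => exact (ih l.snd).trans l.size_snd_le

/-- This turns `drop` into a comparison of unary numerals. -/
theorem drop_eq_leaf {n l : Data} : drop n l = leaf ↔ l.len ≤ n.len := by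
  unfold drop
  induction n generalizing l with
  | leaf => cases l <;> simp [foldl, len]
  | node _ n _ ih =>
    rw [foldl, ih, len]
    cases l <;> simp [len]

/-- One step of the choice of a random number in unary: unless `cnt` is longer than `b`, it is
doubled, and it is added to the number `idx` if the random bit `x` is set. -/
def indexStep (b acc x : Data) : Data :=
  sel (drop b acc.fst) acc
    (node (append (ulen acc.fst) (ulen acc.fst)) (sel x (append (ulen acc.fst) acc.snd) acc.snd))

/-- A random number in unary, chosen with the random bits in the list `l`. It is uniform on
the numbers below the least power of two that exceeds the length of `b`. -/
def index (b l : Data) : Data := (foldl (indexStep b) (node (unary 1) leaf) l).snd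

/-- The identity that differs from a given one in the first bit. -/
def flipFirst (x : Data) : Data := node (not x.fst) x.snd

end Data

@[fun_prop]
theorem PolyTime.flipFirst {f : Data → Data} (hf : PolyTime f) :
    PolyTime fun v => flipFirst (f v) := by
  unfold Data.flipFirst; fun_prop

@[fun_prop]
theorem PolyTime.index {f g : Data → Data} (hf : PolyTime f) (hg : PolyTime g) :
    PolyTime fun v => index (f v) (g v) := by
  obtain ⟨Q, hQ⟩ := hf.size_le
  have hfst := hf.comp (.fst .id)
  refine PolyTime.snd (PolyTime.foldl (s := fun v => indexStep (f v))
    (by unfold Data.indexStep; fun_prop) (.const _) hg (6 * Q + 10) (fun v acc x => ?_))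
  have h1 := hQ v
  have h2 := (f v).len_lt_size
  simp only [Polynomial.eval_add, Polynomial.eval_mul, Polynomial.eval_ofNat]
  rw [indexStep, sel_eq_ite]
  split_ifs with h
  · rw [drop_eq_leaf] at h
    have h3 := size_append_le (Data.ulen acc.fst) (Data.ulen acc.fst)
    have h4 := size_append_le (Data.ulen acc.fst) acc.snd
    have h6 := acc.size_snd_le
    rw [ulen_eq, size_unary] at h3 h4
    have h5 : (Data.sel x (Data.append (Data.ulen acc.fst) acc.snd) acc.snd).size
        ≤ 2 * acc.fst.len + 1 + acc.snd.size + 1 := by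
      rw [sel_eq_ite, ulen_eq]
      split_ifs <;> omega
    rw [ulen_eq] at h5 ⊢
    simp only [size]
    omega
  · omega

/-! ### The program of the distinguisher and its running time. -/

/-- Programs from which the reduction is built, and bounds on their resources. -/
structure Toolkit where
  next : Data → Data
  trap : Data → Data
  teval : Data → Data
  mul : Data → Data
  pair : Data → Data
  next_poly : PolyTime next
  trap_poly : PolyTime trap
  teval_poly : PolyTime teval
  mul_poly : PolyTime mul
  pair_poly : PolyTime pair
  queries : Polynomial ℕ
  coins : Polynomial ℕ
  trapCoins : Polynomial ℕ
  encSize : Polynomial ℕ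
  trials : Polynomial ℕ

namespace Toolkit

variable (R : Toolkit)

@[fun_prop]
theorem polyTime_next {f : Data → Data} (hf : PolyTime f) : PolyTime fun v => R.next (f v) :=
  R.next_poly.comp hf

@[fun_prop]
theorem polyTime_trap {f : Data → Data} (hf : PolyTime f) : PolyTime fun v => R.trap (f v) :=
  R.trap_poly.comp hf

@[fun_prop]
theorem polyTime_teval {f : Data → Data} (hf : PolyTime f) : PolyTime fun v => R.teval (f v) :=
  R.teval_poly.comp hf

@[fun_prop]
theorem polyTime_mul {f : Data → Data} (hf : PolyTime f) : PolyTime fun v => R.mul (f v) :=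
  R.mul_poly.comp hf

@[fun_prop]
theorem polyTime_pair {f : Data → Data} (hf : PolyTime f) : PolyTime fun v => R.pair (f v) :=
  R.pair_poly.comp hf

/-- The data that are fixed during the simulation of the game: security parameter and number of
levels, public key, random tape of the adversary, group system, `h^x`, and trapdoor. -/
def env (k l pk tape pp h' td : Data) : Data := .node (.node k l) (.list [pk, tape, pp, h', td])

/-- The simulated decryption key `e(B_X, h^x)` of the identity `q`. -/
def simKey (F q : Data) : Data :=
  clamp (unary (R.encSize.eval F.fst.fst.len)) (R.pair (.list [F.fst.fst, F.snd.snd.snd.fst,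
    F.fst.snd.snd, unary 1,
    (R.teval (.list [F.fst.fst, F.snd.snd.snd.fst, F.snd.snd.snd.snd.snd.fst, q])).snd,
    F.snd.snd.snd.snd.fst]))

/-- The message of the adversary after the answers `ans`; `ph` is a leaf in the first query phase and
contains the answers in the first phase and the challenge in the second one. -/
def simView (F ph ans : Data) : Data :=
  sel ph (R.next (.list [F.fst, F.snd.fst, F.snd.snd.fst, ph.fst, .node ph.snd ans]))
    (R.next (.list [F.fst, F.snd.fst, F.snd.snd.fst, ans, .leaf]))

/-- A query to the simulated key oracle. -/
noncomputable def simQuery (F fb acc q : Data) : Data :=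
  sel (notStr F.fst.fst q) (.node (append acc.fst (.list [.leaf])) acc.snd)
    (sel (mem q fb) (.node (append acc.fst (.list [.leaf])) acc.snd)
      (.node (append acc.fst (.list [R.simKey F q])) (.node q acc.snd)))

/-- A round of a simulated query phase. -/
noncomputable def simRound (F ph fb acc : Data) : Data :=
  sel (R.simView F ph acc.fst).fst (R.simQuery F fb acc (R.simView F ph acc.fst).snd) acc

/-- A simulated query phase. -/
noncomputable def simPhase (F ph fb : Data) : Data :=
  foldl (fun acc _ => R.simRound F ph fb acc) (.node .leaf .leaf)
    (unary (R.queries.eval F.fst.fst.len))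

/-- The simulated challenge for the identity `i`. -/
def simChallenge (F S C i : Data) : Data :=
  .node (R.mul (.list [F.fst.fst, F.snd.snd.snd.fst, .node .leaf F.fst.snd,
      R.pair (.list [F.fst.fst, F.snd.snd.snd.fst, .leaf, .node .leaf F.fst.snd,
        (R.teval (.list [F.fst.fst, F.snd.snd.snd.fst, F.snd.snd.snd.snd.snd.fst, i])).fst, S]),
      R.pair (.list [F.fst.fst, F.snd.snd.snd.fst, F.fst.snd, unary 1,
        R.pair (.list [F.fst.fst, F.snd.snd.snd.fst, F.fst.snd.snd, unary 1,
          (R.teval (.list [F.fst.fst, F.snd.snd.snd.fst, F.snd.snd.snd.snd.snd.fst, i])).snd, C]),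
        F.snd.snd.snd.snd.fst])])) C

/-- The simulated transcript after the submission of the identities `i₀` and `i₁`, if the state
after the first query phase was `p₁`. -/
noncomputable def simFinish (F S C p₁ i₀ i₁ : Data) : Data :=
  .node i₀ (.node
    (append p₁.snd
      (R.simPhase F (.node p₁.fst (R.simChallenge F S C i₀)) (.list [i₀, i₁])).snd)
    (R.simView F (.node p₁.fst (R.simChallenge F S C i₀))
      (R.simPhase F (.node p₁.fst (R.simChallenge F S C i₀)) (.list [i₀, i₁])).fst).snd)

/-- The simulated transcript after a first query phase with the result `p₁` and the message `m₁`. -/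
noncomputable def simCommit (F S C p₁ m₁ : Data) : Data :=
  sel (notStr F.fst.fst m₁.fst) .leaf (sel (notStr F.fst.fst m₁.snd) .leaf
    (sel (mem m₁.fst p₁.snd) .leaf (sel (mem m₁.snd p₁.snd) .leaf
      (R.simFinish F S C p₁ m₁.fst m₁.snd))))

/-- The simulated transcript. -/
noncomputable def simGame (F S C : Data) : Data :=
  R.simCommit F S C (R.simPhase F .leaf .leaf)
    (R.simView F .leaf (R.simPhase F .leaf .leaf).fst).snd

/-- The test whether the trapdoor `td` is suitable for the transcript `r`. -/
noncomputable def isGood (k pp td r : Data) : Data :=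
  sel (R.teval (.list [k, pp, td, r.fst])).fst
    (sel (R.teval (.list [k, pp, td, flipFirst r.fst])).fst .leaf
      (foldl (fun acc x => sel (R.teval (.list [k, pp, td, x])).fst .leaf acc) (bit true)
        r.snd.fst)) .leaf

/-- The test whether the first trapdoors from a sequence of fresh ones, made with the randomness
on `tape`, are not suitable for the transcript `r`; their number is the length of `idx`. -/
noncomputable def allBad (k pp cs g r idx tape : Data) : Data :=
  (foldl (fun acc _ =>
    .node
      (sel (R.isGood k pp (R.trap (.list [k, .list [pp, cs, g],
        take (unary (R.trapCoins.eval k.len)) acc.snd])).snd r) .leaf acc.fst)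
      (drop (unary (R.trapCoins.eval k.len)) acc.snd))
    (.node (bit true) tape) idx).fst

/-- The decision of the distinguisher; `o` is the hash key with its trapdoor, and `r` is the
simulated transcript. -/
noncomputable def decision (k pp cs g o bits fresh r : Data) : Data :=
  sel r (sel (R.isGood k pp o.snd r)
    (sel (R.allBad k pp cs g r (index (unary (R.trials.eval k.len)) bits) fresh)
      r.snd.snd .leaf) .leaf) .leaf

/-- The distinguisher for given hash key and trapdoor `o`. -/
noncomputable def decideWith (k pp cs g h' C S o tape bits fresh : Data) : Data :=
  R.decision k pp cs g o bits fresh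
    (R.simGame (env k (ulen cs) (.list [pp, o.fst, g, h']) tape pp h' o.snd) S C)

/-- The distinguisher, with the parts of its input and of its random tape as arguments. -/
noncomputable def decideParts (k pp cs g h' C S tape trapTape bits fresh : Data) : Data :=
  R.decideWith k pp cs g h' C S (R.trap (.list [k, .list [pp, cs, g], trapTape])) tape bits fresh

/-- The distinguisher, with the parts of its input and its random tape as arguments; `rx` contains the
powers of `g` in reverse order. -/
noncomputable def decideInput (k pp g rx S tape : Data) : Data :=
  R.decideParts k pp (revAppend rx.snd.snd .leaf) g rx.snd.fst rx.fst S
    (take (unary (R.coins.eval k.len)) tape)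
    (take (unary (R.trapCoins.eval k.len)) (drop (unary (R.coins.eval k.len)) tape))
    (take k (drop (unary (R.trapCoins.eval k.len)) (drop (unary (R.coins.eval k.len)) tape)))
    (drop k (drop (unary (R.trapCoins.eval k.len)) (drop (unary (R.coins.eval k.len)) tape)))

/-- The distinguisher as a function of its input. -/
noncomputable def program (v : Data) : Data :=
  R.decideInput v.fst v.snd.fst.fst v.snd.fst.snd.fst (revAppend v.snd.fst.snd.snd.fst .leaf)
    v.snd.fst.snd.snd.snd.fst v.snd.snd.fst

theorem polyTime_unary_eval_len (P : Polynomial ℕ) {f : Data → Data} (hf : PolyTime f) :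
    PolyTime fun v => unary (P.eval (f v).len) := .unary_eval P hf

attribute [fun_prop] polyTime_unary_eval_len

@[fun_prop]
theorem polyTime_simKey {F q : Data → Data} (hF : PolyTime F) (hq : PolyTime q) :
    PolyTime fun v => R.simKey (F v) (q v) := by
  unfold simKey; fun_prop

@[fun_prop]
theorem polyTime_simView {F ph ans : Data → Data} (hF : PolyTime F) (hph : PolyTime ph)
    (hans : PolyTime ans) : PolyTime fun v => R.simView (F v) (ph v) (ans v) := by
  unfold simView; fun_prop

@[fun_prop]
theorem polyTime_simQuery {F fb acc q : Data → Data} (hF : PolyTime F) (hfb : PolyTime fb)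
    (hacc : PolyTime acc) (hq : PolyTime q) :
    PolyTime fun v => R.simQuery (F v) (fb v) (acc v) (q v) := by
  unfold simQuery; fun_prop

@[fun_prop]
theorem polyTime_simRound {F ph fb acc : Data → Data} (hF : PolyTime F) (hph : PolyTime ph)
    (hfb : PolyTime fb) (hacc : PolyTime acc) :
    PolyTime fun v => R.simRound (F v) (ph v) (fb v) (acc v) := by
  unfold simRound; fun_prop

theorem size_simKey_le (F q : Data) :
    (R.simKey F q).size ≤ 2 * R.encSize.eval F.size + 1 := by
  refine (size_clamp_le _ _).trans ?_
  rw [size_unary]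
  have := R.encSize.eval_nat_mono
    (F.fst.fst.len_lt_size.le.trans (F.fst.size_fst_le.trans F.size_fst_le))
  omega

/-- Polynomial time is required on all inputs, including those that describe no group system. The
growth per round stays bounded because `simKey` clamps its answer and a query is stored only after
`notStr` has limited its length by that of `F.fst.fst`. -/
theorem size_simRound_le (F ph fb acc : Data) :
    (R.simRound F ph fb acc).size ≤ acc.size + (2 * R.encSize.eval F.size + 4 * F.size + 20) := by
  rw [simRound, sel_eq_ite]
  split_ifs
  · omega
  generalize (R.simView F ph acc.fst).snd = q
  have h1 := size_append_le acc.fst (.list [.leaf])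
  have h2 := size_append_le acc.fst (.list [R.simKey F q])
  have h3 := R.size_simKey_le F q
  have h4 : acc.fst.size + acc.snd.size ≤ acc.size + 1 := by cases acc <;> simp [size]; omega
  simp only [list_cons, list_nil, size] at h1 h2
  rw [simQuery, sel_eq_ite, sel_eq_ite]
  split_ifs with h5
  · obtain ⟨w, hw, rfl⟩ := notStr_eq_leaf.1 h5
    have h6 := size_bits_le w
    have h7 := F.fst.fst.len_lt_size.le.trans (F.fst.size_fst_le.trans F.size_fst_le)
    simp only [size, list_cons, list_nil]
    omega
  all_goals
    simp only [size, list_cons, list_nil]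
    omega

@[fun_prop]
theorem polyTime_simPhase {F ph fb : Data → Data} (hF : PolyTime F) (hph : PolyTime ph)
    (hfb : PolyTime fb) : PolyTime fun v => R.simPhase (F v) (ph v) (fb v) := by
  obtain ⟨Q, hQ⟩ := hF.size_le
  have h1 := hF.comp (.fst .id)
  have h2 := hph.comp (.fst .id)
  have h3 := hfb.comp (.fst .id)
  refine PolyTime.foldl (s := fun v acc _ => R.simRound (F v) (ph v) (fb v) acc)
    (by fun_prop) (.const _) (by fun_prop) (2 * R.encSize.comp Q + 4 * Q + 20)
    (fun v acc x => (R.size_simRound_le _ _ _ _).trans ?_)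
  have h4 := hQ v
  have h5 := R.encSize.eval_nat_mono h4
  simp only [Polynomial.eval_add, Polynomial.eval_mul, Polynomial.eval_comp,
    Polynomial.eval_ofNat]
  omega

@[fun_prop]
theorem polyTime_simChallenge {F S C i : Data → Data} (hF : PolyTime F) (hS : PolyTime S)
    (hC : PolyTime C) (hi : PolyTime i) :
    PolyTime fun v => R.simChallenge (F v) (S v) (C v) (i v) := by
  unfold simChallenge; fun_prop

@[fun_prop]
theorem polyTime_simFinish {F S C p₁ i₀ i₁ : Data → Data} (hF : PolyTime F) (hS : PolyTime S)
    (hC : PolyTime C) (hp : PolyTime p₁) (hi : PolyTime i₀) (hi' : PolyTime i₁) :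
    PolyTime fun v => R.simFinish (F v) (S v) (C v) (p₁ v) (i₀ v) (i₁ v) := by
  unfold simFinish; fun_prop

@[fun_prop]
theorem polyTime_simGame {F S C : Data → Data} (hF : PolyTime F) (hS : PolyTime S)
    (hC : PolyTime C) : PolyTime fun v => R.simGame (F v) (S v) (C v) := by
  unfold simGame simCommit; fun_prop

@[fun_prop]
theorem polyTime_isGood {k pp td r : Data → Data} (hk : PolyTime k) (hpp : PolyTime pp)
    (htd : PolyTime td) (hr : PolyTime r) :
    PolyTime fun v => R.isGood (k v) (pp v) (td v) (r v) := by
  have hk' := hk.comp (.fst .id)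
  have hpp' := hpp.comp (.fst .id)
  have htd' := htd.comp (.fst .id)
  have : PolyTime fun v => foldl (fun acc x =>
      Data.sel (R.teval (.list [k v, pp v, td v, x])).fst .leaf acc) (bit true) (r v).snd.fst := by
    refine PolyTime.foldl (s := fun v acc x =>
      Data.sel (R.teval (.list [k v, pp v, td v, x])).fst .leaf acc) (by fun_prop) (.const _)
      (by fun_prop) 1 (fun v acc x => ?_)
    rw [sel_eq_ite]
    split_ifs <;> simp [size] <;> omega
  unfold isGood
  fun_prop

@[fun_prop]
theorem polyTime_allBad {k pp cs g r idx tape : Data → Data} (hk : PolyTime k) (hpp : PolyTime pp)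
    (hcs : PolyTime cs) (hg : PolyTime g) (hr : PolyTime r) (hidx : PolyTime idx)
    (htape : PolyTime tape) :
    PolyTime fun v => R.allBad (k v) (pp v) (cs v) (g v) (r v) (idx v) (tape v) := by
  have hk' := hk.comp (.fst .id)
  have hpp' := hpp.comp (.fst .id)
  have hcs' := hcs.comp (.fst .id)
  have hg' := hg.comp (.fst .id)
  have hr' := hr.comp (.fst .id)
  refine PolyTime.fst (PolyTime.foldl (s := fun v acc _ =>
    .node
      (Data.sel (R.isGood (k v) (pp v) (R.trap (.list [k v, .list [pp v, cs v, g v],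
        Data.take (unary (R.trapCoins.eval (k v).len)) acc.snd])).snd (r v)) .leaf acc.fst)
      (Data.drop (unary (R.trapCoins.eval (k v).len)) acc.snd))
    (by fun_prop) (by fun_prop) hidx 3 (fun v acc x => ?_))
  have h1 := size_drop_le (unary (R.trapCoins.eval (k v).len)) acc.snd
  have h4 : acc.fst.size + acc.snd.size ≤ acc.size + 1 := by cases acc <;> simp [size]; omega
  rw [sel_eq_ite]
  have h5 := acc.fst.size_pos
  split_ifs <;> simp [size] <;> omega

theorem polyTime_program : PolyTime R.program := by
  unfold program decideInput decideParts decideWith decision env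
  fun_prop

/-- The distinguisher. -/
noncomputable def distinguisher : PPT where
  fn := R.program
  polyTime := R.polyTime_program
  -- The tape of the adversary, the randomness of one trapdoor, `k` bits for the index, and the
  -- randomness of the fresh trapdoors, whose number is at most `2 * R.trials` by `indexRange_le`.
  coins := R.coins + (R.trapCoins + (.X + 2 * R.trials * R.trapCoins))

end Toolkit

/-! ### Correctness of the simulation on the level of data. -/

theorem Data.foldl_unary (f : Data → Data) (acc : Data) (n : ℕ) :
    foldl (fun a _ => f a) acc (unary n) = f^[n] acc := by
  rw [unary, foldl_list]
  induction n generalizing acc with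
  | zero => rfl
  | succ n ih => rw [List.replicate, List.foldl_cons, ih, Function.iterate_succ_apply]

/-- Because of this `sel` can test whether an exponent vanishes. -/
theorem Data.nat_eq_leaf {n : ℕ} : nat n = leaf ↔ n = 0 := by
  constructor
  · intro h
    rcases hb : n.bits with _ | ⟨b, l⟩
    · have := Nat.size_eq_bits_len n
      exact Nat.size_eq_zero.1 (by simpa [hb] using this.symm)
    · simp [nat, bits, hb] at h
  · rintro rfl
    rfl

theorem Data.str_succ {k : ℕ} (X : Fin (k + 1) → Bool) :
    str X = node (bit (X 0)) (str fun i => X i.succ) := by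
  simp [str, bits, List.ofFn_succ]

/-- The bit string that differs from a given one in the first bit. -/
def flipZero {k : ℕ} (X : Fin k → Bool) : Fin k → Bool := fun i => if i.val = 0 then !X i else X i

theorem flipZero_ne {k : ℕ} (hk : 0 < k) (X : Fin k → Bool) : flipZero X ≠ X := by
  intro h
  have := congrFun h ⟨0, hk⟩
  simp [flipZero] at this

theorem Data.flipFirst_str {k : ℕ} (hk : 0 < k) (X : Fin k → Bool) :
    flipFirst (str X) = str (flipZero X) := by
  obtain ⟨k, rfl⟩ : ∃ j, k = j + 1 := ⟨k - 1, by omega⟩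
  rw [str_succ, str_succ]
  simp [flipFirst, flipZero]

/-- The transcript `r` does not interfere with a trapdoor that has the exponents `a`. -/
def Transcript.Good {k : ℕ} {α : Type} [Zero α] (r : Transcript (Fin k → Bool))
    (a : (Fin k → Bool) → α) : Prop :=
  a r.first ≠ 0 ∧ a (flipZero r.first) = 0 ∧ ∀ X ∈ r.revealed, a X = 0

/-- The representation of a transcript. -/
def Transcript.toData {k : ℕ} (r : Transcript (Fin k → Bool)) : Data :=
  .node (str r.first) (.node (.list (r.revealed.map str)) r.out)

/-- The representation of an optional transcript. -/
def optData {k : ℕ} : Option (Transcript (Fin k → Bool)) → Data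
  | none => leaf
  | some r => r.toData

@[simp] theorem optData_none {k : ℕ} :
    optData (none : Option (Transcript (Fin k → Bool))) = leaf := rfl

@[simp] theorem optData_some {k : ℕ} (r : Transcript (Fin k → Bool)) :
    optData (some r) = r.toData := rfl

namespace Toolkit

variable (R : Toolkit)

/-- The representation of the state of a query phase. -/
noncomputable def phaseData {k : ℕ} (forb : Set (Fin k → Bool)) (st : List Data × List Data) : Data :=
  .node (.list st.1) (.list ((revealed str forb st.2).map str))

/-- The program records only the identities whose keys it handed out; other queries affect neither
the admissibility test nor the goodness of the trapdoor. -/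
theorem simRound_phaseData {k : ℕ} {F ph : Data} (hF : F.fst.fst = unary k)
    {O : (Fin k → Bool) → Data} (hO : ∀ X, R.simKey F (str X) = O X)
    (fl : List (Fin k → Bool)) (st : List Data × List Data) :
    R.simRound F ph (.list (fl.map str)) (phaseData {X | X ∈ fl} st)
      = phaseData {X | X ∈ fl} (queryRound (fun ans => R.simView F ph (.list ans))
          (keyAnswer str O {X | X ∈ fl}) st) := by
  classical
  obtain ⟨ans, asked⟩ := st
  rw [simRound, queryRound, sel_eq_ite]
  simp only [phaseData, fst_node]
  by_cases h : (R.simView F ph (.list ans)).fst = leaf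
  · simp only [h, if_true]
  simp only [h, if_false]
  generalize (R.simView F ph (.list ans)).snd = q
  rw [simQuery, hF, sel_eq_ite, sel_eq_ite]
  simp only [fst_node, snd_node, append_list]
  split_ifs with h1 h2
  · obtain ⟨w, rfl⟩ := notStr_unary_eq_leaf.1 h1
    have hw : w ∉ fl := by
      intro hw
      exact (mem_list.1 h2) (List.mem_map_of_mem hw)
    simp [revealed, keyAnswer, parse_str str_injective, hO, hw]
  · obtain ⟨w, rfl⟩ := notStr_unary_eq_leaf.1 h1
    have hw : w ∈ fl := by
      rw [mem_list, not_not, List.mem_map] at h2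
      obtain ⟨w', hw', h⟩ := h2
      rwa [← str_injective h]
    simp [revealed, keyAnswer, parse_str str_injective, hw]
  · have hp : parse (str : (Fin k → Bool) → Data) q = none := by
      rw [Option.eq_none_iff_forall_ne_some]
      intro w hw
      exact h1 (notStr_unary_eq_leaf.2 ⟨w, (parse_eq_some str_injective).1 hw⟩)
    simp [revealed, keyAnswer, hp]

theorem simPhase_eq {k : ℕ} {F ph : Data} (hF : F.fst.fst = unary k)
    {O : (Fin k → Bool) → Data} (hO : ∀ X, R.simKey F (str X) = O X)
    (fl : List (Fin k → Bool)) :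
    R.simPhase F ph (.list (fl.map str)) = phaseData {X | X ∈ fl}
      (queryPhase (fun ans => R.simView F ph (.list ans)) (keyAnswer str O {X | X ∈ fl})
        (R.queries.eval k) [] []).2 := by
  rw [queryPhase_eq_iterate, simPhase, hF, len_unary, foldl_unary]
  have : Data.node leaf leaf = phaseData {X | X ∈ fl} ([], []) := by simp [phaseData, revealed]
  rw [this]
  generalize (([], []) : List Data × List Data) = st
  induction R.queries.eval k generalizing st with
  | zero => rfl
  | succ m ih =>
    rw [Function.iterate_succ_apply, Function.iterate_succ_apply, R.simRound_phaseData hF hO, ih]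

theorem simGame_eq {k : ℕ} {F S C : Data} (hF : F.fst.fst = unary k)
    {O : (Fin k → Bool) → Data} (hO : ∀ X, R.simKey F (str X) = O X) :
    R.simGame F S C = optData (runGame str
        (fun ans rest => R.next (.list [F.fst, F.snd.fst, F.snd.snd.fst, .list ans, rest])) O
        (fun s => R.simChallenge F S C (str s.first)) (R.queries.eval k)) := by
  have h1 := R.simPhase_eq (ph := leaf) hF hO []
  have he : ({X | X ∈ ([] : List (Fin k → Bool))} : Set (Fin k → Bool)) = ∅ := by ext; simp
  rw [List.map_nil, list_nil, he] at h1
  unfold simGame runGame commitPhase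
  rw [h1]
  simp only [simView, sel_leaf]
  -- Whether a phase is ended by the adversary or by the query bound, its final message is the
  -- message that follows the answers collected.
  have hq : ∀ ph : Data × List Data × List Data, ph = queryPhase (fun ans => R.next (.list [F.fst,
      F.snd.fst, F.snd.snd.fst, .list ans, .leaf])) (keyAnswer str O ∅) (R.queries.eval k) [] [] →
      (R.next (.list [F.fst, F.snd.fst, F.snd.snd.fst, .list ph.2.1, .leaf])).snd = ph.1 := by
    rintro ph rfl
    rw [queryPhase_eq_iterate]
  generalize hph : queryPhase (fun ans => R.next (.list [F.fst, F.snd.fst, F.snd.snd.fst,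
    .list ans, .leaf])) (keyAnswer str O ∅) (R.queries.eval k) [] [] = ph
  replace hq := hq ph hph.symm
  simp only [phaseData, fst_node]
  rw [hq]
  simp only [simCommit, hF, snd_node, sel_eq_ite]
  rcases hp0 : parse (str : (Fin k → Bool) → Data) ph.1.fst with _ | i₀
  · rw [if_neg]
    · simp
    · rw [notStr_unary_eq_leaf]
      rintro ⟨w, hw⟩
      simp [(parse_eq_some str_injective).2 hw] at hp0
  rcases hp1 : parse (str : (Fin k → Bool) → Data) ph.1.snd with _ | i₁
  · rw [if_neg (c := notStr (unary k) ph.1.snd = leaf)]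
    · simp
    · rw [notStr_unary_eq_leaf]
      rintro ⟨w, hw⟩
      simp [(parse_eq_some str_injective).2 hw] at hp1
  replace hp0 := (parse_eq_some str_injective).1 hp0
  replace hp1 := (parse_eq_some str_injective).1 hp1
  rw [← hp0, ← hp1, if_pos (notStr_unary_eq_leaf.2 ⟨_, rfl⟩),
    if_pos (notStr_unary_eq_leaf.2 ⟨_, rfl⟩)]
  -- Nothing is forbidden in the first phase, so the test of the program on revealed identities
  -- agrees with the test of the game on all queries.
  have hm : ∀ i : Fin k → Bool,
      mem (str i) (.list ((revealed (str : (Fin k → Bool) → Data) ∅ ph.2.2).map str)) = leaf ↔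
      str i ∉ ph.2.2 := by
    intro i
    rw [mem_list, List.mem_map]
    simp [mem_revealed str_injective, str_injective.eq_iff]
  rw [hm i₀, hm i₁]
  by_cases h0 : str i₀ ∈ ph.2.2
  · simp [h0]
  by_cases h1 : str i₁ ∈ ph.2.2
  · simp [h1]
  have h2 := R.simPhase_eq (ph := .node (.list ph.2.1) (R.simChallenge F S C (str i₀)))
    hF hO [i₀, i₁]
  simp only [List.map_cons, List.map_nil] at h2
  simp only [h0, h1, not_false_eq_true, if_true, or_self, if_false, Option.map_some, simFinish,
    fst_node, h2, simView, sel_node, snd_node, phaseData, append_list]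
  have hs : ({X | X ∈ [i₀, i₁]} : Set (Fin k → Bool)) = {i₀, i₁} := by ext; simp
  have hout : (R.next (.list [F.fst, F.snd.fst, F.snd.snd.fst, .list ph.2.1, .node (R.simChallenge
      F S C (str i₀)) (.list (queryPhase (fun ans => R.next (.list [F.fst, F.snd.fst,
      F.snd.snd.fst, .list ph.2.1, .node (R.simChallenge F S C (str i₀)) (.list ans)]))
      (keyAnswer str O {i₀, i₁}) (R.queries.eval k) [] []).2.1)])).snd = (queryPhase (fun ans =>
        R.next (.list [F.fst, F.snd.fst, F.snd.snd.fst, .list ph.2.1, .node (R.simChallenge F S C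
        (str i₀)) (.list ans)])) (keyAnswer str O {i₀, i₁}) (R.queries.eval k) [] []).1 := by
    rw [queryPhase_eq_iterate]
  simp only [hs, optData_some, Transcript.toData, finish, guessPhase, List.map_append, hout]

end Toolkit

theorem Data.take_unary_bits (n : ℕ) (l : List Bool) :
    take (unary n) (bits l) = bits (l.take n) := by
  simp [bits]

theorem Data.drop_unary_bits (n : ℕ) (l : List Bool) :
    drop (unary n) (bits l) = bits (l.drop n) := by
  simp [bits]

/-- The result of `Data.index` as a number, from an arbitrary initial state. -/
def indexNat (t : ℕ) : ℕ → ℕ → List Bool → ℕ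
  | _, idx, [] => idx
  | cnt, idx, x :: xs =>
    if cnt ≤ t then indexNat t (cnt + cnt) (if x then cnt + idx else idx) xs
    else indexNat t cnt idx xs

theorem Data.index_unary (t : ℕ) (l : List Bool) :
    index (unary t) (bits l) = unary (indexNat t 1 0 l) := by
  suffices ∀ cnt idx, ((l.map bit).foldl (indexStep (unary t)) (node (unary cnt) (unary idx))).snd
      = unary (indexNat t cnt idx l) from this 1 0 ▸ foldl_list _ _ _ ▸ rfl
  induction l with
  | nil => intro cnt idx; rfl
  | cons x xs ih =>
    intro cnt idx
    have h1 : indexStep (unary t) (node (unary cnt) (unary idx)) (bit x)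
        = if cnt ≤ t then node (unary (cnt + cnt)) (unary (if x then cnt + idx else idx))
          else node (unary cnt) (unary idx) := by
      rw [indexStep, sel_eq_ite, fst_node, ulen_eq, len_unary, snd_node, append_unary, append_unary]
      simp only [drop_eq_leaf, len_unary]
      split_ifs <;> simp_all [bit]
    rw [List.map_cons, List.foldl_cons, h1, indexNat]
    split_ifs
    all_goals exact ih _ _

/-- The first `n` blocks of length `c` of a list satisfy `B`. -/
def AllBlocks (B : List Bool → Prop) (c : ℕ) : ℕ → List Bool → Prop
  | 0, _ => True
  | n + 1, l => B (l.take c) ∧ AllBlocks B c n (l.drop c)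

namespace Toolkit

variable (R : Toolkit)

theorem isGood_iff {k : ℕ} (hk : 0 < k) {p : ℕ} {pp td : Data} {a : (Fin k → Bool) → ZMod p}
    (ha : ∀ X, (R.teval (.list [unary k, pp, td, str X])).fst = nat (a X).val)
    (r : Transcript (Fin k → Bool)) :
    R.isGood (unary k) pp td r.toData ≠ leaf ↔ r.Good a := by
  have hz : ∀ X, (R.teval (.list [unary k, pp, td, str X])).fst = leaf ↔ a X = 0 := by
    intro X
    rw [ha, nat_eq_leaf, ZMod.val_eq_zero]
  have hfold : ∀ (l : List (Fin k → Bool)) acc, (l.map str).foldl (fun acc x =>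
      sel (R.teval (.list [unary k, pp, td, x])).fst leaf acc) acc ≠ leaf ↔
      acc ≠ leaf ∧ ∀ X ∈ l, a X = 0 := by
    intro l
    induction l with
    | nil => simp
    | cons X l ih =>
      intro acc
      rw [List.map_cons, List.foldl_cons, ih, sel_eq_ite]
      simp only [hz, List.forall_mem_cons]
      split_ifs with h <;> simp [h]
  unfold isGood Transcript.Good Transcript.toData
  simp only [fst_node, snd_node, flipFirst_str hk, sel_eq_ite, hz, foldl_list]
  by_cases h1 : a r.first = 0
  · simp [h1]
  · by_cases h2 : a (flipZero r.first) = 0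
    · have := hfold r.revealed (bit true)
      simp only [sel_eq_ite] at this
      rw [if_neg h1, if_pos h2, this]
      simp [h1, h2, bit]
    · simp [h1, h2]

theorem allBad_iff {k n : ℕ} {pp cs g r : Data} (l : List Bool) :
    R.allBad (unary k) pp cs g r (unary n) (bits l) ≠ leaf ↔
      AllBlocks (fun w => R.isGood (unary k) pp
        (R.trap (.list [unary k, .list [pp, cs, g], bits w])).snd r = leaf)
        (R.trapCoins.eval k) n l := by
  rw [allBad, foldl_unary, len_unary]
  suffices ∀ flag, ((fun acc => Data.node
      (sel (R.isGood (unary k) pp (R.trap (.list [unary k, .list [pp, cs, g],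
        take (unary (R.trapCoins.eval k)) acc.snd])).snd r) leaf acc.fst)
      (drop (unary (R.trapCoins.eval k)) acc.snd))^[n] (.node flag (bits l))).fst ≠ leaf ↔
      flag ≠ leaf ∧ AllBlocks (fun w => R.isGood (unary k) pp
        (R.trap (.list [unary k, .list [pp, cs, g], bits w])).snd r = leaf)
        (R.trapCoins.eval k) n l by
    simpa [bit] using this (bit true)
  induction n generalizing l with
  | zero => simp [AllBlocks]
  | succ n ih =>
    intro flag
    rw [Function.iterate_succ_apply, snd_node, fst_node, take_unary_bits, drop_unary_bits, ih,
      sel_eq_ite, AllBlocks]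
    split_ifs with h <;> simp [h, -list_cons]

theorem decision_iff {k : ℕ} {pp cs g o : Data} (lb lf : List Bool)
    (r : Option (Transcript (Fin k → Bool))) :
    R.decision (unary k) pp cs g o (bits lb) (bits lf)
      (optData r) ≠ leaf ↔
    ∃ r', r = some r' ∧ R.isGood (unary k) pp o.snd r'.toData ≠ leaf ∧
      AllBlocks (fun w => R.isGood (unary k) pp
        (R.trap (.list [unary k, .list [pp, cs, g], bits w])).snd r'.toData = leaf)
        (R.trapCoins.eval k) (indexNat (R.trials.eval k) 1 0 lb) lf ∧ r'.out ≠ leaf := by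
  rcases r with _ | r
  · simp [decision]
  · have h1 : r.toData ≠ leaf := by simp [Transcript.toData]
    have h2 := R.allBad_iff (k := k) (n := indexNat (R.trials.eval k) 1 0 lb) (pp := pp) (cs := cs)
      (g := g) (r := r.toData) lf
    simp only [Option.some.injEq, exists_eq_left', ← h2, optData_some]
    unfold decision
    rw [len_unary, index_unary, sel_eq_ite, if_neg h1, sel_eq_ite, sel_eq_ite]
    split_ifs with h3 h4
    · simp [h3]
    · simp [h4]
    · have h5 : r.toData.snd.snd = r.out := rfl
      simp [h3, h4, h5]

end Toolkit

/-! ### Algebra in a group system. -/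

namespace GroupSystem

variable {n : ℕ} (Γ : GroupSystem n)

theorem exists_gen_pow {i : ℕ} (hi : i ≤ n) (x : Γ.G i) : ∃ a : ℕ, x = Γ.gen i ^ a := by
  obtain ⟨a, ha⟩ := mem_powers_iff_mem_zpowers.2 (Γ.gen_spec i hi x)
  exact ⟨a, ha.symm⟩

theorem pow_gen_pow {i : ℕ} (a : ℕ) (x : ZMod Γ.p) :
    Γ.pow (Γ.gen i ^ a) x = Γ.gen i ^ (a * x.val) := by
  rw [pow, pow_mul]

theorem pow_zero {i : ℕ} (g : Γ.G i) : Γ.pow g 0 = 1 := by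
  simp [pow]

theorem e_one_left {i j l : ℕ} (h : i + j = l) (hl : l ≤ n) (y : Γ.G j) : Γ.e h 1 y = 1 := by
  obtain ⟨b, rfl⟩ := Γ.exists_gen_pow (by omega) y
  simpa using Γ.e_gen h hl 0 b

theorem e_zero_left {j : ℕ} (hj : j ≤ n) (a : ℕ) (y : Γ.G j) :
    Γ.e (Nat.zero_add j) (Γ.gen 0 ^ a) y = y ^ a := by
  obtain ⟨b, rfl⟩ := Γ.exists_gen_pow hj y
  rw [Γ.e_gen _ hj, ← pow_mul, mul_comm]

theorem pow_e {i j l : ℕ} (h : i + j = l) (hl : l ≤ n) (x : Γ.G i) (y : Γ.G j) (z : ZMod Γ.p) :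
    Γ.pow (Γ.e h x y) z = Γ.e h x (Γ.pow y z) := by
  obtain ⟨a, rfl⟩ := Γ.exists_gen_pow (by omega) x
  obtain ⟨b, rfl⟩ := Γ.exists_gen_pow (by omega) y
  simp only [Γ.e_gen h hl, pow_gen_pow, mul_assoc]

theorem multi_gen_pow {j : ℕ} (hj : 1 ≤ j) (hn : j ≤ n) (a : Fin j → ℕ) :
    Γ.multi j (fun i => Γ.gen 1 ^ a i) = Γ.gen j ^ ∏ i, a i := by
  obtain ⟨j, rfl⟩ : ∃ m, j = m + 1 := ⟨j - 1, by omega⟩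
  induction j with
  | zero => simp [multi]
  | succ j ih =>
    rw [multi, ih (by omega) (by omega) fun i => a i.succ, Γ.e_gen _ hn, ← Fin.prod_univ_succ a]

/-- The simulated challenge equals the genuine one: if `H = e(c₁, …, c_l)^a · e(B, g)` with
`c_i = g^{x_i}`, then `e(H, g^x)^r` can be computed from `e(c₁, …, c_l, g^x)^r`. -/
theorem challenge_eq {l : ℕ} (hl : 1 ≤ l) (hn : l + 1 ≤ n) (g : Γ.G 1) (x : Fin (l + 1) → ZMod Γ.p)
    (r a : ZMod Γ.p) (B : Γ.G (l - 1)) :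
    Γ.pow (Γ.e rfl (Γ.pow (Γ.multi l fun i => Γ.pow g (x i.castSucc)) a
        * Γ.e (Nat.sub_add_cancel hl) B g) (Γ.pow g (x (Fin.last l)))) r
      = Γ.pow (Γ.pow (Γ.multi (l + 1) fun i => Γ.pow g (x i)) r) a
        * Γ.e rfl (Γ.e (Nat.sub_add_cancel hl) B (Γ.pow g r)) (Γ.pow g (x (Fin.last l))) := by
  obtain ⟨b, rfl⟩ := Γ.exists_gen_pow (by omega) B
  obtain ⟨c, rfl⟩ := Γ.exists_gen_pow (by omega) g
  simp only [pow_gen_pow, Γ.multi_gen_pow hl (by omega), Γ.multi_gen_pow (j := l + 1) (by omega) hn,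
    Γ.e_gen (Nat.sub_add_cancel hl) (by omega), ← pow_add, Γ.e_gen (i := l) (j := 1) rfl hn,
    Fin.prod_univ_castSucc]
  congr 1
  ring

theorem orderOf_eq {i : ℕ} (hi : i ≤ n) {g : Γ.G i} (hg : g ≠ 1) : orderOf g = Γ.p := by
  have h : orderOf g ∣ Γ.p := Γ.card_eq i hi ▸ orderOf_dvd_card
  exact ((Nat.dvd_prime Γ.prime).1 h).resolve_left fun h => hg (orderOf_eq_one_iff.1 h)

theorem pow_bijective {i : ℕ} (hi : i ≤ n) {g : Γ.G i} (hg : g ≠ 1) :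
    Function.Bijective (Γ.pow g) := by
  rw [Fintype.bijective_iff_injective_and_card]
  refine ⟨fun x y h => ?_, by rw [ZMod.card, Γ.card_eq i hi]⟩
  apply ZMod.val_injective
  refine pow_injOn_Iio_orderOf ?_ ?_ h
  · rw [Γ.orderOf_eq hi hg]; exact ZMod.val_lt x
  · rw [Γ.orderOf_eq hi hg]; exact ZMod.val_lt y

/-- A nonzero exponent is prime to the group order. Thus `S^a` is uniform if `S` is, which hides the
challenge key in the random case. -/
theorem pow_left_bijective {i : ℕ} (hi : i ≤ n) {a : ZMod Γ.p} (ha : a ≠ 0) :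
    Function.Bijective fun y : Γ.G i => Γ.pow y a := by
  have h : (Nat.card (Γ.G i)).Coprime a.val := by
    rw [Nat.card_eq_fintype_card, Γ.card_eq i hi, Nat.Prime.coprime_iff_not_dvd Γ.prime]
    intro h
    exact ha ((ZMod.val_eq_zero a).1 (Nat.eq_zero_of_dvd_of_lt h (ZMod.val_lt a)))
  exact (powCoprime h).bijective

theorem pow_eq_one_iff {i : ℕ} (hi : i ≤ n) (g : Γ.G i) (x : ZMod Γ.p) :
    Γ.pow g x = 1 ↔ g = 1 ∨ x = 0 := by
  constructor
  · intro h
    by_contra! hne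
    exact hne.2 ((Γ.pow_bijective hi hne.1).1 (h.trans (Γ.pow_zero g).symm))
  · rintro (rfl | rfl)
    · simp [pow]
    · exact Γ.pow_zero g

/-- Exponents multiply modulo a prime, so the maps are nondegenerate. -/
theorem e_eq_one_iff {i j l : ℕ} (h : i + j = l) (hl : l ≤ n) (x : Γ.G i) (y : Γ.G j) :
    Γ.e h x y = 1 ↔ x = 1 ∨ y = 1 := by
  obtain ⟨a, rfl⟩ := Γ.exists_gen_pow (by omega) x
  obtain ⟨b, rfl⟩ := Γ.exists_gen_pow (by omega) y
  have hp : ∀ i ≤ n, ∀ a : ℕ, Γ.gen i ^ a = 1 ↔ Γ.p ∣ a := by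
    intro i hi a
    rw [← orderOf_dvd_iff_pow_eq_one, orderOf_eq_card_of_forall_mem_zpowers (Γ.gen_spec i hi),
      Nat.card_eq_fintype_card, Γ.card_eq i hi]
  rw [Γ.e_gen h hl, hp l hl, hp i (by omega), hp j (by omega), Γ.prime.dvd_mul]

end GroupSystem

/-! ### Mean values, indicators and probabilities. -/

/-- The mean value of a function on a finite type. -/
noncomputable def avg {α : Type*} [Fintype α] (f : α → ℝ) : ℝ := (∑ a, f a) / Fintype.card α

open Classical in
/-- The truth value of a proposition as a real number. -/
noncomputable def ind (P : Prop) : ℝ := if P then 1 else 0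

theorem ind_nonneg (P : Prop) : 0 ≤ ind P := by unfold ind; split_ifs <;> norm_num
theorem ind_le_one (P : Prop) : ind P ≤ 1 := by unfold ind; split_ifs <;> norm_num
@[simp] theorem ind_true : ind True = 1 := by simp [ind]
@[simp] theorem ind_false : ind False = 0 := by simp [ind]
theorem ind_and (P Q : Prop) : ind (P ∧ Q) = ind P * ind Q := by
  by_cases hP : P <;> by_cases hQ : Q <;> simp [hP, hQ]
theorem ind_not (P : Prop) : ind (¬P) = 1 - ind P := by
  by_cases hP : P <;> simp [hP]
theorem ind_mono {P Q : Prop} (h : P → Q) : ind P ≤ ind Q := by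
  by_cases hP : P
  · simp [hP, h hP]
  · simpa [hP] using ind_nonneg Q

section avg

variable {α β : Type*} [Fintype α] [Fintype β]

theorem avg_const [Nonempty α] (c : ℝ) : avg (fun _ : α => c) = c := by
  simp [avg]

theorem avg_add (f g : α → ℝ) : avg (fun a => f a + g a) = avg f + avg g := by
  simp [avg, Finset.sum_add_distrib, add_div]

theorem avg_sub (f g : α → ℝ) : avg (fun a => f a - g a) = avg f - avg g := by
  simp [avg, Finset.sum_sub_distrib, sub_div]

theorem avg_mul_left (c : ℝ) (f : α → ℝ) : avg (fun a => c * f a) = c * avg f := by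
  simp [avg, ← Finset.mul_sum, mul_div_assoc]

theorem avg_mul_right (c : ℝ) (f : α → ℝ) : avg (fun a => f a * c) = avg f * c := by
  simp only [mul_comm _ c, avg_mul_left]

theorem avg_mono {f g : α → ℝ} (h : ∀ a, f a ≤ g a) : avg f ≤ avg g :=
  div_le_div_of_nonneg_right (Finset.sum_le_sum fun a _ => h a) (Nat.cast_nonneg _)

theorem avg_nonneg {f : α → ℝ} (h : ∀ a, 0 ≤ f a) : 0 ≤ avg f :=
  div_nonneg (Finset.sum_nonneg fun a _ => h a) (Nat.cast_nonneg _)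

theorem avg_le_of_le [Nonempty α] {f : α → ℝ} {c : ℝ} (h : ∀ a, f a ≤ c) : avg f ≤ c :=
  (avg_mono h).trans_eq (avg_const c)

theorem le_avg_of_le [Nonempty α] {f : α → ℝ} {c : ℝ} (h : ∀ a, c ≤ f a) : c ≤ avg f :=
  (avg_const c).symm.trans_le (avg_mono h)

theorem abs_avg_sub_le {f g h : α → ℝ} (H : ∀ a, |f a - g a| ≤ h a) :
    |avg f - avg g| ≤ avg h := by
  rw [← avg_sub, abs_le]
  constructor
  · rw [neg_le_iff_add_nonneg, ← avg_add]
    exact avg_nonneg fun a => by linarith [(abs_le.1 (H a)).1]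
  · exact avg_mono fun a => (abs_le.1 (H a)).2

theorem avg_comm (f : α → β → ℝ) :
    avg (fun a => avg fun b => f a b) = avg fun b => avg fun a => f a b := by
  simp only [avg, ← Finset.sum_div]
  rw [Finset.sum_comm, div_right_comm]

theorem avg_prod (f : α × β → ℝ) : avg f = avg fun a => avg fun b => f (a, b) := by
  simp only [avg, Fintype.sum_prod_type, Fintype.card_prod, ← Finset.sum_div, div_div, Nat.cast_mul]
  rw [mul_comm]

theorem avg_bijective {e : α → β} (he : Function.Bijective e) (f : β → ℝ) :
    avg (fun a => f (e a)) = avg f := by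
  rw [avg, avg, he.sum_comp, Fintype.card_of_bijective he]

theorem avg_ind_eq (a₀ : α) : avg (fun a => ind (a = a₀)) = 1 / Fintype.card α := by
  classical
  simp [avg, ind]

theorem avg_bool (f : Bool → ℝ) : avg f = (f true + f false) / 2 := by
  simp [avg]

end avg

section prob

variable {α β : Type*}

theorem prob_uniform_bind [Fintype α] [Nonempty α] (f : α → PMF β) (S : Set β) :
    prob ((PMF.uniformOfFintype α).bind f) S = avg fun a => prob (f a) S := by
  have hfin : ∀ a, (f a).toOuterMeasure S ≠ ⊤ := fun a =>
    ne_top_of_le_ne_top ENNReal.one_ne_top ((f a).toOuterMeasure_apply S ▸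
      (ENNReal.tsum_le_tsum fun x => Set.indicator_le_self' (fun _ _ => zero_le) x).trans_eq
        (f a).tsum_coe)
  simp only [prob, PMF.toOuterMeasure_bind_apply, tsum_fintype, PMF.uniformOfFintype_apply, avg]
  rw [ENNReal.toReal_sum fun a _ => ENNReal.mul_ne_top (by simp) (hfin a), Finset.sum_div]
  refine Finset.sum_congr rfl fun a _ => ?_
  rw [ENNReal.toReal_mul, ENNReal.toReal_inv, ENNReal.toReal_natCast, div_eq_inv_mul]

theorem prob_pure (a : α) (S : Set α) : prob (PMF.pure a) S = ind (a ∈ S) := by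
  classical
  rw [prob, PMF.toOuterMeasure_pure_apply, ind]
  split_ifs <;> simp

theorem prob_uniform_map [Fintype α] [Nonempty α] (f : α → β) (S : Set β) :
    prob ((PMF.uniformOfFintype α).map f) S = avg fun a => ind (f a ∈ S) := by
  have : (PMF.uniformOfFintype α).map f = (PMF.uniformOfFintype α).bind fun a => PMF.pure (f a) := rfl
  rw [this, prob_uniform_bind]
  simp only [prob_pure]

theorem mem_support_uniform_map [Fintype α] [Nonempty α] (f : α → β) (a : α) :
    f a ∈ ((PMF.uniformOfFintype α).map f).support := by
  rw [PMF.mem_support_map_iff]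
  exact ⟨a, by simp, rfl⟩

end prob

/-! ### Cutting the random tape, and the distribution of the random index. -/

section bits

/-- Functions of lists, rather than of `Fin n → Bool`, let the program cut its tape without casts
between index types. -/
theorem avg_bits_add (a b : ℕ) (F : List Bool → ℝ) :
    avg (fun w : Fin (a + b) → Bool => F (List.ofFn w))
      = avg fun u : Fin a → Bool => avg fun v : Fin b → Bool => F (List.ofFn u ++ List.ofFn v) := by
  rw [← avg_prod fun w : (Fin a → Bool) × (Fin b → Bool) => F (List.ofFn w.1 ++ List.ofFn w.2),
    ← avg_bijective (Fin.appendEquiv a b).bijective fun w => F (List.ofFn w)]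
  simp only [Fin.appendEquiv, Equiv.coe_fn_mk, List.ofFn_fin_append]

theorem avg_bits_succ (n : ℕ) (F : List Bool → ℝ) :
    avg (fun w : Fin (n + 1) → Bool => F (List.ofFn w))
      = (avg (fun w : Fin n → Bool => F (true :: List.ofFn w))
        + avg (fun w : Fin n → Bool => F (false :: List.ofFn w))) / 2 := by
  rw [← avg_bool fun b => avg fun w : Fin n → Bool => F (b :: List.ofFn w),
    ← avg_prod fun x : Bool × (Fin n → Bool) => F (x.1 :: List.ofFn x.2),
    ← avg_bijective (Fin.consEquiv fun _ : Fin (n + 1) => Bool).bijective fun w => F (List.ofFn w)]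
  simp [Fin.consEquiv, List.ofFn_succ]

/-- Disjoint blocks of a uniform string are independent. -/
theorem avg_allBlocks (B : List Bool → Prop) (c j n : ℕ) (h : j * c ≤ n) :
    avg (fun w : Fin n → Bool => ind (AllBlocks B c j (List.ofFn w)))
      = avg (fun w : Fin c → Bool => ind (B (List.ofFn w))) ^ j := by
  induction j generalizing n with
  | zero => simp [AllBlocks, avg_const]
  | succ j ih =>
    obtain ⟨m, rfl⟩ : ∃ m, n = c + m := ⟨n - c, by rw [add_mul] at h; omega⟩
    rw [avg_bits_add c m fun l => ind (AllBlocks B c (j + 1) l)]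
    simp only [AllBlocks, ind_and]
    have h1 : ∀ (u : Fin c → Bool) (v : Fin m → Bool),
        (List.ofFn u ++ List.ofFn v).take c = List.ofFn u := fun u v => by
      rw [List.take_append_of_le_length (by simp), List.take_of_length_le (by simp)]
    have h2 : ∀ (u : Fin c → Bool) (v : Fin m → Bool),
        (List.ofFn u ++ List.ofFn v).drop c = List.ofFn v := fun u v => by
      rw [List.drop_append_of_le_length (by simp), List.drop_of_length_le (by simp), List.nil_append]
    simp only [h1, h2, avg_mul_left, ih m (by rw [add_mul] at h; omega), avg_mul_right]
    rw [pow_succ, mul_comm]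

/-- The number of values of `indexNat`. -/
def indexRange (t : ℕ) : ℕ → ℕ → ℕ
  | cnt, 0 => cnt
  | cnt, n + 1 => if cnt ≤ t then indexRange t (cnt + cnt) n else indexRange t cnt n

theorem indexRange_le (t : ℕ) (cnt n : ℕ) : indexRange t cnt n ≤ max cnt (2 * t) := by
  induction n generalizing cnt with
  | zero => simp [indexRange]
  | succ n ih =>
    rw [indexRange]
    split_ifs
    · have := ih (cnt + cnt); omega
    · exact ih cnt

theorem lt_indexRange (t : ℕ) (cnt n : ℕ) (h : t < cnt * 2 ^ n) : t < indexRange t cnt n := by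
  induction n generalizing cnt with
  | zero => simpa [indexRange] using h
  | succ n ih =>
    rw [indexRange]
    split_ifs with h'
    · exact ih _ (by rw [pow_succ] at h; linarith)
    · refine ih cnt (lt_of_lt_of_le (not_le.1 h') (Nat.le_mul_of_pos_right _ (by positivity)))

theorem indexRange_pos (t : ℕ) (cnt n : ℕ) (h : 0 < cnt) : 0 < indexRange t cnt n := by
  induction n generalizing cnt with
  | zero => simpa [indexRange] using h
  | succ n ih =>
    rw [indexRange]
    split_ifs with h'
    · exact ih _ (by omega)
    · exact ih cnt h

/-- With `cnt = 1` and `idx = 0` the index is less than `indexRange`, so finitely many blocks of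
fresh randomness suffice. -/
theorem indexNat_add_le (t : ℕ) (cnt idx : ℕ) (l : List Bool) :
    indexNat t cnt idx l + cnt ≤ idx + indexRange t cnt l.length := by
  induction l generalizing cnt idx with
  | nil => simp [indexNat, indexRange]
  | cons x xs ih =>
    rw [indexNat, List.length_cons, indexRange]
    split_ifs with h1 h2
    · have := ih (cnt + cnt) (cnt + idx); omega
    · have := ih (cnt + cnt) idx; omega
    · exact ih cnt idx

/-- The index is `idx` plus a uniform multiple of `cnt` below `indexRange`, and the mean is a
geometric sum. The factor `1 - s ^ cnt` is kept on the left since it may vanish. -/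
theorem avg_pow_indexNat {s : ℝ} (hs : 0 ≤ s) (t cnt idx n : ℕ) (hc : 0 < cnt) :
    (1 - s ^ cnt) * avg (fun w : Fin n → Bool => s ^ indexNat t cnt idx (List.ofFn w))
      = cnt / indexRange t cnt n * s ^ idx * (1 - s ^ indexRange t cnt n) := by
  induction n generalizing cnt idx with
  | zero =>
    have : (cnt : ℝ) ≠ 0 := by positivity
    simp [indexNat, indexRange, avg, this]
    ring
  | succ n ih =>
    rw [avg_bits_succ n fun l => s ^ indexNat t cnt idx l]
    simp only [indexNat, indexRange]
    by_cases h : cnt ≤ t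
    · have h1 := ih (cnt + cnt) (cnt + idx) (by omega)
      have h2 := ih (cnt + cnt) idx (by omega)
      -- Doubling `cnt` multiplies the left factor by `1 + s ^ cnt`, which can be cancelled also for
      -- `s = 1`.
      have h3 : 1 + s ^ cnt ≠ 0 := by positivity
      simp only [h, if_true, Bool.false_eq_true, if_false]
      rw [← mul_right_inj' h3]
      rw [pow_add] at h1 h2
      rw [pow_add s cnt idx] at h1
      push_cast at h1 h2
      linear_combination (h1 + h2) / 2
    · simp only [h, if_false]
      rw [← ih cnt idx hc]
      ring

end bits

/-! ### Conditioning on the hash key. -/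

section conditioning

variable {Ω κ : Type*} [Fintype Ω]

/-- The conditional probability of `G` given `u = y`, under the uniform distribution. -/
noncomputable def condProb (u : Ω → κ) (G : Ω → Prop) (y : κ) : ℝ :=
  avg (fun τ => ind (u τ = y ∧ G τ)) / avg fun τ => ind (u τ = y)

theorem avg_ind_eq_pos [Nonempty Ω] (u : Ω → κ) (τ : Ω) : 0 < avg fun τ' => ind (u τ' = u τ) := by
  have h : avg (fun τ' => ind (τ' = τ)) ≤ avg fun τ' => ind (u τ' = u τ) :=
    avg_mono fun τ' => ind_mono fun h => by rw [h]
  rw [avg_ind_eq] at h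
  exact lt_of_lt_of_le (by positivity) h

/-- This is the tower property: weight and event may depend on the value of `u`, and the mass of
each fibre of `u` cancels the denominator of `condProb`. -/
theorem avg_mul_condProb [Nonempty Ω] (u : Ω → κ) (w : κ → ℝ) (G : κ → Ω → Prop) :
    avg (fun τ => w (u τ) * condProb u (G (u τ)) (u τ)) = avg fun τ => w (u τ) * ind (G (u τ) τ) := by
  have h1 : ∀ τ, w (u τ) * condProb u (G (u τ)) (u τ) = avg fun τ' =>
      w (u τ') * ind (G (u τ') τ') / avg (fun σ => ind (u σ = u τ')) * ind (u τ = u τ') := by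
    intro τ
    unfold condProb
    rw [mul_div_assoc', ← avg_mul_left, div_eq_mul_inv, ← avg_mul_right]
    congr 1
    funext τ'
    by_cases h : u τ' = u τ
    · simp [h, div_eq_mul_inv]
    · simp [h, Ne.symm h]
  simp only [h1]
  rw [avg_comm]
  congr 1
  funext τ'
  rw [avg_mul_left, div_mul_cancel₀ _ (avg_ind_eq_pos u τ').ne']

theorem avg_condProb [Nonempty Ω] (u : Ω → κ) (G : Ω → Prop) :
    avg (fun τ => condProb u G (u τ)) = avg fun τ => ind (G τ) := by
  simpa using avg_mul_condProb u (fun _ => 1) fun _ => G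

end conditioning

/-! ### The artificial abort. -/

/-- The probability that a random number of fresh trials fails, if each of them succeeds with
probability `p`. -/
noncomputable def failProb (t k : ℕ) (p : ℝ) : ℝ :=
  avg fun w : Fin k → Bool => (1 - p) ^ indexNat t 1 0 (List.ofFn w)

/-- The mean of `(1-p)^j` over `j < N` is a geometric sum, and multiplication by `p` makes it
telescope. The dependence on `p` is confined to the small term `(1-p)^N`. -/
theorem mul_failProb {p : ℝ} (hp : p ≤ 1) (t k : ℕ) :
    indexRange t 1 k * (p * failProb t k p) = 1 - (1 - p) ^ indexRange t 1 k := by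
  have h := avg_pow_indexNat (s := 1 - p) (by linarith) t 1 0 k one_pos
  have hN : (indexRange t 1 k : ℝ) ≠ 0 := by
    have := indexRange_pos t 1 k one_pos
    positivity
  rw [pow_one, sub_sub_cancel] at h
  rw [failProb, h]
  field_simp
  simp

theorem failProb_mem {p : ℝ} (hp0 : 0 ≤ p) (hp : p ≤ 1) (t k : ℕ) :
    0 ≤ failProb t k p ∧ failProb t k p ≤ 1 :=
  ⟨avg_nonneg fun w => pow_nonneg (by linarith) _,
    avg_le_of_le fun w => pow_le_one₀ (by linarith) (by linarith)⟩

section abort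

variable {ι Ω : Type} [Fintype Ω] [Nonempty Ω]

/-- The outcome of the game is a transcript with output `1`. -/
def Wins (r : Option (Transcript ι)) : Prop := ∃ r', r = some r' ∧ r'.out ≠ .leaf

/-- The probability that the distinguisher outputs `1` if the transcript is `r` and the trapdoor
comes from the randomness `τ`. -/
noncomputable def acceptProb (good : Ω → Transcript ι → Prop) (t k : ℕ) (τ : Ω) :
    Option (Transcript ι) → ℝ
  | none => 0
  | some r => ind (good τ r) * ind (r.out ≠ .leaf) * failProb t k (avg fun σ => ind (good σ r))

/-- The artificial abort makes the probability of an abort almost independent of the transcript. -/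
theorem abs_acceptProb_sub_le (u : Ω → Data) (good : Ω → Transcript ι → Prop) (t k : ℕ)
    (tr : Data → Option (Transcript ι)) {δ ν : ℝ} (hδ0 : 0 ≤ δ) (hδ : δ ≤ 1) (hν : 0 ≤ ν)
    (h : ∀ τ r, tr (u τ) = some r → ∀ σ, δ ≤ condProb u (good · r) (u σ) ∧
      ∀ σ', |condProb u (good · r) (u σ) - condProb u (good · r) (u σ')| ≤ ν) :
    |indexRange t 1 k * avg (fun τ => acceptProb good t k τ (tr (u τ)))
      - avg fun τ => ind (Wins (tr (u τ)))| ≤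
      indexRange t 1 k * ν + (1 - δ) ^ indexRange t 1 k := by
  let N := indexRange t 1 k
  let G : Data → Ω → Prop := fun y τ => ∃ r, tr y = some r ∧ good τ r
  let w : Data → ℝ := fun y => match tr y with
    | none => 0
    | some r => ind (r.out ≠ .leaf) * failProb t k (avg fun σ => ind (good σ r))
  have h1 : ∀ τ, acceptProb good t k τ (tr (u τ)) = w (u τ) * ind (G (u τ) τ) := by
    intro τ
    dsimp only [w, G]
    cases tr (u τ) with
    | none => simp [acceptProb]
    | some r => simp [acceptProb]; ring
  simp only [h1]
  -- The transcript is a function of the hash key, so the indicator of a good trapdoor may be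
  -- replaced by its conditional probability given the key.
  rw [← avg_mul_condProb, ← avg_mul_left]
  refine (abs_avg_sub_le (h := fun _ => N * ν + (1 - δ) ^ N) fun τ => ?_).trans_eq (avg_const _)
  have hN : (0 : ℝ) ≤ (1 - δ) ^ N := pow_nonneg (by linarith) _
  have hnn : 0 ≤ N * ν + (1 - δ) ^ N := by positivity
  rcases hr : tr (u τ) with _ | r
  · have hw : w (u τ) = 0 := by simp [w, hr]
    simpa [hw, Wins] using hnn
  by_cases ho : r.out = .leaf
  · have hw : w (u τ) = 0 := by simp [w, hr, ho]
    simpa [hw, Wins, ho] using hnn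
  have hG : G (u τ) = (good · r) := by
    funext σ
    simp [G, hr]
  have hw : w (u τ) = failProb t k (avg fun σ => ind (good σ r)) := by simp [w, hr, ho]
  have hW : Wins (some r) := ⟨r, rfl, ho⟩
  rw [hG, hw]
  simp only [hW, ind_true]
  set p := avg fun σ => ind (good σ r) with hp
  have hpc := avg_condProb u (good · r)
  rw [← hp] at hpc
  have hδp : δ ≤ p := hpc ▸ le_avg_of_le fun σ => (h τ r hr σ).1
  have hp1 : p ≤ 1 := avg_le_of_le fun σ => ind_le_one _
  have hdiff : |condProb u (good · r) (u τ) - p| ≤ ν := by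
    rw [← hpc, ← avg_const (α := Ω) (condProb u (good · r) (u τ))]
    exact (abs_avg_sub_le (h := fun _ => ν) fun σ => (h τ r hr τ).2 σ).trans_eq (avg_const _)
  have hF := failProb_mem (hδ0.trans hδp) hp1 t k
  have hmul := mul_failProb hp1 t k
  set F := failProb t k p
  set c := condProb u (good · r) (u τ)
  -- The two errors: the conditional probability `c` is not exactly `p`, and the geometric sum is
  -- finite.
  have heq : N * (F * c) - 1 = N * (F * (c - p)) - (1 - p) ^ N := by
    have : (N : ℝ) * (p * F) = 1 - (1 - p) ^ N := hmul
    linear_combination this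
  change |N * (F * c) - 1| ≤ _
  rw [heq]
  refine (abs_sub _ _).trans (add_le_add ?_ ?_)
  · rw [abs_mul, abs_mul, Nat.abs_cast, abs_of_nonneg hF.1]
    have := mul_le_mul hF.2 hdiff (abs_nonneg _) zero_le_one
    rw [one_mul] at this
    exact mul_le_mul_of_nonneg_left this (Nat.cast_nonneg _)
  · rw [abs_of_nonneg (pow_nonneg (by linarith) _)]
    exact pow_le_pow_left₀ (by linarith) (by linarith) _

end abort

/-! ### The simulated game compared with the ideal one. -/

section Simulation

variable {k l : ℕ} (Γ : GroupSystem (l + 1))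

/-- The public key of the scheme as data. -/
def publicData (pp hk : Data) (h h' : Γ.G 1) : Data := .list [pp, hk, Γ.enc 1 h, Γ.enc 1 h']

/-- The next message of an adversary that knows the security parameter and the number of levels. -/
def playerView (nx : Data → Data) (k l : ℕ) (pk tape : Data) (ans : List Data) (rest : Data) : Data :=
  nx (.list [.node (unary k) (unary l), pk, tape, .list ans, rest])

/-- The game with hash function `hev hk`, secret exponent `x`, capsule `C` and key `K`. -/
noncomputable def idealRun (nx : Data → Data) (m : ℕ) (pp : Data)
    (hev : Data → (Fin k → Bool) → Γ.G l) (h : Γ.G 1) (x : ZMod Γ.p) (tape : Data) (C : Γ.G 1)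
    (K : Data → Commitment (Fin k → Bool) → Γ.G (l + 1)) (hk : Data) :
    Option (Transcript (Fin k → Bool)) :=
  runGame str (playerView nx k l (publicData Γ pp hk h (Γ.pow h x)) tape)
    (fun X => Γ.enc l (Γ.pow (hev hk X) x))
    (fun s => .node (Γ.enc (l + 1) (K hk s)) (Γ.enc 1 C)) m

/-- The correctness of the programs of a toolkit for a given group system. -/
structure Toolkit.Computes (R : Toolkit) (k : ℕ) {l : ℕ} (Γ : GroupSystem (l + 1)) (pp : Data) :
    Prop where
  mul : ∀ x y : Γ.G (l + 1), R.mul (.list [unary k, pp, unary (l + 1), Γ.enc (l + 1) x,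
    Γ.enc (l + 1) y]) = Γ.enc (l + 1) (x * y)
  pair : ∀ i j m, ∀ h : i + j = m, m ≤ l + 1 → ∀ (x : Γ.G i) (y : Γ.G j),
    R.pair (.list [unary k, pp, unary i, unary j, Γ.enc i x, Γ.enc j y]) = Γ.enc m (Γ.e h x y)
  enc_size : ∀ x : Γ.G l, (Γ.enc l x).size ≤ R.encSize.eval k

variable {Γ} (hl : 1 ≤ l) (R : Toolkit) {pp : Data}

/-- The simulated game for a trapdoor with exponents `a` and group elements `B`. -/
noncomputable def simRun (pk tape : Data) (h' C : Γ.G 1) (S : Γ.G (l + 1))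
    (a : (Fin k → Bool) → ZMod Γ.p) (B : (Fin k → Bool) → Γ.G (l - 1)) :
    Option (Transcript (Fin k → Bool)) :=
  runGame str (playerView R.next k l pk tape)
    (fun X => Γ.enc l (Γ.e (Nat.sub_add_cancel hl) (B X) h'))
    (fun s => .node (Γ.enc (l + 1) (Γ.pow S (a s.first)
      * Γ.e rfl (Γ.e (Nat.sub_add_cancel hl) (B s.first) C) h')) (Γ.enc 1 C)) (R.queries.eval k)

theorem Toolkit.Computes.simGame_eq (hR : R.Computes k Γ pp) {td pk tape : Data} {h' C : Γ.G 1}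
    {S : Γ.G (l + 1)} {a : (Fin k → Bool) → ZMod Γ.p} {B : (Fin k → Bool) → Γ.G (l - 1)}
    (hte : ∀ X, R.teval (.list [unary k, pp, td, str X])
      = .node (nat (a X).val) (Γ.enc (l - 1) (B X))) :
    R.simGame (Toolkit.env (unary k) (unary l) pk tape pp (Γ.enc 1 h') td) (Γ.enc (l + 1) S)
        (Γ.enc 1 C)
      = optData (simRun hl R pk tape h' C S a B) := by
  have hkey : ∀ X, R.simKey (Toolkit.env (unary k) (unary l) pk tape pp (Γ.enc 1 h') td) (str X)
      = Γ.enc l (Γ.e (Nat.sub_add_cancel hl) (B X) h') := by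
    intro X
    simp only [Toolkit.simKey, Toolkit.env, fst_node, snd_node, list_cons, snd_unary, len_unary]
    simp only [← list_cons, hte, snd_node, hR.pair (l - 1) 1 l (Nat.sub_add_cancel hl) (by omega)]
    -- Genuine encodings respect the bound, so clamping changes nothing here.
    exact clamp_of_le (by simpa using hR.enc_size _)
  have hch : ∀ X, R.simChallenge (Toolkit.env (unary k) (unary l) pk tape pp (Γ.enc 1 h') td)
      (Γ.enc (l + 1) S) (Γ.enc 1 C) (str X) = .node (Γ.enc (l + 1) (Γ.pow S (a X)
        * Γ.e rfl (Γ.e (Nat.sub_add_cancel hl) (B X) C) h')) (Γ.enc 1 C) := by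
    intro X
    simp only [Toolkit.simChallenge, Toolkit.env, fst_node, snd_node, list_cons, snd_unary]
    simp only [← list_cons, hte, snd_node, fst_node, ← unary_succ]
    -- The numeral of the exponent represents an element of `Γ.G 0`, and raising `S` to it is the
    -- map `e_{0,l+1}`.
    rw [← Γ.enc_zero _ (ZMod.val_lt (a X)), hR.pair (l - 1) 1 l (Nat.sub_add_cancel hl) (by omega),
      hR.pair l 1 (l + 1) rfl le_rfl]
    have := hR.pair 0 (l + 1) (l + 1) (Nat.zero_add _) le_rfl (Γ.gen 0 ^ (a X).val) S
    rw [show unary 0 = leaf from rfl] at this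
    rw [this, hR.mul, Γ.e_zero_left le_rfl]
    rfl
  rw [R.simGame_eq (k := k) rfl hkey]
  unfold simRun
  simp only [hch]
  rfl

variable {nx : Data → Data}

/-- Where the exponent vanishes, `H(X)^x = e(B_X, h)^x = e(B_X, h^x)`, so the simulated keys are
correct at all revealed identities of a good transcript. On other transcripts the two games may
differ. -/
theorem simRun_eq_some_iff {h : Γ.G 1} {x : ZMod Γ.p} {c : Fin l → Γ.G 1}
    {hev : Data → (Fin k → Bool) → Γ.G l} {hk tape : Data} {C : Γ.G 1} {S : Γ.G (l + 1)}
    {a : (Fin k → Bool) → ZMod Γ.p} {B : (Fin k → Bool) → Γ.G (l - 1)}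
    (hH : ∀ X, hev hk X
      = Γ.pow (Γ.multi l c) (a X) * Γ.e (Nat.sub_add_cancel hl) (B X) h)
    {K : Data → Commitment (Fin k → Bool) → Γ.G (l + 1)}
    (hK : ∀ s, K hk s = Γ.pow S (a s.first)
      * Γ.e rfl (Γ.e (Nat.sub_add_cancel hl) (B s.first) C) (Γ.pow h x))
    {r : Transcript (Fin k → Bool)} (hr : r.Good a) :
    simRun hl R (publicData Γ pp hk h (Γ.pow h x)) tape (Γ.pow h x) C S a B = some r ↔
      idealRun Γ R.next (R.queries.eval k) pp hev h x tape C K hk = some r := by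
  have hO : ∀ X ∈ r.revealed, Γ.enc l (Γ.e (Nat.sub_add_cancel hl) (B X) (Γ.pow h x))
      = Γ.enc l (Γ.pow (hev hk X) x) := by
    intro X hX
    rw [hH, hr.2.2 X hX, Γ.pow_zero, one_mul, Γ.pow_e _ (by omega)]
  constructor
  · exact fun h => runGame_congr str_injective h hO fun s _ => by rw [hK]
  · exact fun h => runGame_congr str_injective h (fun X hX => (hO X hX).symm)
      fun s _ => by rw [hK]

/-- Transcripts for which the trapdoor is not good have acceptance probability zero, so agreement on
the good ones is enough. -/
theorem acceptProb_congr {ι Ω : Type} [Fintype Ω] {good : Ω → Transcript ι → Prop} {t k : ℕ} {τ : Ω}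
    {r₁ r₂ : Option (Transcript ι)} (h : ∀ r, good τ r → (r₁ = some r ↔ r₂ = some r)) :
    acceptProb good t k τ r₁ = acceptProb good t k τ r₂ := by
  have key : ∀ {r₁ r₂ : Option (Transcript ι)}, (∀ r, good τ r → (r₁ = some r ↔ r₂ = some r)) →
      ∀ r, r₁ = some r → good τ r → acceptProb good t k τ r₁ = acceptProb good t k τ r₂ := by
    intro r₁ r₂ h r hr hg
    rw [hr, (h r hg).1 hr]
  have zero : ∀ {r : Option (Transcript ι)}, (∀ r', r = some r' → ¬good τ r') →
      acceptProb good t k τ r = 0 := by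
    intro r h
    rcases r with _ | r
    · rfl
    · simp [acceptProb, h r rfl]
  by_cases h1 : ∃ r, r₁ = some r ∧ good τ r
  · obtain ⟨r, hr, hg⟩ := h1
    exact key h r hr hg
  by_cases h2 : ∃ r, r₂ = some r ∧ good τ r
  · obtain ⟨r, hr, hg⟩ := h2
    exact (key (fun r hr => (h r hr).symm) r hr hg).symm
  push Not at h1 h2
  rw [zero h1, zero h2]

theorem Data.str_eq_bits {n : ℕ} (w : Fin n → Bool) : str w = bits (List.ofFn w) := rfl

theorem Toolkit.program_eq (g S : Data) (X : Fin (l + 2) → Data) (w : List Bool) :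
    R.program (.list [unary k, .list [pp, g, .list (List.ofFn X), S], bits w])
      = R.decideParts (unary k) pp (.list (List.ofFn fun i : Fin l => X i.castSucc.castSucc)) g
        (X (Fin.last l).castSucc) (X (Fin.last (l + 1))) S (bits (w.take (R.coins.eval k)))
        (bits ((w.drop (R.coins.eval k)).take (R.trapCoins.eval k)))
        (bits (((w.drop (R.coins.eval k)).drop (R.trapCoins.eval k)).take k))
        (bits (((w.drop (R.coins.eval k)).drop (R.trapCoins.eval k)).drop k)) := by
  have hr : revAppend (.list (List.ofFn X)) leaf = .list (X (Fin.last (l + 1)) ::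
      X (Fin.last l).castSucc :: (List.ofFn fun i : Fin l => X i.castSucc.castSucc).reverse) := by
    rw [← list_nil, revAppend_list, List.ofFn_succ', List.ofFn_succ']
    simp
  have hc : revAppend (.list (List.ofFn fun i : Fin l => X i.castSucc.castSucc).reverse) leaf
      = .list (List.ofFn fun i : Fin l => X i.castSucc.castSucc) := by
    rw [← list_nil, revAppend_list]
    simp [-list_nil]
  simp only [program, decideInput, list_cons, fst_node, snd_node, hr, hc, take_unary_bits,
    drop_unary_bits, len_unary]

theorem Toolkit.Computes.avg_decideParts (hk0 : 0 < k) (hR : R.Computes k Γ pp)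
    {cs : Fin l → Data} {h h' C : Γ.G 1} {S : Γ.G (l + 1)} (tape : Data)
    (a : Data → (Fin k → Bool) → ZMod Γ.p) (B : Data → (Fin k → Bool) → Γ.G (l - 1))
    (o : (Fin (R.trapCoins.eval k) → Bool) → Data)
    (ho : ∀ τ, o τ = R.trap (.list [unary k, .list [pp, .list (List.ofFn cs), Γ.enc 1 h], str τ]))
    (hte : ∀ τ X, R.teval (.list [unary k, pp, (o τ).snd, str X])
      = .node (nat (a (o τ).snd X).val) (Γ.enc (l - 1) (B (o τ).snd X)))
    (ht : 0 < R.trials.eval k) (τ : Fin (R.trapCoins.eval k) → Bool) :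
    avg (fun wb : Fin k → Bool =>
      avg fun wf : Fin (2 * R.trials.eval k * R.trapCoins.eval k) → Bool =>
        ind (R.decideParts (unary k) pp (.list (List.ofFn cs)) (Γ.enc 1 h) (Γ.enc 1 h') (Γ.enc 1 C)
          (Γ.enc (l + 1) S) tape (str τ) (str wb) (str wf) ≠ leaf))
    = acceptProb (fun τ r => r.Good (a (o τ).snd)) (R.trials.eval k) k τ
        (simRun hl R (publicData Γ pp (o τ).fst h h') tape h' C S (a (o τ).snd) (B (o τ).snd)) := by
  have hgood : ∀ τ (r : Transcript (Fin k → Bool)),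
      R.isGood (unary k) pp (o τ).snd r.toData ≠ leaf ↔ r.Good (a (o τ).snd) := fun τ r =>
    R.isGood_iff hk0 (fun X => by rw [hte]; rfl) r
  unfold Toolkit.decideParts Toolkit.decideWith
  rw [← ho τ, ulen_list, List.length_ofFn]
  have hsim := hR.simGame_eq hl R (tape := tape) (h' := h') (C := C) (S := S)
    (pk := publicData Γ pp (o τ).fst h h') (hte τ)
  unfold publicData at hsim ⊢
  simp only [hsim, Data.str_eq_bits, R.decision_iff]
  rcases simRun hl R _ tape h' C S (a (o τ).snd) (B (o τ).snd) with _ | r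
  · simp [acceptProb, avg_const]
  simp only [Option.some.injEq, exists_eq_left', ind_and, hgood, avg_mul_left, avg_mul_right,
    acceptProb, failProb]
  have hbad : avg (fun w : Fin (R.trapCoins.eval k) → Bool => ind (R.isGood (unary k) pp
      (R.trap (.list [unary k, .list [pp, .list (List.ofFn cs), Γ.enc 1 h],
        bits (List.ofFn w)])).snd r.toData = leaf))
      = 1 - avg fun σ => ind (r.Good (a (o σ).snd)) := by
    rw [← avg_const (α := Fin (R.trapCoins.eval k) → Bool) (1 : ℝ), ← avg_sub]
    congr 1
    funext w
    rw [← ind_not, ← hgood w r, not_not, ho w, Data.str_eq_bits]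
  have hblocks : ∀ wb : Fin k → Bool,
      avg (fun wf : Fin (2 * R.trials.eval k * R.trapCoins.eval k) → Bool =>
        ind (AllBlocks (fun w => R.isGood (unary k) pp (R.trap (.list [unary k, .list [pp,
          .list (List.ofFn cs), Γ.enc 1 h], bits w])).snd r.toData = leaf) (R.trapCoins.eval k)
          (indexNat (R.trials.eval k) 1 0 (List.ofFn wb)) (List.ofFn wf)))
      = (1 - avg fun σ => ind (r.Good (a (o σ).snd)))
          ^ indexNat (R.trials.eval k) 1 0 (List.ofFn wb) := by
    intro wb
    -- The index is less than `indexRange`, which is at most `max 1 (2 * trials)`; hence all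
    -- required blocks fit on the tape.
    rw [avg_allBlocks _ _ _ _ (Nat.mul_le_mul_right _ ?_), hbad]
    have h1 := indexNat_add_le (R.trials.eval k) 1 0 (List.ofFn wb)
    have h2 := indexRange_le (R.trials.eval k) 1 k
    rw [List.length_ofFn] at h1
    omega
  simp only [hblocks]
  ring

/-- The program of the distinguisher accepts with the probability that is given by `acceptProb`. -/
theorem Toolkit.Computes.avg_program (hk0 : 0 < k) (hR : R.Computes k Γ pp) (h : Γ.G 1)
    (x : Fin (l + 2) → ZMod Γ.p) (S : Γ.G (l + 1))
    (a : Data → (Fin k → Bool) → ZMod Γ.p) (B : Data → (Fin k → Bool) → Γ.G (l - 1))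
    (o : (Fin (R.trapCoins.eval k) → Bool) → Data)
    (ho : ∀ τ, o τ = R.trap (.list [unary k, .list [pp, .list (List.ofFn fun i : Fin l =>
      Γ.enc 1 (Γ.pow h (x i.castSucc.castSucc))), Γ.enc 1 h], str τ]))
    (hte : ∀ τ X, R.teval (.list [unary k, pp, (o τ).snd, str X])
      = .node (nat (a (o τ).snd X).val) (Γ.enc (l - 1) (B (o τ).snd X)))
    (ht : 0 < R.trials.eval k) :
    avg (fun w : Fin (R.distinguisher.coins.eval k) → Bool => ind (R.distinguisher.fn
      (.list [unary k, .list [pp, Γ.enc 1 h, .list (List.ofFn fun i => Γ.enc 1 (Γ.pow h (x i))),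
        Γ.enc (l + 1) S], str w]) ≠ leaf))
    = avg fun ω : Fin (R.coins.eval k) → Bool => avg fun τ =>
        acceptProb (fun τ r => r.Good (a (o τ).snd)) (R.trials.eval k) k τ
          (simRun hl R (publicData Γ pp (o τ).fst h (Γ.pow h (x (Fin.last l).castSucc))) (str ω)
            (Γ.pow h (x (Fin.last l).castSucc)) (Γ.pow h (x (Fin.last (l + 1)))) S
            (a (o τ).snd) (B (o τ).snd)) := by
  have hcoins : R.distinguisher.coins.eval k = R.coins.eval k + (R.trapCoins.eval k
      + (k + 2 * R.trials.eval k * R.trapCoins.eval k)) := by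
    simp [distinguisher]
  rw [hcoins]
  simp only [distinguisher, Data.str_eq_bits, R.program_eq (X := fun i => Γ.enc 1 (Γ.pow h (x i)))]
  rw [avg_bits_add (R.coins.eval k) _ fun w => ind (R.decideParts (unary k) pp
    (.list (List.ofFn fun i : Fin l => Γ.enc 1 (Γ.pow h (x i.castSucc.castSucc)))) (Γ.enc 1 h)
    (Γ.enc 1 (Γ.pow h (x (Fin.last l).castSucc))) (Γ.enc 1 (Γ.pow h (x (Fin.last (l + 1)))))
    (Γ.enc (l + 1) S) (bits (w.take (R.coins.eval k)))
    (bits ((w.drop (R.coins.eval k)).take (R.trapCoins.eval k)))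
    (bits (((w.drop (R.coins.eval k)).drop (R.trapCoins.eval k)).take k))
    (bits (((w.drop (R.coins.eval k)).drop (R.trapCoins.eval k)).drop k)) ≠ leaf)]
  congr 1
  funext ω
  have htake : ∀ (m : ℕ) (u : Fin m → Bool) (v : List Bool),
      (List.ofFn u ++ v).take m = List.ofFn u := fun m u v => by
    rw [List.take_append_of_le_length (by simp), List.take_of_length_le (by simp)]
  have hdrop : ∀ (m : ℕ) (u : Fin m → Bool) (v : List Bool),
      (List.ofFn u ++ v).drop m = v := fun m u v => by
    rw [List.drop_append_of_le_length (by simp), List.drop_of_length_le (by simp), List.nil_append]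
  simp only [htake, hdrop]
  rw [avg_bits_add (R.trapCoins.eval k) _ fun w => ind (R.decideParts (unary k) pp
    (.list (List.ofFn fun i : Fin l => Γ.enc 1 (Γ.pow h (x i.castSucc.castSucc)))) (Γ.enc 1 h)
    (Γ.enc 1 (Γ.pow h (x (Fin.last l).castSucc))) (Γ.enc 1 (Γ.pow h (x (Fin.last (l + 1)))))
    (Γ.enc (l + 1) S) (bits (List.ofFn ω)) (bits (w.take (R.trapCoins.eval k)))
    (bits ((w.drop (R.trapCoins.eval k)).take k))
    (bits ((w.drop (R.trapCoins.eval k)).drop k)) ≠ leaf)]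
  congr 1
  funext τ
  simp only [htake, hdrop]
  rw [avg_bits_add k _ fun w => ind (R.decideParts (unary k) pp
    (.list (List.ofFn fun i : Fin l => Γ.enc 1 (Γ.pow h (x i.castSucc.castSucc)))) (Γ.enc 1 h)
    (Γ.enc 1 (Γ.pow h (x (Fin.last l).castSucc))) (Γ.enc 1 (Γ.pow h (x (Fin.last (l + 1)))))
    (Γ.enc (l + 1) S) (bits (List.ofFn ω)) (bits (List.ofFn τ))
    (bits (w.take k)) (bits (w.drop k)) ≠ leaf)]
  simp only [htake, hdrop]
  exact hR.avg_decideParts hl R hk0 (bits (List.ofFn ω)) a B o ho hte ht τ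

end Simulation

/-! ### The acceptance probability on real and on random challenges. -/

section Core

variable {k l : ℕ} {Γ : GroupSystem (l + 1)} (hl : 1 ≤ l) (R : Toolkit) {pp : Data}
  {Ω Ω' : Type} [Fintype Ω] [Fintype Ω']

/-- With everything else fixed, winning is an event about the hash key alone. After the artificial
abort, the statistical distance therefore allows passing from trapdoor keys to genuine ones. -/
theorem abs_acceptProb_idealRun_sub_le [Nonempty Ω] {o : Ω → Data} {hg : Ω' → Data}
    {good : Ω → Transcript (Fin k → Bool) → Prop} {δ ν ν' : ℝ} {t : ℕ}
    (hδ0 : 0 ≤ δ) (hδ : δ ≤ 1) (hν : 0 ≤ ν')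
    (hprob : ∀ r : Transcript (Fin k → Bool), r.first ∉ r.revealed →
      r.revealed.length ≤ 2 * R.queries.eval k → ∀ σ,
      δ ≤ condProb (fun τ => (o τ).fst) (good · r) (o σ).fst ∧
      ∀ σ', |condProb (fun τ => (o τ).fst) (good · r) (o σ).fst
        - condProb (fun τ => (o τ).fst) (good · r) (o σ').fst| ≤ ν')
    (hstat : ∀ S : Set Data, |avg (fun τ => ind ((o τ).fst ∈ S)) - avg fun w => ind (hg w ∈ S)| ≤ ν)
    (hev : Data → (Fin k → Bool) → Γ.G l) (h : Γ.G 1) (x : ZMod Γ.p) (tape : Data) (C : Γ.G 1)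
    (K : Data → Commitment (Fin k → Bool) → Γ.G (l + 1)) :
    |indexRange t 1 k * avg (fun τ => acceptProb good t k τ
        (idealRun Γ R.next (R.queries.eval k) pp hev h x tape C K (o τ).fst))
      - avg fun w => ind (Wins (idealRun Γ R.next (R.queries.eval k) pp hev h x tape C K (hg w)))|
      ≤ indexRange t 1 k * ν' + (1 - δ) ^ indexRange t 1 k + ν := by
  have h1 := abs_acceptProb_sub_le (fun τ => (o τ).fst) good t k
    (idealRun Γ R.next (R.queries.eval k) pp hev h x tape C K) hδ0 hδ hν
    fun τ r hr => hprob r (runGame_revealed str_injective hr).1 (runGame_revealed str_injective hr).2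
  have h2 := hstat {y | Wins (idealRun Γ R.next (R.queries.eval k) pp hev h x tape C K y)}
  simp only [Set.mem_ofPred_eq] at h2
  exact (abs_sub_le _ _ _).trans (add_le_add h1 h2)

/-- With a uniform value `S` in place of the product in the exponent, the simulated key is uniform if
the trapdoor is good for the transcript. -/
theorem avg_acceptProb_idealRun {o : Ω → Data} {a : Data → (Fin k → Bool) → ZMod Γ.p}
    {t : ℕ} (τ : Ω) (hev : Data → (Fin k → Bool) → Γ.G l) (h : Γ.G 1) (x : ZMod Γ.p) (tape : Data)
    (C : Γ.G 1) (D : (Fin k → Bool) → Γ.G (l + 1)) (nx : Data → Data) (m : ℕ) (hk : Data) :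
    avg (fun S : Γ.G (l + 1) => acceptProb (fun τ r => r.Good (a (o τ).snd)) t k τ
      (idealRun Γ nx m pp hev h x tape C
        (fun _ s => Γ.pow S (a (o τ).snd s.first) * D s.first) hk))
    = avg fun K : Γ.G (l + 1) => acceptProb (fun τ r => r.Good (a (o τ).snd)) t k τ
      (idealRun Γ nx m pp hev h x tape C (fun _ _ => K) hk) := by
  unfold idealRun runGame
  -- The challenge identities are submitted before `S` enters, so the exponent at the first one is
  -- fixed while `S` varies.
  rcases commitPhase str (playerView nx k l (publicData Γ pp hk h (Γ.pow h x)) tape)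
    (fun X => Γ.enc l (Γ.pow (hev hk X) x)) m with _ | s
  · simp [acceptProb]
  simp only [Option.map_some]
  by_cases ha : a (o τ).snd s.first = 0
  · have : ∀ ch, ¬(finish str (playerView nx k l (publicData Γ pp hk h (Γ.pow h x)) tape)
        (fun X => Γ.enc l (Γ.pow (hev hk X) x)) m s ch).Good (a (o τ).snd) := fun ch hg => hg.1 ha
    simp only [acceptProb, this, ind_false, zero_mul]
  · exact avg_bijective (e := fun S : Γ.G (l + 1) => Γ.pow S (a (o τ).snd s.first) * D s.first)
      ((Group.mulRight_bijective _).comp (Γ.pow_left_bijective le_rfl ha))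
      (fun K => acceptProb (fun τ r => r.Good (a (o τ).snd)) t k τ (some (finish str
        (playerView nx k l (publicData Γ pp hk h (Γ.pow h x)) tape)
        (fun X => Γ.enc l (Γ.pow (hev hk X) x)) m s
        (.node (Γ.enc (l + 1) K) (Γ.enc 1 C)))))

theorem abs_mul_avg_avg_sub_le {α β : Type} [Fintype α] [Nonempty α] [Fintype β] {c ε : ℝ}
    {f : α → ℝ} {g : α → β → ℝ} (h : ∀ a, |c * f a - avg (g a)| ≤ ε) :
    |c * avg f - avg fun a => avg (g a)| ≤ ε := by
  rw [← avg_mul_left]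
  exact (abs_avg_sub_le (h := fun _ => ε) h).trans_eq (avg_const _)

/-- What is needed of a trapdoor key generation with output `o` for the security proof, for a given
group system and given group elements `h^{x_1}, …, h^{x_l}` and `h`. -/
structure Toolkit.Programs (R : Toolkit) (k : ℕ) {l : ℕ} (hl : 1 ≤ l) (Γ : GroupSystem (l + 1))
    (pp : Data) {Ω' : Type} [Fintype Ω'] (hg : Ω' → Data) (hev : Data → (Fin k → Bool) → Γ.G l)
    (h : Γ.G 1) (c : Fin l → Γ.G 1) (a : Data → (Fin k → Bool) → ZMod Γ.p)
    (B : Data → (Fin k → Bool) → Γ.G (l - 1)) (o : (Fin (R.trapCoins.eval k) → Bool) → Data)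
    (δ ν ν' : ℝ) : Prop where
  trap : ∀ τ, o τ = R.trap (.list [unary k, .list [pp, .list (List.ofFn fun i : Fin l =>
    Γ.enc 1 (c i)), Γ.enc 1 h], str τ])
  teval : ∀ τ X, R.teval (.list [unary k, pp, (o τ).snd, str X])
    = .node (nat (a (o τ).snd X).val) (Γ.enc (l - 1) (B (o τ).snd X))
  hash : ∀ τ X, hev (o τ).fst X
    = Γ.pow (Γ.multi l c) (a (o τ).snd X) * Γ.e (Nat.sub_add_cancel hl) (B (o τ).snd X) h
  prob : ∀ r : Transcript (Fin k → Bool), r.first ∉ r.revealed →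
    r.revealed.length ≤ 2 * R.queries.eval k → ∀ σ,
    δ ≤ condProb (fun τ => (o τ).fst) (fun τ => r.Good (a (o τ).snd)) (o σ).fst ∧
    ∀ σ', |condProb (fun τ => (o τ).fst) (fun τ => r.Good (a (o τ).snd)) (o σ).fst
      - condProb (fun τ => (o τ).fst) (fun τ => r.Good (a (o τ).snd)) (o σ').fst| ≤ ν'
  stat : ∀ S : Set Data, |avg (fun τ => ind ((o τ).fst ∈ S)) - avg fun w => ind (hg w ∈ S)| ≤ ν

/-- The acceptance probability of the distinguisher on a challenge. -/
noncomputable def Toolkit.accept (R : Toolkit) (k : ℕ) {l : ℕ} (Γ : GroupSystem (l + 1)) (pp : Data)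
    (h : Γ.G 1) (x : Fin (l + 2) → ZMod Γ.p) (S : Γ.G (l + 1)) : ℝ :=
  avg fun w : Fin (R.distinguisher.coins.eval k) → Bool => ind (R.distinguisher.fn
    (.list [unary k, .list [pp, Γ.enc 1 h, .list (List.ofFn fun i => Γ.enc 1 (Γ.pow h (x i))),
      Γ.enc (l + 1) S], str w]) ≠ leaf)

variable {R hl}

/-- By `challenge_eq` the simulated challenge is the genuine one for every trapdoor, so only the key
oracle needs a good transcript. -/
theorem Toolkit.Programs.abs_accept_real_sub_le {hg : Ω' → Data}
    {hev : Data → (Fin k → Bool) → Γ.G l} {h : Γ.G 1} {x : Fin (l + 2) → ZMod Γ.p}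
    {a : Data → (Fin k → Bool) → ZMod Γ.p} {B : Data → (Fin k → Bool) → Γ.G (l - 1)}
    {o : (Fin (R.trapCoins.eval k) → Bool) → Data} {δ ν ν' : ℝ}
    (hP : R.Programs k hl Γ pp hg hev h (fun i => Γ.pow h (x i.castSucc.castSucc)) a B o δ ν ν')
    (hk0 : 0 < k) (hR : R.Computes k Γ pp) (ht : 0 < R.trials.eval k)
    (hδ0 : 0 ≤ δ) (hδ : δ ≤ 1) (hν : 0 ≤ ν') :
    |indexRange (R.trials.eval k) 1 k * R.accept k Γ pp h x
        (Γ.pow (Γ.multi (l + 1) fun i => Γ.pow h (x i.castSucc)) (x (Fin.last (l + 1))))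
      - avg fun ω : Fin (R.coins.eval k) → Bool => avg fun w => ind (Wins (idealRun Γ R.next
        (R.queries.eval k) pp hev h (x (Fin.last l).castSucc) (str ω)
        (Γ.pow h (x (Fin.last (l + 1)))) (fun hk s => Γ.pow (Γ.e rfl (hev hk s.first)
          (Γ.pow h (x (Fin.last l).castSucc))) (x (Fin.last (l + 1)))) (hg w)))|
      ≤ indexRange (R.trials.eval k) 1 k * ν' + (1 - δ) ^ indexRange (R.trials.eval k) 1 k + ν := by
  rw [accept, hR.avg_program hl R hk0 h x _ a B o hP.trap hP.teval ht]
  refine abs_mul_avg_avg_sub_le fun ω => ?_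
  refine le_trans (le_of_eq ?_) (abs_acceptProb_idealRun_sub_le (pp := pp) R hδ0 hδ hν hP.prob
    hP.stat hev h (x (Fin.last l).castSucc) (str ω) (Γ.pow h (x (Fin.last (l + 1))))
    fun hk s => Γ.pow (Γ.e rfl (hev hk s.first) (Γ.pow h (x (Fin.last l).castSucc)))
      (x (Fin.last (l + 1))))
  congr 4
  funext τ
  refine acceptProb_congr fun r hr => simRun_eq_some_iff hl R (hP.hash τ) (fun s => ?_) hr
  rw [hP.hash, Γ.challenge_eq hl le_rfl h fun i => x i.castSucc]

theorem Toolkit.Programs.abs_accept_random_sub_le {hg : Ω' → Data}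
    {hev : Data → (Fin k → Bool) → Γ.G l} {h : Γ.G 1} {x : Fin (l + 2) → ZMod Γ.p}
    {a : Data → (Fin k → Bool) → ZMod Γ.p} {B : Data → (Fin k → Bool) → Γ.G (l - 1)}
    {o : (Fin (R.trapCoins.eval k) → Bool) → Data} {δ ν ν' : ℝ}
    (hP : R.Programs k hl Γ pp hg hev h (fun i => Γ.pow h (x i.castSucc.castSucc)) a B o δ ν ν')
    (hk0 : 0 < k) (hR : R.Computes k Γ pp) (ht : 0 < R.trials.eval k)
    (hδ0 : 0 ≤ δ) (hδ : δ ≤ 1) (hν : 0 ≤ ν') :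
    |indexRange (R.trials.eval k) 1 k * avg (fun S => R.accept k Γ pp h x S)
      - avg fun K => avg fun ω : Fin (R.coins.eval k) → Bool => avg fun w => ind (Wins (idealRun Γ
        R.next (R.queries.eval k) pp hev h (x (Fin.last l).castSucc) (str ω)
        (Γ.pow h (x (Fin.last (l + 1)))) (fun _ _ => K) (hg w)))|
      ≤ indexRange (R.trials.eval k) 1 k * ν' + (1 - δ) ^ indexRange (R.trials.eval k) 1 k + ν := by
  have h1 : avg (fun S => R.accept k Γ pp h x S) = avg fun K : Γ.G (l + 1) =>
      avg fun ω : Fin (R.coins.eval k) → Bool => avg fun τ =>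
        acceptProb (fun τ r => r.Good (a (o τ).snd)) (R.trials.eval k) k τ
          (idealRun Γ R.next (R.queries.eval k) pp hev h (x (Fin.last l).castSucc) (str ω)
            (Γ.pow h (x (Fin.last (l + 1)))) (fun _ _ => K) (o τ).fst) := by
    simp only [accept, hR.avg_program hl R hk0 h x _ a B o hP.trap hP.teval ht]
    -- The mean over `S` is moved inside those over the tape and the trapdoor, because the bijection
    -- between `S` and the key depends on the trapdoor.
    rw [avg_comm, avg_comm fun K : Γ.G (l + 1) => _]
    congr 1
    funext ω
    rw [avg_comm, avg_comm fun K : Γ.G (l + 1) => _]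
    congr 1
    funext τ
    refine Eq.trans ?_ (avg_acceptProb_idealRun τ hev h (x (Fin.last l).castSucc) (str ω)
      (Γ.pow h (x (Fin.last (l + 1)))) (fun X => Γ.e rfl (Γ.e (Nat.sub_add_cancel hl)
        (B (o τ).snd X) (Γ.pow h (x (Fin.last (l + 1))))) (Γ.pow h (x (Fin.last l).castSucc)))
      R.next (R.queries.eval k) (o τ).fst)
    congr 1
    funext S
    exact acceptProb_congr fun r hr => simRun_eq_some_iff hl R (hP.hash τ) (fun s => rfl) hr
  rw [h1, ← avg_mul_left]
  refine (abs_avg_sub_le (h := fun _ => _) fun K => ?_).trans_eq (avg_const _)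
  refine abs_mul_avg_avg_sub_le fun ω => ?_
  exact abs_acceptProb_idealRun_sub_le R hδ0 hδ hν hP.prob hP.stat hev h _ _ _ _

end Core

/-! ### Uniform vectors, and units versus residues. -/

section avgLemmas

theorem avg_snoc {α : Type} [Fintype α] {n : ℕ} (F : (Fin n → α) → α → ℝ) :
    avg (fun f : Fin (n + 1) → α => F (fun i => f i.castSucc) (f (Fin.last n)))
      = avg fun a => avg fun f => F f a := by
  rw [← avg_prod fun x : α × (Fin n → α) => F x.2 x.1,
    ← avg_bijective (Fin.snocEquiv fun _ : Fin (n + 1) => α).bijective]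
  simp [Fin.snocEquiv]

theorem avg_last_two {α : Type} [Fintype α] [Nonempty α] {n : ℕ} (F : α → α → ℝ) :
    avg (fun f : Fin (n + 2) → α => F (f (Fin.last n).castSucc) (f (Fin.last (n + 1))))
      = avg fun x => avg fun r => F x r := by
  rw [avg_snoc fun (f : Fin (n + 1) → α) a => F (f (Fin.last n)) a]
  simp only [fun a => avg_snoc fun (_ : Fin n → α) b => F b a, avg_const]
  exact avg_comm _

/-- Passing from a uniform residue modulo `p` to a uniform unit changes expectations little. -/
theorem abs_avg_units_sub_le {p : ℕ} [Fact p.Prime] {F : ZMod p → ℝ} (h0 : ∀ x, 0 ≤ F x)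
    (h1 : ∀ x, F x ≤ 1) : |avg (fun u : (ZMod p)ˣ => F u) - avg F| ≤ 1 / p := by
  have hp : 1 < p := (Fact.out : p.Prime).one_lt
  have hsum : ∑ x, F x = F 0 + ∑ u : (ZMod p)ˣ, F u := by
    rw [← Finset.add_sum_erase _ _ (Finset.mem_univ 0)]
    congr 1
    refine (Finset.sum_bij (fun (u : (ZMod p)ˣ) _ => (u : ZMod p)) (fun u _ => by simp)
      (fun u _ v _ h => Units.ext h) (fun x hx => ?_) (fun _ _ => rfl)).symm
    exact ⟨Units.mk0 x (by simpa using hx), Finset.mem_univ _, rfl⟩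
  have hcard : (Fintype.card (ZMod p)ˣ : ℝ) = p - 1 := by
    rw [ZMod.card_units, Nat.cast_sub hp.le, Nat.cast_one]
  have hU0 : 0 ≤ ∑ u : (ZMod p)ˣ, F u := Finset.sum_nonneg fun u _ => h0 u
  have hU1 : ∑ u : (ZMod p)ˣ, F u ≤ p - 1 := by
    rw [← hcard]
    simpa using Finset.sum_le_card_nsmul Finset.univ (fun u : (ZMod p)ˣ => F u) 1 fun u _ => h1 u
  have hp' : (1 : ℝ) < p := by exact_mod_cast hp
  unfold avg
  -- The difference of the two means is exactly (mean over the units minus `F 0`) divided by `p`.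
  rw [hsum, hcard, ZMod.card, show (∑ u : (ZMod p)ˣ, F u) / ((p : ℝ) - 1)
    - (F 0 + ∑ u : (ZMod p)ˣ, F u) / p = ((∑ u : (ZMod p)ˣ, F u) / ((p : ℝ) - 1) - F 0) / p by
      have : (p : ℝ) - 1 ≠ 0 := by linarith
      field_simp
      ring, abs_div, abs_of_pos (by linarith : (0 : ℝ) < p)]
  refine div_le_div_of_nonneg_right ?_ (by linarith)
  have h2 : (∑ u : (ZMod p)ˣ, F u) / ((p : ℝ) - 1) ≤ 1 := (div_le_one (by linarith)).2 hU1
  have h3 : 0 ≤ (∑ u : (ZMod p)ˣ, F u) / ((p : ℝ) - 1) := div_nonneg hU0 (by linarith)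
  rw [abs_le]
  constructor <;> linarith [h0 0, h1 0]

end avgLemmas

/-! ### Negligible functions. -/

section negligible

theorem Negligible.of_abs_le {f g : ℕ → ℝ} (hf : Negligible f) (h : ∀ᶠ k in atTop, |g k| ≤ |f k|) :
    Negligible g :=
  SuperpolynomialDecay.trans_eventually_abs_le hf h

theorem Negligible.abs {f : ℕ → ℝ} (hf : Negligible f) : Negligible fun k => |f k| :=
  hf.of_abs_le (Eventually.of_forall fun _ => (abs_abs _).le)

theorem Negligible.add {f g : ℕ → ℝ} (hf : Negligible f) (hg : Negligible g) :
    Negligible fun k => f k + g k :=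
  SuperpolynomialDecay.add hf hg

theorem Negligible.poly_mul {f : ℕ → ℝ} (hf : Negligible f) (P : Polynomial ℕ) :
    Negligible fun k => ((P.eval k : ℕ) : ℝ) * f k := by
  have h := SuperpolynomialDecay.polynomial_mul hf (P.map (Nat.castRingHom ℝ))
  refine h.congr fun k => ?_
  simp [Polynomial.eval_natCast_map]

theorem negligible_exp_neg : Negligible fun k => Real.exp (-k) := by
  intro n
  have := (Real.tendsto_pow_mul_exp_neg_atTop_nhds_zero n).comp tendsto_natCast_atTop_atTop
  exact this

theorem eventually_eval_lt_two_pow (P : Polynomial ℕ) : ∀ᶠ k in atTop, P.eval k < 2 ^ k := by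
  have h1 : Negligible fun k => 1 / 2 ^ k := fun n => by
    simpa [div_eq_mul_inv] using tendsto_pow_const_div_const_pow_of_one_lt n (one_lt_two (α := ℝ))
  have h2 := (h1.poly_mul P) 0
  simp only [pow_zero, one_mul] at h2
  filter_upwards [h2.eventually_lt_const one_pos] with k hk
  rw [mul_one_div, div_lt_one (by positivity)] at hk
  exact_mod_cast hk

end negligible

/-! ### MDDH probabilities as mean values, and the size of the group order. -/

theorem prob_run_bind {β : Type*} (A : PPT) (k : ℕ) (x : Data) (f : Data → PMF β) (S : Set β) :
    prob ((A.run k x).bind f) S = avg fun w : Fin (A.coins.eval k) → Bool =>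
      prob (f (A.fn (.list [unary k, x, str w]))) S := by
  rw [PPT.run, PMF.bind_map, prob_uniform_bind]
  rfl

theorem prob_run (A : PPT) (k : ℕ) (x : Data) (S : Set Data) :
    prob (A.run k x) S = avg fun w : Fin (A.coins.eval k) → Bool =>
      ind (A.fn (.list [unary k, x, str w]) ∈ S) := by
  rw [PPT.run, prob_uniform_map]

theorem PPT.fn_mem_support (A : PPT) (k : ℕ) (x : Data) (w : Fin (A.coins.eval k) → Bool) :
    A.fn (.list [unary k, x, str w]) ∈ (A.run k x).support :=
  mem_support_uniform_map (fun w => A.fn (.list [unary k, x, str w])) w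

namespace GroupGen

variable {n : ℕ → ℕ} (M : GroupGen n)

/-- The expectation of a function of the description of the group system. -/
noncomputable def avgParams (k : ℕ) (F : Data → ℝ) : ℝ :=
  avg fun w : Fin (M.gen.coins.eval k) → Bool => F (M.gen.fn (.list [unary k, leaf, str w]))

theorem prob_params_bind {β : Type*} (k : ℕ) (f : Data → PMF β) (S : Set β) :
    prob ((M.params k).bind f) S = M.avgParams k fun pp => prob (f pp) S :=
  prob_run_bind _ _ _ _ _

variable {M} {k : ℕ}

theorem avgParams_mono {F G : Data → ℝ} (h : ∀ pp ∈ (M.params k).support, F pp ≤ G pp) :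
    M.avgParams k F ≤ M.avgParams k G :=
  avg_mono fun w => h _ (PPT.fn_mem_support _ _ _ w)

theorem avgParams_nonneg {F : Data → ℝ} (h : ∀ pp, 0 ≤ F pp) : 0 ≤ M.avgParams k F :=
  avg_nonneg fun _ => h _

theorem avgParams_add (F G : Data → ℝ) :
    M.avgParams k (fun pp => F pp + G pp) = M.avgParams k F + M.avgParams k G :=
  avg_add _ _

theorem avgParams_sub (F G : Data → ℝ) :
    M.avgParams k (fun pp => F pp - G pp) = M.avgParams k F - M.avgParams k G :=
  avg_sub _ _

theorem avgParams_mul_left (c : ℝ) (F : Data → ℝ) :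
    M.avgParams k (fun pp => c * F pp) = c * M.avgParams k F :=
  avg_mul_left _ _

theorem avgParams_const (c : ℝ) : M.avgParams k (fun _ => c) = c :=
  avg_const _

theorem abs_avgParams_sub_le {F G E : Data → ℝ}
    (h : ∀ pp ∈ (M.params k).support, |F pp - G pp| ≤ E pp) :
    |M.avgParams k F - M.avgParams k G| ≤ M.avgParams k E :=
  abs_avg_sub_le fun w => h _ (PPT.fn_mem_support _ _ _ w)

/-- The acceptance probability of a distinguisher on a challenge. -/
noncomputable def acceptance (M : GroupGen n) (D : PPT) (k : ℕ) (pp : Data) (g : (M.sys k pp).G 1)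
    (x : Fin (n k + 1) → ZMod (M.sys k pp).p) (S : (M.sys k pp).G (n k)) : ℝ :=
  avg fun w : Fin (D.coins.eval k) → Bool => ind (D.fn (.list [unary k, .list [pp,
    (M.sys k pp).enc 1 g, .list (List.ofFn fun i => (M.sys k pp).enc 1 ((M.sys k pp).pow g (x i))),
    (M.sys k pp).enc (n k) S], str w]) ≠ leaf)

theorem prob_mddhChallenge_true (D : PPT) :
    prob ((M.mddhChallenge true k).bind (D.run k)) {b | b ≠ .leaf} = M.avgParams k fun pp =>
      avg fun g => avg fun x => M.acceptance D k pp g x ((M.sys k pp).pow ((M.sys k pp).multi (n k)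
        fun i => (M.sys k pp).pow g (x i.castSucc)) (x (Fin.last (n k)))) := by
  rw [mddhChallenge, PMF.bind_bind, prob_params_bind]
  congr 1
  funext pp
  rw [PMF.bind_bind, prob_uniform_bind]
  congr 1
  funext g
  rw [PMF.bind_bind, prob_uniform_bind]
  congr 1
  funext x
  rw [PMF.bind_map, prob_uniform_bind]
  simp only [Function.comp_apply, if_true, prob_run, avg_const]
  rfl

theorem prob_mddhChallenge_false (D : PPT) :
    prob ((M.mddhChallenge false k).bind (D.run k)) {b | b ≠ .leaf} = M.avgParams k fun pp =>
      avg fun g => avg fun x => avg fun S => M.acceptance D k pp g x S := by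
  rw [mddhChallenge, PMF.bind_bind, prob_params_bind]
  congr 1
  funext pp
  rw [PMF.bind_bind, prob_uniform_bind]
  congr 1
  funext g
  rw [PMF.bind_bind, prob_uniform_bind]
  congr 1
  funext x
  rw [PMF.bind_map, prob_uniform_bind]
  simp only [Function.comp_apply, Bool.false_eq_true, if_false, prob_run]
  rfl

theorem acceptance_nonneg (D : PPT) (pp : Data) (g : (M.sys k pp).G 1)
    (x : Fin (n k + 1) → ZMod (M.sys k pp).p) (S : (M.sys k pp).G (n k)) :
    0 ≤ M.acceptance D k pp g x S :=
  avg_nonneg fun _ => ind_nonneg _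

theorem acceptance_le_one (D : PPT) (pp : Data) (g : (M.sys k pp).G 1)
    (x : Fin (n k + 1) → ZMod (M.sys k pp).p) (S : (M.sys k pp).G (n k)) :
    M.acceptance D k pp g x S ≤ 1 :=
  avg_le_of_le fun _ => ind_le_one _

/-- Under the MDDH assumption the inverse of the group order is negligible: otherwise the test
whether `S` is trivial would distinguish real from random challenges. -/
theorem MDDH.negligible_inv_order (hM : M.MDDH) (hn : ∀ k, 1 ≤ n k) :
    Negligible fun k => M.avgParams k fun pp => 1 / ((M.sys k pp).p : ℝ) := by
  obtain ⟨f, hf, hmul⟩ := M.mul_eff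
  let D : PPT :=
    -- No encoding of the unit is given, so triviality of `S` is tested by `S * S = S`. The level is
    -- one less than the number of powers in the challenge.
    { fn := fun v => eqb (f (.list [v.fst, v.snd.fst.fst, (ulen v.snd.fst.snd.snd.fst).snd,
        v.snd.fst.snd.snd.snd.fst, v.snd.fst.snd.snd.snd.fst])) v.snd.fst.snd.snd.snd.fst
      polyTime := by
        have : ∀ {g : Data → Data}, PolyTime g → PolyTime fun v => f (g v) := fun hg => hf.comp hg
        exact .eqb (this (by fun_prop)) (by fun_prop)
      coins := 0 }
  have hD : ∀ k, ∀ pp ∈ (M.params k).support, ∀ g x S,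
      M.acceptance D k pp g x S = ind (S = 1) := by
    intro k pp hpp g x S
    have : ∀ w : Data, D.fn (.list [unary k, .list [pp, (M.sys k pp).enc 1 g, .list (List.ofFn
        fun i => (M.sys k pp).enc 1 ((M.sys k pp).pow g (x i))), (M.sys k pp).enc (n k) S], w])
        ≠ leaf ↔ S = 1 := by
      intro w
      simp only [D, list_cons, fst_node, snd_node, ulen_list, List.length_ofFn, snd_unary,
        Nat.add_sub_cancel, ne_eq, eqb_eq_leaf, not_not]
      rw [← list_cons, ← list_cons, ← list_cons, ← list_cons, ← list_cons, hmul k pp hpp _ le_rfl,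
        ((M.sys k pp).enc_injective _ le_rfl).eq_iff]
      exact mul_eq_left
    simp only [acceptance, this, avg_const]
  refine ((hM D).poly_mul 2).of_abs_le (Eventually.of_forall fun k => ?_)
  rw [prob_mddhChallenge_true, prob_mddhChallenge_false, ← avgParams_sub]
  rw [abs_of_nonneg (avgParams_nonneg fun pp => by positivity)]
  refine le_trans ?_ (le_abs_self _)
  simp only [Polynomial.eval_ofNat, Nat.cast_ofNat]
  rw [← avgParams_mul_left]
  refine avgParams_mono fun pp hpp => ?_
  set Γ := M.sys k pp
  have hp : (2 : ℝ) ≤ Γ.p := by exact_mod_cast Γ.prime.two_le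
  have hone : Γ.multi (n k) (fun _ => 1) = 1 := by
    have := Γ.multi_gen_pow (hn k) le_rfl fun _ => 0
    have h0 : n k ≠ 0 := Nat.one_le_iff_ne_zero.1 (hn k)
    simpa [h0, Finset.prod_const, zero_pow_eq] using this
  have h1 : ∀ (g : Γ.G 1) (x : Fin (n k + 1) → ZMod Γ.p),
      1 - (1 - ind (g = 1)) * (1 - ind (x (Fin.last (n k)) = 0)) ≤ ind (Γ.pow (Γ.multi (n k)
        fun i => Γ.pow g (x i.castSucc)) (x (Fin.last (n k))) = 1) := by
    intro g x
    by_cases hg : g = 1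
    · subst hg
      simp [GroupSystem.pow, hone, ind]
    · by_cases hx : x (Fin.last (n k)) = 0
      · simp [hx, Γ.pow_zero, ind]
      · simp [hg, hx, ind]
        split_ifs <;> norm_num
  -- A real `S` is trivial if `g = 1` or the last exponent is zero, which has probability `1 - (1 -
  -- 1/p)^2 ≥ 3/(2p)`. A uniform `S` is trivial with probability `1/p`, so twice the advantage is at
  -- least `1/p`.
  have h2 : avg (fun g : Γ.G 1 => avg fun x : Fin (n k + 1) → ZMod Γ.p =>
      1 - (1 - ind (g = 1)) * (1 - ind (x (Fin.last (n k)) = 0)))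
      = 1 - (1 - 1 / (Γ.p : ℝ)) * (1 - 1 / (Γ.p : ℝ)) := by
    simp only [fun g : Γ.G 1 => avg_snoc fun (_ : Fin (n k) → ZMod Γ.p) a =>
      1 - (1 - ind (g = 1)) * (1 - ind (a = 0)), avg_const, avg_sub, avg_mul_left, avg_mul_right,
      avg_ind_eq, ZMod.card, Γ.card_eq 1 (hn k)]
  have h3 := avg_mono fun g : Γ.G 1 => avg_mono fun x => h1 g x
  simp only [hD k pp hpp, avg_const, avg_ind_eq]
  have h6 : Fintype.card ((M.sys k pp).G (n k)) = Γ.p := Γ.card_eq _ le_rfl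
  rw [h2] at h3
  rw [h6]
  change 1 / (Γ.p : ℝ) ≤ 2 * (avg (fun g : Γ.G 1 => avg fun x : Fin (n k + 1) → ZMod Γ.p =>
    ind (Γ.pow (Γ.multi (n k) fun i => Γ.pow g (x i.castSucc)) (x (Fin.last (n k))) = 1))
    - 1 / (Γ.p : ℝ))
  have h4 : 1 / (Γ.p : ℝ) ≤ 1 / 2 := one_div_le_one_div_of_le (by norm_num) hp
  have h5 : 0 ≤ 1 / (Γ.p : ℝ) := by positivity
  nlinarith [mul_nonneg h5 (sub_nonneg.2 h4)]

end GroupGen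

/-! ### The reduction for the key of the first challenge identity. -/

section Reduction

variable {ℓ : ℕ → ℕ} {M : GroupGen fun k => ℓ k + 1} {H : GroupHash M ℓ}

/-- The output of a trapdoor key generator for given randomness. -/
def PPT.trapOut (T : PPT) (k : ℕ) (pp : Data) (c : Fin (ℓ k) → (M.sys k pp).G 1)
    (h : (M.sys k pp).G 1) (τ : Fin (T.coins.eval k) → Bool) : Data :=
  T.fn (.list [unary k, .list [pp, .list (List.ofFn fun i => (M.sys k pp).enc 1 (c i)),
    (M.sys k pp).enc 1 h], str τ])

theorem trapKeys_eq_map (T : PPT) (k : ℕ) (pp : Data) (c : Fin (ℓ k) → (M.sys k pp).G 1)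
    (h : (M.sys k pp).G 1) :
    H.trapKeys T k pp c h = (PMF.uniformOfFintype (Fin (T.coins.eval k) → Bool)).map fun τ =>
      ((T.trapOut k pp c h τ).fst, (T.trapOut k pp c h τ).snd) := by
  rw [GroupHash.trapKeys, PPT.run, PMF.map_comp]
  rfl

theorem mem_support_trapKeys (T : PPT) (k : ℕ) (pp : Data) (c : Fin (ℓ k) → (M.sys k pp).G 1)
    (h : (M.sys k pp).G 1) (τ : Fin (T.coins.eval k) → Bool) :
    ((T.trapOut k pp c h τ).fst, (T.trapOut k pp c h τ).snd) ∈ (H.trapKeys T k pp c h).support := by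
  rw [trapKeys_eq_map]
  exact mem_support_uniform_map
    (fun τ => ((T.trapOut k pp c h τ).fst, (T.trapOut k pp c h τ).snd)) τ

/-- The family that contains the identities whose keys are revealed. -/
def Transcript.family {k : ℕ} (r : Transcript (Fin k → Bool)) (q : ℕ) (i : Fin q) : Fin k → Bool :=
  r.revealed[(i : ℕ)]?.getD (flipZero r.first)

/-- At least one position lies beyond the revealed identities, so the padding value always occurs.
This is why `Transcript.Good` has a condition at `flipZero r.first`: its event matches that of
programmability exactly. -/
theorem Transcript.forall_family {k q : ℕ} {r : Transcript (Fin k → Bool)}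
    (hr : r.revealed.length < q) {φ : (Fin k → Bool) → Prop} :
    (∀ i, φ (r.family q i)) ↔ φ (flipZero r.first) ∧ ∀ X ∈ r.revealed, φ X := by
  constructor
  · intro h
    refine ⟨?_, fun X hX => ?_⟩
    · simpa [family] using h ⟨_, hr⟩
    · obtain ⟨i, hi, rfl⟩ := List.mem_iff_getElem.1 hX
      simpa [family, hi] using h ⟨i, hi.trans hr⟩
  · rintro ⟨h1, h2⟩ i
    unfold family
    by_cases hi : (i : ℕ) < r.revealed.length
    · simpa [hi] using h2 _ (List.getElem_mem hi)
    · simpa [hi] using h1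

/-- The hash key for given randomness. -/
def GroupHash.key (H : GroupHash M ℓ) (k : ℕ) (pp : Data) (w : Fin (H.hgen.coins.eval k) → Bool) :
    Data := H.hgen.fn (.list [unary k, pp, str w])

/-- Programmability is applied with `Z_1 = Z_2`, since only the first challenge identity needs a
nonzero exponent. -/
theorem progProb_trapKeys (T : PPT) (k q : ℕ) (pp : Data) (c : Fin (ℓ k) → (M.sys k pp).G 1)
    (h : (M.sys k pp).G 1) {α : Type} [Zero α] (a : Data → (Fin k → Bool) → α)
    {r : Transcript (Fin k → Bool)}
    (hr : r.revealed.length < q) (y : Data) :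
    GroupHash.progProb (H.trapKeys T k pp c h) a y (r.family q) (fun _ : Fin 2 => r.first)
      = condProb (fun τ => (T.trapOut k pp c h τ).fst)
        (fun τ => r.Good (a (T.trapOut k pp c h τ).snd)) y := by
  rw [GroupHash.progProb, trapKeys_eq_map, prob_uniform_map, prob_uniform_map, condProb]
  congr 2
  funext τ
  congr 1
  simp only [Set.mem_ofPred_eq, Transcript.Good, forall_const, eq_iff_iff, ne_eq]
  rw [Transcript.forall_family hr (φ := fun X => a (T.trapOut k pp c h τ).snd X = 0)]
  tauto

/-- The programs for the reduction, for an adversary `nx` with a bound on the number of queries. -/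
theorem GroupHash.IsPolyMPHF.exists_toolkit (hH : H.IsPolyMPHF 2) {nx : Data → Data}
    (hnx : PolyTime nx) (m coins : Polynomial ℕ) :
    ∃ (R : Toolkit) (a : ∀ k pp, Data → (Fin k → Bool) → ZMod (M.sys k pp).p)
      (B : ∀ k pp, Data → (Fin k → Bool) → (M.sys k pp).G (ℓ k - 1)) (P : Polynomial ℕ)
      (ν ν' : ℕ → ℝ), R.next = nx ∧ R.queries = m ∧ R.coins = coins ∧ R.trials = .X * P ∧
      (∀ k, 0 < P.eval k) ∧ Negligible ν ∧ Negligible ν' ∧ (∀ k, 0 ≤ ν' k) ∧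
      ∀ k, 0 < k → ∀ pp ∈ (M.params k).support, R.Computes (l := ℓ k) k (M.sys k pp) pp ∧
        ∀ c h, h ≠ 1 → ∃ o, R.Programs k (H.one_le k) (M.sys k pp) pp (H.key k pp)
          (H.eval k pp) h c (a k pp) (B k pp) o (1 / (P.eval k : ℕ)) (ν k) (ν' k) := by
  -- Room for `2 * m` revealed identities from two phases, and one more place for the padding.
  obtain ⟨T, f, a, B, P, ν, ν', hf, hP, hν, hν', hT⟩ := hH (2 * m + 1)
  obtain ⟨fm, hfm, hmul⟩ := M.mul_eff
  obtain ⟨fe, hfe, he⟩ := M.e_eff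
  obtain ⟨E, hE⟩ := M.enc_size
  let R : Toolkit :=
    { next := nx, trap := T.fn, teval := f, mul := fm, pair := fe, next_poly := hnx
      trap_poly := T.polyTime, teval_poly := hf, mul_poly := hfm, pair_poly := hfe, queries := m
      coins := coins, trapCoins := T.coins, encSize := E, trials := .X * P }
  refine ⟨R, a, B, P, ν, fun k => |ν' k|, rfl, rfl, rfl, rfl, hP, hν, hν'.abs,
    fun k => abs_nonneg _, fun k hk0 pp hpp => ⟨?_, fun c h hh => ⟨T.trapOut k pp c h, ?_⟩⟩⟩
  · exact ⟨hmul k pp hpp _ le_rfl, he k pp hpp, hE k pp hpp _ (Nat.le_succ _)⟩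
  obtain ⟨hstat, heval, hprob⟩ := hT k pp hpp c h hh
  refine ⟨fun τ => rfl, ?_, ?_, ?_, ?_⟩
  · exact fun τ X => (heval _ (mem_support_trapKeys T k pp c h τ) X).1
  · exact fun τ X => (heval _ (mem_support_trapKeys T k pp c h τ) X).2
  · intro r hr hlen σ
    have hlt : r.revealed.length < (2 * m + 1).eval k := by simpa using Nat.lt_succ_of_le hlen
    -- For `k = 0` there would be no identity other than `r.first` to pad with.
    have hne : ∀ i j, r.family ((2 * m + 1).eval k) i ≠ (fun _ : Fin 2 => r.first) j := fun i j =>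
      (Transcript.forall_family hlt (φ := fun X => X ≠ r.first)).2
        ⟨flipZero_ne hk0 _, fun X hX h => hr (h ▸ hX)⟩ i
    have := hprob _ _ hne _ (mem_support_trapKeys T k pp c h σ)
    simp only [progProb_trapKeys T k _ pp c h (a k pp) hlt] at this
    exact ⟨this.1, fun σ' => (this.2 _ (mem_support_trapKeys T k pp c h σ')).trans (le_abs_self _)⟩
  · intro S
    have := hstat S
    rw [trapKeys_eq_map, PMF.map_comp, prob_uniform_map, prob_run] at this
    exact this

/-- The probability that the adversary outputs `1` for given group system, `h`, secret exponent `x`,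
random value `r` of the capsule, and key `K`. -/
noncomputable def GroupHash.winProb (H : GroupHash M ℓ) (nx : Data → Data) (m coins : Polynomial ℕ)
    (k : ℕ) (pp : Data) (h : (M.sys k pp).G 1) (x r : ZMod (M.sys k pp).p)
    (K : Data → Commitment (Fin k → Bool) → (M.sys k pp).G (ℓ k + 1)) : ℝ :=
  avg fun ω : Fin (coins.eval k) → Bool => avg fun w => ind (Wins (idealRun (l := ℓ k) (M.sys k pp)
    nx (m.eval k) pp (H.eval k pp) h x (str ω) ((M.sys k pp).pow h r) K (H.key k pp w)))

/-- The genuine key of the first challenge identity. -/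
def GroupHash.realKey (H : GroupHash M ℓ) (k : ℕ) (pp : Data) (h : (M.sys k pp).G 1)
    (x r : ZMod (M.sys k pp).p) (hk : Data) (s : Commitment (Fin k → Bool)) :
    (M.sys k pp).G (ℓ k + 1) :=
  (M.sys k pp).pow ((M.sys k pp).e rfl (H.eval k pp hk s.first) ((M.sys k pp).pow h x)) r

theorem GroupHash.winProb_nonneg (nx : Data → Data) (m coins : Polynomial ℕ) (k : ℕ) (pp : Data)
    (h : (M.sys k pp).G 1) (x r : ZMod (M.sys k pp).p)
    (K : Data → Commitment (Fin k → Bool) → (M.sys k pp).G (ℓ k + 1)) :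
    0 ≤ H.winProb nx m coins k pp h x r K :=
  avg_nonneg fun _ => avg_nonneg fun _ => ind_nonneg _

theorem GroupHash.winProb_le_one (nx : Data → Data) (m coins : Polynomial ℕ) (k : ℕ) (pp : Data)
    (h : (M.sys k pp).G 1) (x r : ZMod (M.sys k pp).p)
    (K : Data → Commitment (Fin k → Bool) → (M.sys k pp).G (ℓ k + 1)) :
    H.winProb nx m coins k pp h x r K ≤ 1 :=
  avg_le_of_le fun _ => avg_le_of_le fun _ => ind_le_one _

/-- To be used with `a₀ = 1` for the group element `h`, where programmability says nothing. A single
point has weight `1 / Fintype.card α`, and its error is at most `N`. -/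
theorem abs_mul_avg_sub_avg_le_of_ne {α : Type} [Fintype α] [Nonempty α] (a₀ : α) {f g : α → ℝ}
    {N ε : ℝ}
    (hN : 1 ≤ N) (hε : 0 ≤ ε) (hf0 : ∀ a, 0 ≤ f a) (hf1 : ∀ a, f a ≤ 1) (hg0 : ∀ a, 0 ≤ g a)
    (hg1 : ∀ a, g a ≤ 1) (h : ∀ a, a ≠ a₀ → |N * f a - g a| ≤ ε) :
    |N * avg f - avg g| ≤ ε + N * (1 / Fintype.card α) := by
  rw [← avg_ind_eq a₀, ← avg_mul_left, ← avg_mul_left, ← avg_const (α := α) ε, ← avg_add]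
  refine abs_avg_sub_le fun a => ?_
  by_cases ha : a = a₀
  · simp only [ha, ind_true, mul_one]
    have h1 := mul_le_mul_of_nonneg_left (hf1 a₀) (zero_le_one.trans hN)
    have h2 := mul_nonneg (zero_le_one.trans hN) (hf0 a₀)
    rw [abs_le]
    constructor <;> linarith [hg0 a₀, hg1 a₀]
  · simpa [ha] using h a ha

theorem abs_winProb_sub_le {R : Toolkit} {k : ℕ} {pp : Data}
    {a : Data → (Fin k → Bool) → ZMod (M.sys k pp).p}
    {B : Data → (Fin k → Bool) → (M.sys k pp).G (ℓ k - 1)} {δ ν ν' : ℝ}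
    (hk0 : 0 < k) (ht : 0 < R.trials.eval k) (hδ0 : 0 ≤ δ) (hδ : δ ≤ 1) (hν : 0 ≤ ν')
    (hR : R.Computes (l := ℓ k) k (M.sys k pp) pp)
    (hP : ∀ c h, h ≠ 1 → ∃ o, R.Programs k (H.one_le k) (M.sys k pp) pp (H.key k pp)
          (H.eval k pp) h c a B o δ ν ν') :
    |indexRange (R.trials.eval k) 1 k * (avg fun g => avg fun x =>
        M.acceptance R.distinguisher k pp g x ((M.sys k pp).pow ((M.sys k pp).multi (ℓ k + 1)
        fun i => (M.sys k pp).pow g (x i.castSucc)) (x (Fin.last (ℓ k + 1)))))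
      - avg fun h => avg fun x => avg fun r =>
        H.winProb R.next R.queries R.coins k pp h x r (H.realKey k pp h x r)|
      ≤ indexRange (R.trials.eval k) 1 k * ν' + (1 - δ) ^ indexRange (R.trials.eval k) 1 k + |ν|
        + indexRange (R.trials.eval k) 1 k * (1 / (M.sys k pp).p) ∧
    |indexRange (R.trials.eval k) 1 k * (avg fun g => avg fun x => avg fun S =>
        M.acceptance R.distinguisher k pp g x S)
      - avg fun h => avg fun x => avg fun r => avg fun K =>
        H.winProb R.next R.queries R.coins k pp h x r fun _ _ => K|
      ≤ indexRange (R.trials.eval k) 1 k * ν' + (1 - δ) ^ indexRange (R.trials.eval k) 1 k + |ν|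
        + indexRange (R.trials.eval k) 1 k * (1 / (M.sys k pp).p) := by
  have hN : (1 : ℝ) ≤ indexRange (R.trials.eval k) 1 k := by
    exact_mod_cast indexRange_pos _ _ _ one_pos
  have hδN : (0 : ℝ) ≤ (1 - δ) ^ indexRange (R.trials.eval k) 1 k := pow_nonneg (by linarith) _
  have hε : 0 ≤ indexRange (R.trials.eval k) 1 k * ν'
    + (1 - δ) ^ indexRange (R.trials.eval k) 1 k + |ν| := by positivity
  have hcard : 1 / ((M.sys k pp).p : ℝ) = 1 / Fintype.card ((M.sys k pp).G 1) := by
    rw [(M.sys k pp).card_eq 1 (Nat.succ_le_succ (Nat.zero_le _))]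
  rw [hcard]
  constructor
  · refine abs_mul_avg_sub_avg_le_of_ne 1 hN hε
      (fun g => avg_nonneg fun x => GroupGen.acceptance_nonneg _ _ _ _ _)
      (fun g => avg_le_of_le fun x => GroupGen.acceptance_le_one _ _ _ _ _)
      (fun h => avg_nonneg fun x => avg_nonneg fun r => GroupHash.winProb_nonneg _ _ _ _ _ _ _ _ _)
      (fun h => avg_le_of_le fun x => avg_le_of_le fun r => GroupHash.winProb_le_one _ _ _ _ _ _ _ _ _)
      fun h hh => ?_
    rw [← avg_last_two (n := ℓ k) fun x r =>
      H.winProb R.next R.queries R.coins k pp h x r (H.realKey k pp h x r), ← avg_mul_left]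
    refine (abs_avg_sub_le (h := fun _ => _) fun x => ?_).trans_eq (avg_const _)
    obtain ⟨o, ho⟩ := hP (fun i => (M.sys k pp).pow h (x i.castSucc.castSucc)) h hh
    exact (ho.abs_accept_real_sub_le hk0 hR ht hδ0 hδ hν).trans (by linarith [le_abs_self ν])
  · refine abs_mul_avg_sub_avg_le_of_ne 1 hN hε
      (fun g => avg_nonneg fun x => avg_nonneg fun S => GroupGen.acceptance_nonneg _ _ _ _ _)
      (fun g => avg_le_of_le fun x => avg_le_of_le fun S => GroupGen.acceptance_le_one _ _ _ _ _)
      (fun h => avg_nonneg fun x => avg_nonneg fun r => avg_nonneg fun K =>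
        GroupHash.winProb_nonneg _ _ _ _ _ _ _ _ _)
      (fun h => avg_le_of_le fun x => avg_le_of_le fun r => avg_le_of_le fun K =>
        GroupHash.winProb_le_one _ _ _ _ _ _ _ _ _)
      fun h hh => ?_
    rw [← avg_last_two (n := ℓ k) fun x r => avg fun K =>
      H.winProb R.next R.queries R.coins k pp h x r fun _ _ => K, ← avg_mul_left]
    refine (abs_avg_sub_le (h := fun _ => _) fun x => ?_).trans_eq (avg_const _)
    obtain ⟨o, ho⟩ := hP (fun i => (M.sys k pp).pow h (x i.castSucc.castSucc)) h hh
    exact (ho.abs_accept_random_sub_le hk0 hR ht hδ0 hδ hν).trans (by linarith [le_abs_self ν])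

/-- Genuine keys are indistinguishable from uniform ones. -/
theorem negligible_winProb_sub (hH : H.IsPolyMPHF 2) (hM : M.MDDH) {nx : Data → Data}
    (hnx : PolyTime nx) (m coins : Polynomial ℕ) :
    Negligible fun k =>
      (M.avgParams k fun pp => avg fun h => avg fun x => avg fun r =>
        H.winProb nx m coins k pp h x r (H.realKey k pp h x r))
      - M.avgParams k fun pp => avg fun h => avg fun x => avg fun r => avg fun K =>
        H.winProb nx m coins k pp h x r fun _ _ => K := by
  obtain ⟨R, a, B, P, ν, ν', rfl, rfl, rfl, htr, hP, hν, hν', hν0, hR⟩ :=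
    hH.exists_toolkit hnx m coins
  have hinv := hM.negligible_inv_order fun k => Nat.succ_le_succ (Nat.zero_le (ℓ k))
  have hneg := (((hM R.distinguisher).abs.poly_mul (2 * R.trials)).add
    (((((hν'.poly_mul (2 * R.trials)).add negligible_exp_neg).add hν.abs).add
      (hinv.poly_mul (2 * R.trials))).poly_mul 2))
  refine hneg.of_abs_le ?_
  -- `k` random bits push the range of the index above `trials` as soon as `trials < 2 ^ k`.
  filter_upwards [eventually_eval_lt_two_pow R.trials, eventually_gt_atTop 0] with k hk hk0
  refine le_trans ?_ (le_abs_self _)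
  rw [GroupGen.prob_mddhChallenge_true, GroupGen.prob_mddhChallenge_false]
  set N := indexRange (R.trials.eval k) 1 k with hN
  have hP1 : (1 : ℝ) ≤ (P.eval k : ℕ) := by exact_mod_cast hP k
  have htk : R.trials.eval k = k * P.eval k := by rw [htr]; simp
  have ht : 0 < R.trials.eval k := by rw [htk]; exact Nat.mul_pos hk0 (hP k)
  have hNle : (N : ℝ) ≤ ((2 * R.trials).eval k : ℕ) := by
    have := indexRange_le (R.trials.eval k) 1 k
    have h2 : (2 * R.trials).eval k = 2 * R.trials.eval k := by simp
    rw [h2]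
    exact_mod_cast this.trans (by omega)
  -- From `1 - 1/P ≤ exp (-1/P)` and `N > k * P`; this is why `trials` was chosen as `X * P`.
  have hpow : (1 - 1 / ((P.eval k : ℕ) : ℝ)) ^ N ≤ Real.exp (-k) := by
    have h1 : 1 - 1 / ((P.eval k : ℕ) : ℝ) ≤ Real.exp (-(1 / (P.eval k : ℕ))) := by
      linarith [Real.add_one_le_exp (-(1 / ((P.eval k : ℕ) : ℝ)))]
    have h2 : (k * P.eval k : ℝ) ≤ N := by
      have := lt_indexRange (R.trials.eval k) 1 k (by simpa using hk)
      rw [htk] at this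
      rw [hN, htk]
      exact_mod_cast this.le
    refine (pow_le_pow_left₀ (sub_nonneg.2 (div_le_one_of_le₀ hP1 (by positivity))) h1 N).trans ?_
    rw [← Real.exp_nat_mul, Real.exp_le_exp]
    have h3 : (k : ℝ) ≤ N * (1 / (P.eval k : ℕ)) := by
      rw [mul_one_div, le_div_iff₀ (by linarith)]
      exact h2
    linarith
  have hb := fun pp hpp => abs_winProb_sub_le hk0 ht (by positivity)
    (div_le_one_of_le₀ hP1 (by positivity)) (hν0 k) (hR k hk0 pp hpp).1 (hR k hk0 pp hpp).2
  have h1 := GroupGen.abs_avgParams_sub_le fun pp hpp => (hb pp hpp).1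
  have h2 := GroupGen.abs_avgParams_sub_le fun pp hpp => (hb pp hpp).2
  rw [GroupGen.avgParams_mul_left, GroupGen.avgParams_add, GroupGen.avgParams_const,
    GroupGen.avgParams_mul_left] at h1 h2
  have hI : 0 ≤ M.avgParams k fun pp => 1 / ((M.sys k pp).p : ℝ) :=
    GroupGen.avgParams_nonneg fun pp => by positivity
  simp only [Polynomial.eval_ofNat, Nat.cast_ofNat]
  -- Both acceptance probabilities are scaled by the same `N`, so the winning probabilities differ
  -- by at most `N` times the MDDH advantage plus twice the error. `T` is the polynomial bound on
  -- `N`.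
  have h3 : ∀ {A A' W W' e b T I : ℝ}, |N * A - W| ≤ e + N * I → |N * A' - W'| ≤ e + N * I →
      e ≤ b → 0 ≤ I → N ≤ T → |W - W'| ≤ T * |A - A'| + 2 * (b + T * I) := by
    intro A A' W W' e b T I h1 h2 he hI hT
    have h4 := mul_le_mul_of_nonneg_right hT hI
    have h5 := mul_le_mul_of_nonneg_right hT (abs_nonneg (A - A'))
    have h6 : N * (A - A') ≤ N * |A - A'| :=
      mul_le_mul_of_nonneg_left (le_abs_self _) (Nat.cast_nonneg _)
    have h7 : N * (A' - A) ≤ N * |A - A'| := by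
      rw [abs_sub_comm]
      exact mul_le_mul_of_nonneg_left (le_abs_self _) (Nat.cast_nonneg _)
    rw [abs_le] at h1 h2 ⊢
    constructor <;> linarith
  refine h3 h1 h2 (add_le_add (add_le_add ?_ hpow) le_rfl) hI hNle
  exact mul_le_mul_of_nonneg_right hNle (hν0 k)

end Reduction

/-! ### An adversary that detects trivial hash values. -/

section Phase

/-- If an adversary behaves like another one until the end of a query phase, where it changes the
final message, then so does the whole query phase. -/
theorem queryPhase_map_message {next next' : List Data → Data} (oracle : Data → Data) {m : ℕ}
    (φ : Data → Data)
    (h1 : ∀ ans, ans.length < m → (next ans).fst ≠ leaf → next' ans = next ans)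
    (h2 : ∀ ans, (next ans).fst = leaf ∨ m ≤ ans.length →
      next' ans = node leaf (φ (next ans).snd)) (j : ℕ) (ans asked : List Data)
    (hj : ans.length + j = m) :
    queryPhase next' oracle j ans asked
      = (φ (queryPhase next oracle j ans asked).1, (queryPhase next oracle j ans asked).2) := by
  induction j generalizing ans asked with
  | zero => rw [queryPhase, queryPhase, h2 ans (.inr (by omega))]; rfl
  | succ j ih =>
    rw [queryPhase, queryPhase]
    by_cases h : (next ans).fst = leaf
    · rw [h2 ans (.inl h), fst_node, if_pos rfl, if_pos h]; rfl
    · rw [h1 ans (by omega) h, if_neg h, if_neg h]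
      exact ih _ _ (by simp; omega)

theorem queryPhase_fst_of_leaf {next : List Data → Data} (oracle : Data → Data)
    (j : ℕ) (ans asked : List Data) (h : (next ans).fst = leaf) :
    (queryPhase next oracle j ans asked).1 = (next ans).snd := by
  cases j with
  | zero => rfl
  | succ j => rw [queryPhase, if_pos h]

end Phase

section Triviality

/-- The adversary that behaves like `nx` in the first phase, but submits the second challenge identity
twice, and then tests whether the challenge key is trivial. -/
noncomputable def trivialityTest (nx fm : Data → Data) (m : Polynomial ℕ) (v : Data) : Data :=
  sel v.snd.snd.snd.snd.fst
    (node leaf (eqb (fm (.list [v.fst.fst, v.snd.fst.fst, node leaf v.fst.snd,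
      v.snd.snd.snd.snd.fst.fst.fst, v.snd.snd.snd.snd.fst.fst.fst]))
      v.snd.snd.snd.snd.fst.fst.fst))
    (sel (nx v).fst (sel (drop v.snd.snd.snd.fst (unary (m.eval v.fst.fst.len))) (nx v)
      (node leaf (node (nx v).snd.snd (nx v).snd.snd)))
      (node leaf (node (nx v).snd.snd (nx v).snd.snd)))

theorem polyTime_trivialityTest {nx fm : Data → Data} (hnx : PolyTime nx) (hfm : PolyTime fm)
    (m : Polynomial ℕ) : PolyTime (trivialityTest nx fm m) := by
  have h1 : ∀ {g : Data → Data}, PolyTime g → PolyTime fun v => fm (g v) := fun hg => hfm.comp hg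
  have h2 : PolyTime fun v => eqb (fm (.list [v.fst.fst, v.snd.fst.fst, node leaf v.fst.snd,
      v.snd.snd.snd.snd.fst.fst.fst, v.snd.snd.snd.snd.fst.fst.fst]))
      v.snd.snd.snd.snd.fst.fst.fst := .eqb (h1 (by fun_prop)) (by fun_prop)
  have h3 : PolyTime fun v => unary (m.eval v.fst.fst.len) := .unary_eval m (by fun_prop)
  unfold trivialityTest
  fun_prop

variable {k l : ℕ} {nx fm : Data → Data} {m : Polynomial ℕ} {pk tape : Data}

theorem playerView_trivialityTest_leaf (ans : List Data) :
    playerView (trivialityTest nx fm m) k l pk tape ans leaf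
      = sel (playerView nx k l pk tape ans leaf).fst
        (sel (drop (.list ans) (unary (m.eval k))) (playerView nx k l pk tape ans leaf)
          (node leaf (node (playerView nx k l pk tape ans leaf).snd.snd
            (playerView nx k l pk tape ans leaf).snd.snd)))
        (node leaf (node (playerView nx k l pk tape ans leaf).snd.snd
          (playerView nx k l pk tape ans leaf).snd.snd)) := by
  simp only [playerView, trivialityTest, list_cons, fst_node, snd_node, len_unary]
  rfl

/-- Only the final message is changed, so queries and answers stay the same, and an identity that
was admissible as the second one may be submitted twice. -/
theorem commitPhase_trivialityTest {ι : Type} (str : ι → Data) {O : ι → Data} {s : Commitment ι}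
    (hs : commitPhase str (playerView nx k l pk tape) O (m.eval k) = some s) :
    commitPhase str (playerView (trivialityTest nx fm m) k l pk tape) O (m.eval k)
      = some ⟨s.second, s.second, s.answers, s.revealed⟩ := by
  have key := queryPhase_map_message
    (next := fun ans => playerView nx k l pk tape ans .leaf)
    (next' := fun ans => playerView (trivialityTest nx fm m) k l pk tape ans .leaf)
    (keyAnswer str O ∅) (m := m.eval k) (fun d => node d.snd d.snd)
    (fun ans h1 h2 => ?_) (fun ans h => ?_) (m.eval k) [] [] (by simp)
  · unfold commitPhase at hs ⊢
    dsimp only at hs ⊢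
    rw [key]
    generalize queryPhase (fun ans => playerView nx k l pk tape ans .leaf) (keyAnswer str O ∅)
      (m.eval k) [] [] = q at hs
    rcases h0 : parse str q.1.fst with _ | i₀
    · simp [h0] at hs
    rcases h1 : parse str q.1.snd with _ | i₁
    · simp [h0, h1] at hs
    simp only [h0, h1] at hs
    split_ifs at hs with h
    obtain rfl := Option.some.inj hs
    simp only [fst_node, snd_node, h1]
    rw [if_neg (by tauto)]
  · rw [playerView_trivialityTest_leaf, sel_eq_ite, if_neg h2, sel_eq_ite, if_neg]
    rw [drop_eq_leaf]
    simpa using h1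
  -- At the query bound even a message in the form of a query counts as the submission, so it has to
  -- be replaced as well.
  · rw [playerView_trivialityTest_leaf, sel_eq_ite, sel_eq_ite, drop_eq_leaf, len_unary, len_list]
    split_ifs <;> tauto

theorem playerView_trivialityTest_node (ans : List Data) (K C rest : Data) :
    playerView (trivialityTest nx fm m) k l pk tape ans (node (node K C) rest)
      = node leaf (eqb (fm (.list [unary k, pk.fst, unary (l + 1), K, K])) K) := by
  simp only [playerView, trivialityTest, list_cons, fst_node, snd_node]
  rfl

variable {Γ : GroupSystem (l + 1)} {pp : Data}

/-- In its second phase the test asks nothing and answers at once, by checking `K * K = K`. -/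
theorem wins_trivialityTest_iff
    (hmul : ∀ x y : Γ.G (l + 1), fm (.list [unary k, pp, unary (l + 1), Γ.enc (l + 1) x,
      Γ.enc (l + 1) y]) = Γ.enc (l + 1) (x * y))
    (hev : Data → (Fin k → Bool) → Γ.G l) (h : Γ.G 1) (x : ZMod Γ.p) (C : Γ.G 1)
    (K : Data → Commitment (Fin k → Bool) → Γ.G (l + 1)) (hk : Data) :
    Wins (idealRun Γ (trivialityTest nx fm m) (m.eval k) pp hev h x tape C K hk) ↔
      ∃ s, commitPhase str (playerView (trivialityTest nx fm m) k l
        (publicData Γ pp hk h (Γ.pow h x)) tape) (fun X => Γ.enc l (Γ.pow (hev hk X) x)) (m.eval k)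
          = some s ∧ K hk s = 1 := by
  unfold Wins idealRun runGame
  simp only [Option.map_eq_some_iff]
  have hout : ∀ s, (finish str (playerView (trivialityTest nx fm m) k l
      (publicData Γ pp hk h (Γ.pow h x)) tape) (fun X => Γ.enc l (Γ.pow (hev hk X) x)) (m.eval k) s
      (.node (Γ.enc (l + 1) (K hk s)) (Γ.enc 1 C))).out ≠ leaf ↔ K hk s = 1 := by
    intro s
    have hpp : (publicData Γ pp hk h (Γ.pow h x)).fst = pp := rfl
    have hp := queryPhase_fst_of_leaf
      (next := fun ans => playerView (trivialityTest nx fm m) k l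
        (publicData Γ pp hk h (Γ.pow h x)) tape s.answers
        (.node (.node (Γ.enc (l + 1) (K hk s)) (Γ.enc 1 C)) (.list ans)))
      (keyAnswer str (fun X => Γ.enc l (Γ.pow (hev hk X) x)) {s.first, s.second}) (m.eval k) [] []
      (by simp only [playerView_trivialityTest_node, fst_node])
    rw [finish, guessPhase, hp]
    simp only [playerView_trivialityTest_node, snd_node, hpp, hmul, ne_eq, eqb_eq_leaf,
      not_not, (Γ.enc_injective _ le_rfl).eq_iff, mul_eq_left]
  constructor
  · rintro ⟨r, ⟨s, hs, rfl⟩, hr⟩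
    exact ⟨s, hs, (hout s).1 hr⟩
  · rintro ⟨s, hs, hK⟩
    exact ⟨_, ⟨s, hs, rfl⟩, (hout s).2 hK⟩

end Triviality

/-! ### The key of the second challenge identity. -/

section SecondKey

theorem abs_avg_ind_sub_avg_ind_le_one {α β : Type} [Fintype α] [Nonempty α] [Fintype β]
    [Nonempty β] (P : α → Prop) (Q : β → Prop) :
    |avg (fun a => ind (P a)) - avg fun b => ind (Q b)| ≤ 1 := by
  have h1 : 0 ≤ avg fun a => ind (P a) := avg_nonneg fun _ => ind_nonneg _
  have h2 : avg (fun a => ind (P a)) ≤ 1 := avg_le_of_le fun _ => ind_le_one _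
  have h3 : 0 ≤ avg fun b => ind (Q b) := avg_nonneg fun _ => ind_nonneg _
  have h4 : avg (fun b => ind (Q b)) ≤ 1 := avg_le_of_le fun _ => ind_le_one _
  rw [abs_le]
  constructor <;> linarith

variable {k l : ℕ} {Γ : GroupSystem (l + 1)} {pp : Data}

/-- Unless the key is trivial, the challenge key for the second identity is uniform. -/
theorem abs_avg_secondKey_sub_le (nx : Data → Data) (m : ℕ) (tape : Data)
    (hev : Data → (Fin k → Bool) → Γ.G l) (h : Γ.G 1) (x : ZMod Γ.p) (C : Γ.G 1) (hk : Data) :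
    |avg (fun r => ind (Wins (idealRun Γ nx m pp hev h x tape C
        (fun hk s => Γ.pow (Γ.e rfl (hev hk s.second) (Γ.pow h x)) r) hk)))
      - avg fun K => ind (Wins (idealRun Γ nx m pp hev h x tape C (fun _ _ => K) hk))|
    ≤ ind (h = 1) + ind (x = 0) + ind (∃ s, commitPhase str (playerView nx k l
        (publicData Γ pp hk h (Γ.pow h x)) tape) (fun X => Γ.enc l (Γ.pow (hev hk X) x)) m
          = some s ∧ hev hk s.second = 1) := by
  unfold idealRun runGame
  rcases hs : commitPhase str (playerView nx k l (publicData Γ pp hk h (Γ.pow h x)) tape)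
    (fun X => Γ.enc l (Γ.pow (hev hk X) x)) m with _ | s
  · have hw : ¬Wins (none : Option (Transcript (Fin k → Bool))) := by simp [Wins]
    simp [hw, avg_const, ind_nonneg, add_nonneg]
  simp only [Option.map_some, Option.some.injEq, exists_eq_left']
  by_cases hb : Γ.e rfl (hev hk s.second) (Γ.pow h x) = 1
  · rw [Γ.e_eq_one_iff rfl le_rfl, Γ.pow_eq_one_iff (Nat.succ_le_succ (Nat.zero_le l))] at hb
    have h1 : (1 : ℝ) ≤ ind (h = 1) + ind (x = 0) + ind (hev hk s.second = 1) := by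
      have := ind_nonneg (h = 1)
      have := ind_nonneg (x = 0)
      have := ind_nonneg (hev hk s.second = 1)
      rcases hb with hb | hb | hb <;> simp only [hb, ind_true] <;> linarith
    exact (abs_avg_ind_sub_avg_ind_le_one _ _).trans h1
  -- If the base of the key is nontrivial, `r ↦ base^r` is a bijection onto the group, and the
  -- capsule does not involve `r`.
  · have := avg_bijective (Γ.pow_bijective le_rfl hb) fun K => ind (Wins (some (finish str
        (playerView nx k l (publicData Γ pp hk h (Γ.pow h x)) tape)
        (fun X => Γ.enc l (Γ.pow (hev hk X) x)) m s (.node (Γ.enc (l + 1) K) (Γ.enc 1 C)))))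
    rw [this, sub_self, abs_zero]
    have := ind_nonneg (h = 1)
    have := ind_nonneg (x = 0)
    have := ind_nonneg (hev hk s.second = 1)
    positivity

end SecondKey

/-! ### The advantage in the game. -/

section Security

variable {ℓ : ℕ → ℕ} {M : GroupGen fun k => ℓ k + 1} {H : GroupHash M ℓ}

/-- The genuine key of the second challenge identity. -/
def GroupHash.secondKey (H : GroupHash M ℓ) (k : ℕ) (pp : Data) (h : (M.sys k pp).G 1)
    (x r : ZMod (M.sys k pp).p) (hk : Data) (s : Commitment (Fin k → Bool)) :
    (M.sys k pp).G (ℓ k + 1) :=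
  (M.sys k pp).pow ((M.sys k pp).e rfl (H.eval k pp hk s.second) ((M.sys k pp).pow h x)) r

/-- The next-message function of an adversary, as a function of the data in `playerView`. -/
def Adversary.player (A : Adversary) (v : Data) : Data :=
  A.next (.list [v.fst.fst, v.snd.fst, v.snd.snd.fst, v.snd.snd.snd.fst, v.snd.snd.snd.snd.fst])

theorem Adversary.polyTime_player (A : Adversary) : PolyTime A.player :=
  A.polyTime.comp (f := fun v => .list [v.fst.fst, v.snd.fst, v.snd.snd.fst, v.snd.snd.snd.fst,
    v.snd.snd.snd.snd.fst]) (by fun_prop)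

/-- The game draws hash key, `h`, `x`, tape and `r` in this order, while `winProb` has the hash key
and the tape innermost. -/
theorem avg_rotate {α β γ δ ε : Type} [Fintype α] [Fintype β] [Fintype γ] [Fintype δ] [Fintype ε]
    (F : α → β → γ → δ → ε → ℝ) :
    (avg fun a => avg fun b => avg fun c => avg fun d => avg fun e => F a b c d e)
      = avg fun b => avg fun c => avg fun e => avg fun d => avg fun a => F a b c d e := by
  rw [avg_comm]
  congr 1; funext b
  rw [avg_comm]
  congr 1; funext c
  simp only [fun a => avg_comm fun d e => F a b c d e]
  rw [avg_comm]
  congr 1; funext e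
  rw [avg_comm]

/-- The guess of the adversary in the game for the scheme. -/
noncomputable def GroupHash.guess (H : GroupHash M ℓ) (A : Adversary) (k : ℕ) (pp hk : Data)
    (h : (M.sys k pp).G 1) (x : ZMod (M.sys k pp).p) (tape : Data)
    (r : (ZMod (M.sys k pp).p)ˣ × (ZMod (M.sys k pp).p)ˣ) (d : Bool) : Bool :=
  IBKEM.guess (multilinearIBKEM ℓ M H) A (k := k)
    (⟨pp, hk, h, (M.sys k pp).pow h x⟩ : MasterPublic M k) (⟨pp, hk, x⟩ : MasterSecret M k) tape
    r.1 r.2 d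

theorem GroupHash.guess_iff (A : Adversary) {k : ℕ} (pp hk : Data) (h : (M.sys k pp).G 1)
    (x : ZMod (M.sys k pp).p) (tape : Data)
    (r : (ZMod (M.sys k pp).p)ˣ × (ZMod (M.sys k pp).p)ˣ) (d : Bool) :
    H.guess A k pp hk h x tape r d = true ↔
      Wins (idealRun (l := ℓ k) (M.sys k pp) A.player (A.queries.eval k) pp (H.eval k pp) h x tape
        ((M.sys k pp).pow h (r.1 : ZMod (M.sys k pp).p))
        (if d then H.secondKey k pp h x r.2 else H.realKey k pp h x r.1) hk) := by
  refine (IBKEM.guess_eq_true (multilinearIBKEM ℓ M H) A (k := k)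
    (⟨pp, hk, h, (M.sys k pp).pow h x⟩ : MasterPublic M k) (⟨pp, hk, x⟩ : MasterSecret M k) tape
    r.1 r.2 d).trans ?_
  cases d <;> rfl

theorem game_multilinearIBKEM_eq (A : Adversary) (k : ℕ) :
    (multilinearIBKEM ℓ M H).game A k = (M.params k).bind fun pp =>
      (H.hgen.run k pp).bind fun hk =>
      (PMF.uniformOfFintype ((M.sys k pp).G 1)).bind fun h =>
      (PMF.uniformOfFintype (ZMod (M.sys k pp).p)).bind fun x =>
      (PMF.uniformOfFintype (Fin (A.coins.eval k) → Bool)).bind fun ω =>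
      (PMF.uniformOfFintype ((ZMod (M.sys k pp).p)ˣ × (ZMod (M.sys k pp).p)ˣ)).bind fun r =>
      (PMF.uniformOfFintype Bool).map fun d => H.guess A k pp hk h x (str ω) r d == d := by
  refine (PMF.bind_bind _ _ _).trans ?_
  congr 1; funext pp
  refine (PMF.bind_bind _ _ _).trans ?_
  congr 1; funext hk
  refine (PMF.bind_bind _ _ _).trans ?_
  congr 1; funext h
  exact PMF.bind_map _ _ _

/-- A correct guess is output `1` for `d = 1` and output `0` for `d = 0`. Inadmissible submissions
count as output `0` in both cases. -/
theorem prob_game_multilinearIBKEM (A : Adversary) (k : ℕ) :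
    prob ((multilinearIBKEM ℓ M H).game A k) {true} = 1 / 2
      + ((M.avgParams k fun pp => avg fun h => avg fun x =>
          avg fun r : (ZMod (M.sys k pp).p)ˣ × (ZMod (M.sys k pp).p)ˣ =>
            H.winProb A.player A.queries A.coins k pp h x r.1 (H.secondKey k pp h x r.2))
        - M.avgParams k fun pp => avg fun h => avg fun x =>
          avg fun r : (ZMod (M.sys k pp).p)ˣ × (ZMod (M.sys k pp).p)ˣ =>
            H.winProb A.player A.queries A.coins k pp h x r.1 (H.realKey k pp h x r.1)) * (1 / 2) := by
  have h2 : ∀ (P Q : Prop), (ind P + ind (¬Q)) / 2 = 1 / 2 + 1 / 2 * (ind P - ind Q) := by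
    intro P Q
    rw [ind_not]
    ring
  rw [game_multilinearIBKEM_eq, ← GroupGen.avgParams_sub, mul_comm, ← GroupGen.avgParams_mul_left,
    GroupGen.prob_params_bind]
  refine Eq.trans ?_ ((GroupGen.avgParams_add _ _).trans
    (congrArg (· + _) (GroupGen.avgParams_const (M := M) (k := k) (1 / 2))))
  congr 1; funext pp
  simp only [prob_run_bind, prob_uniform_bind, prob_uniform_map, avg_bool, Set.mem_singleton_iff,
    beq_iff_eq, ← Bool.not_eq_true, GroupHash.guess_iff, if_true, Bool.false_eq_true, if_false, h2]
  rw [avg_rotate]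
  simp only [avg_add, avg_const, avg_mul_left, avg_sub]
  rfl

/-- The probability that the adversary submits a second identity with a trivial hash value. -/
noncomputable def GroupHash.trivialProb (H : GroupHash M ℓ) (nx : Data → Data)
    (m coins : Polynomial ℕ) (k : ℕ) (pp : Data) (h : (M.sys k pp).G 1)
    (x : ZMod (M.sys k pp).p) : ℝ :=
  avg fun ω : Fin (coins.eval k) → Bool => avg fun w => ind (∃ s, commitPhase str
    (playerView nx k (ℓ k) (publicData (l := ℓ k) (M.sys k pp) pp (H.key k pp w) h
      ((M.sys k pp).pow h x)) (str ω))
    (fun X => (M.sys k pp).enc (ℓ k) ((M.sys k pp).pow (H.eval k pp (H.key k pp w) X) x))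
    (m.eval k) = some s ∧ H.eval k pp (H.key k pp w) s.second = 1)

variable {nx : Data → Data} {m coins : Polynomial ℕ} {k : ℕ} {pp : Data}

theorem abs_avg_winProb_secondKey_sub_le (h : (M.sys k pp).G 1) (x r : ZMod (M.sys k pp).p) :
    |avg (fun y => H.winProb nx m coins k pp h x r (H.secondKey k pp h x y))
      - avg fun K => H.winProb nx m coins k pp h x r fun _ _ => K|
    ≤ ind (h = 1) + ind (x = 0) + H.trivialProb nx m coins k pp h x := by
  unfold GroupHash.winProb GroupHash.trivialProb
  rw [avg_comm, avg_comm fun K : (M.sys k pp).G (ℓ k + 1) => _,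
    ← avg_const (α := Fin (coins.eval k) → Bool) (ind (h = 1) + ind (x = 0)), ← avg_add]
  refine abs_avg_sub_le fun ω => ?_
  rw [avg_comm, avg_comm fun K : (M.sys k pp).G (ℓ k + 1) => _,
    ← avg_const (α := Fin (H.hgen.coins.eval k) → Bool) (ind (h = 1) + ind (x = 0)), ← avg_add]
  refine abs_avg_sub_le fun w => ?_
  exact abs_avg_secondKey_sub_le (Γ := M.sys k pp) nx (m.eval k) (str ω) (H.eval k pp) h x
    ((M.sys k pp).pow h r) (H.key k pp w)

/-- A trivial hash value makes the genuine key trivial for every `r`, and the test then outputs `1`.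
-/
theorem trivialProb_le_winProb {fm : Data → Data}
    (hmul : ∀ x y : (M.sys k pp).G (ℓ k + 1), fm (.list [unary k, pp, unary (ℓ k + 1),
      (M.sys k pp).enc (ℓ k + 1) x, (M.sys k pp).enc (ℓ k + 1) y])
      = (M.sys k pp).enc (ℓ k + 1) (x * y))
    (h : (M.sys k pp).G 1) (x r : ZMod (M.sys k pp).p) :
    H.trivialProb nx m coins k pp h x
      ≤ H.winProb (trivialityTest nx fm m) m coins k pp h x r (H.realKey k pp h x r) := by
  refine avg_mono fun ω => avg_mono fun w => ind_mono ?_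
  rintro ⟨s, hs, h1⟩
  rw [wins_trivialityTest_iff hmul]
  refine ⟨_, commitPhase_trivialityTest str hs, ?_⟩
  rw [GroupHash.realKey, h1, GroupSystem.e_one_left _ _ le_rfl, GroupSystem.pow, one_pow]

theorem avg_winProb_trivialityTest_le {fm : Data → Data}
    (hmul : ∀ x y : (M.sys k pp).G (ℓ k + 1), fm (.list [unary k, pp, unary (ℓ k + 1),
      (M.sys k pp).enc (ℓ k + 1) x, (M.sys k pp).enc (ℓ k + 1) y])
      = (M.sys k pp).enc (ℓ k + 1) (x * y))
    (h : (M.sys k pp).G 1) (x r : ZMod (M.sys k pp).p) :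
    avg (fun K => H.winProb (trivialityTest nx fm m) m coins k pp h x r fun _ _ => K)
      ≤ 1 / (M.sys k pp).p := by
  have hcard : Fintype.card ((M.sys k pp).G (ℓ k + 1)) = (M.sys k pp).p :=
    (M.sys k pp).card_eq _ le_rfl
  refine (avg_mono fun K => ?_).trans_eq
    ((avg_ind_eq (1 : (M.sys k pp).G (ℓ k + 1))).trans (by rw [hcard]))
  refine avg_le_of_le fun ω => avg_le_of_le fun w => ind_mono fun hw => ?_
  obtain ⟨s, -, hs⟩ := (wins_trivialityTest_iff hmul _ _ _ _ _ _).1 hw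
  exact hs

theorem abs_avg_realKey_units_sub_le :
    |avg (fun h => avg fun x => avg fun r : (ZMod (M.sys k pp).p)ˣ × (ZMod (M.sys k pp).p)ˣ =>
        H.winProb nx m coins k pp h x r.1 (H.realKey k pp h x r.1))
      - avg fun h => avg fun x => avg fun r =>
        H.winProb nx m coins k pp h x r (H.realKey k pp h x r)| ≤ 1 / (M.sys k pp).p := by
  refine (abs_avg_sub_le (h := fun _ => 1 / ((M.sys k pp).p : ℝ)) fun h => ?_).trans_eq (avg_const _)
  refine (abs_avg_sub_le (h := fun _ => 1 / ((M.sys k pp).p : ℝ)) fun x => ?_).trans_eq (avg_const _)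
  rw [avg_prod]
  simp only [avg_const]
  exact abs_avg_units_sub_le
    (F := fun r => H.winProb nx m coins k pp h x r (H.realKey k pp h x r))
    (fun _ => GroupHash.winProb_nonneg _ _ _ _ _ _ _ _ _)
    (fun _ => GroupHash.winProb_le_one _ _ _ _ _ _ _ _ _)

/-- The four terms `1/p` come from the two exponents that are uniform units instead of residues, and
from the cases `h = 1` and `x = 0`. -/
theorem abs_avg_secondKey_units_sub_le :
    |avg (fun h => avg fun x => avg fun r : (ZMod (M.sys k pp).p)ˣ × (ZMod (M.sys k pp).p)ˣ =>
        H.winProb nx m coins k pp h x r.1 (H.secondKey k pp h x r.2))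
      - avg fun h => avg fun x => avg fun r => avg fun K =>
        H.winProb nx m coins k pp h x r fun _ _ => K|
    ≤ 4 * (1 / (M.sys k pp).p) + avg fun h => avg fun x => H.trivialProb nx m coins k pp h x := by
  have hcard : Fintype.card ((M.sys k pp).G 1) = (M.sys k pp).p :=
    (M.sys k pp).card_eq 1 (Nat.succ_le_succ (Nat.zero_le _))
  have h1 : 4 * (1 / ((M.sys k pp).p : ℝ))
      + avg (fun h => avg fun x => H.trivialProb nx m coins k pp h x)
      = avg fun h => avg fun x => 1 / ((M.sys k pp).p : ℝ) + (ind (h = 1) + ind (x = 0)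
        + H.trivialProb nx m coins k pp h x) + 1 / ((M.sys k pp).p : ℝ) := by
    simp only [avg_add, avg_const, avg_ind_eq, ZMod.card, hcard]
    ring
  rw [h1]
  refine abs_avg_sub_le fun h => abs_avg_sub_le fun x => ?_
  rw [avg_prod]
  have h2 : |avg (fun u : (ZMod (M.sys k pp).p)ˣ => avg fun v : (ZMod (M.sys k pp).p)ˣ =>
        H.winProb nx m coins k pp h x u (H.secondKey k pp h x v))
      - avg fun u : (ZMod (M.sys k pp).p)ˣ => avg fun y =>
        H.winProb nx m coins k pp h x u (H.secondKey k pp h x y)| ≤ 1 / (M.sys k pp).p :=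
    (abs_avg_sub_le (h := fun _ => 1 / ((M.sys k pp).p : ℝ))
      fun u : (ZMod (M.sys k pp).p)ˣ => abs_avg_units_sub_le
      (F := fun y => H.winProb nx m coins k pp h x u (H.secondKey k pp h x y))
      (fun _ => GroupHash.winProb_nonneg _ _ _ _ _ _ _ _ _)
      (fun _ => GroupHash.winProb_le_one _ _ _ _ _ _ _ _ _)).trans_eq (avg_const _)
  have h3 : |avg (fun u : (ZMod (M.sys k pp).p)ˣ => avg fun y =>
        H.winProb nx m coins k pp h x u (H.secondKey k pp h x y))
      - avg fun u : (ZMod (M.sys k pp).p)ˣ => avg fun K =>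
        H.winProb nx m coins k pp h x u fun _ _ => K|
      ≤ ind (h = 1) + ind (x = 0) + H.trivialProb nx m coins k pp h x :=
    (abs_avg_sub_le (h := fun _ => _) fun u : (ZMod (M.sys k pp).p)ˣ =>
      abs_avg_winProb_secondKey_sub_le h x u).trans_eq (avg_const _)
  have h4 := abs_avg_units_sub_le
    (F := fun r => avg fun K => H.winProb nx m coins k pp h x r fun _ _ => K)
    (fun _ => avg_nonneg fun _ => GroupHash.winProb_nonneg _ _ _ _ _ _ _ _ _)
    (fun _ => avg_le_of_le fun _ => GroupHash.winProb_le_one _ _ _ _ _ _ _ _ _)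
  exact (abs_sub_le _ _ _).trans (add_le_add ((abs_sub_le _ _ _).trans (add_le_add h2 h3)) h4)

end Security

theorem theorem5 (ℓ : ℕ → ℕ) (M : GroupGen fun k => ℓ k + 1) (H : GroupHash M ℓ)
    (hH : H.IsPolyMPHF 2) (hM : M.MDDH) :
    (multilinearIBKEM ℓ M H).AnonSSIDCPA := by
  intro A
  obtain ⟨fm, hfm, hmul⟩ := M.mul_eff
  have hinv := hM.negligible_inv_order fun k => Nat.succ_le_succ (Nat.zero_le (ℓ k))
  have h1 := negligible_winProb_sub hH hM A.polyTime_player A.queries A.coins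
  -- The same indistinguishability, for the triviality test: a uniform key is trivial only with
  -- probability `1/p`, so trivial hash values are submitted with negligible probability.
  have h2 := negligible_winProb_sub hH hM (polyTime_trivialityTest A.polyTime_player hfm A.queries)
    A.queries A.coins
  refine (((hinv.poly_mul 6).add h1.abs).add h2.abs).of_abs_le (Eventually.of_forall fun k => ?_)
  refine le_trans ?_ (le_abs_self _)
  rw [prob_game_multilinearIBKEM]
  have e1 := GroupGen.abs_avgParams_sub_le (M := M) (k := k) fun pp _ =>
    abs_avg_realKey_units_sub_le (H := H) (nx := A.player) (m := A.queries) (coins := A.coins) (k := k)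
      (pp := pp)
  have e2 := GroupGen.abs_avgParams_sub_le (M := M) (k := k) fun pp _ =>
    abs_avg_secondKey_units_sub_le (H := H) (nx := A.player) (m := A.queries) (coins := A.coins) (k := k)
      (pp := pp)
  have e3 := GroupGen.avgParams_mono (M := M) (k := k) fun pp hpp =>
    avg_mono fun h => avg_mono fun x => le_avg_of_le fun r =>
      trivialProb_le_winProb (H := H) (nx := A.player) (m := A.queries) (coins := A.coins) (k := k)
        (hmul k pp hpp _ le_rfl) h x r
  have e4 := GroupGen.avgParams_mono (M := M) (k := k) fun pp hpp =>
    avg_le_of_le fun h => avg_le_of_le fun x => avg_le_of_le fun r =>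
      avg_winProb_trivialityTest_le (H := H) (nx := A.player) (m := A.queries) (coins := A.coins) (k := k)
        (hmul k pp hpp _ le_rfl) h x r
  rw [GroupGen.avgParams_add, GroupGen.avgParams_mul_left] at e2
  have hI : 0 ≤ M.avgParams k fun pp => 1 / ((M.sys k pp).p : ℝ) :=
    GroupGen.avgParams_nonneg fun pp => by positivity
  -- `6 = 1 + 4 + 1`: one `I` for the first key, four for the second, one for `U'`. The factor `1/2`
  -- is given away.
  have key : ∀ {S R₀ R U T R' U' I : ℝ}, |R₀ - R| ≤ I → |S - U| ≤ 4 * I + T → T ≤ R' → U' ≤ I →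
      0 ≤ I → |1 / 2 + (S - R₀) * (1 / 2) - 1 / 2| ≤ 6 * I + |R - U| + |R' - U'| := by
    intro S R₀ R U T R' U' I e1 e2 e3 e4 hI
    have := le_abs_self (R - U)
    have := neg_abs_le (R - U)
    have := le_abs_self (R' - U')
    rw [abs_le] at e1 e2 ⊢
    constructor <;> linarith
  simp only [Polynomial.eval_ofNat, Nat.cast_ofNat]
  exact key e1 e2 e3 e4 hI
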